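/- All graphs are finite and simple, and a graph is $F$-free if it does not contain $F$ as a (not necessarily induced) subgraph. Let $ex(n,F)$ be the maximum number of edges of an $F$-free graph on $n$ vertices, and let $EX(n,F)$ be the family of all $F$-free graphs on $n$ vertices with exactly $ex(n,F)$ edges; these are called the extremal graphs. Let $P_k$ and $K_k$ be the path and the complete graph on $k$ vertices, $2P_7$ the disjoint union of two copies of $P_7$, $\overline{G}$ the complement of $G$, $G\cup H$ the disjoint union of $G$ and $H$, and $G+H$ the graph obtained from $G\cup H$ by joining every vertex of $G$ to every vertex of $H$. For $n\ge 14$ write $n-13=6t+r$ with integers $t\ge 0$ and $0\le r<6$, and put $[n,14,7]=\binom{13}{2}+t\binom{6}{2}+\binom{r}{2}$. Theorem. For every $n\ge 14$, $$[n,14,7]=\frac{5n+91+r(r-6)}{2}\qquad\text{and}\qquad ex(n,2P_7)=\max\{[n,14,7],\,5n-14\}.$$ Moreover, up to isomorphism, the extremal graphs, i.e. the members of $EX(n,2P_7)$, are exactly the following: - for $14\le n\le 21$, the graphs $K_{13}\cup H$ with $H\in EX(n-13,P_7)$; - for $n=22$, where $[22,14,7]=5\cdot 22-14=96$, the graphs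 $K_{13}\cup H$ with $H\in EX(9,P_7)$, and the graph $K_5+(K_2\cup\overline{K_{15}})$; - for $n\ge 23$, the single graph $K_5+(K_2\cup\overline{K_{n-7}})$. -/

import Mathlib

open SimpleGraph

/-- The number `[n, m, ℓ]`: writing `n = (m - 1) + t (ℓ - 1) + r` with `0 ≤ r < ℓ - 1`, it equals
`C(m - 1, 2) + t C(ℓ - 1, 2) + C(r, 2)`; if `n ≤ m - 1`, it equals `C(n, 2)`. -/
def pathBracket (n m ℓ : ℕ) : ℕ :=
  if n ≤ m - 1 then n.choose 2
  else (m - 1).choose 2 + ((n - (m - 1)) / (ℓ - 1)) * (ℓ - 1).choose 2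
    + ((n - (m - 1)) % (ℓ - 1)).choose 2

/-- The graph `2 P_k`: two disjoint copies of the path on `k` vertices. -/
abbrev twoPaths (k : ℕ) : SimpleGraph (Fin k ⊕ Fin k) :=
  pathGraph k ⊕g pathGraph k

/-- The join `G + H`: the disjoint union of `G` and `H` together with all edges between the
vertices of `G` and the vertices of `H`. -/
def graphJoin {V W : Type*} (G : SimpleGraph V) (H : SimpleGraph W) : SimpleGraph (V ⊕ W) :=
  (G ⊕g H) ⊔ completeBipartiteGraph V W

/-- `G` is an extremal graph for `F`, i.e. `G ∈ EX(n, F)` where `n` is the number of vertices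
of `G`: it does not contain `F` as a (not necessarily induced) subgraph, and it has `ex(n, F)`
edges. -/
def IsExtremalGraph {V W : Type*} [Fintype V] (F : SimpleGraph W) (G : SimpleGraph V) : Prop :=
  F.Free G ∧ G.edgeSet.ncard = extremalNumber (Fintype.card V) F

/-! Edges are counted twice throughout, as `degSum`, so the two competing values become
`twiceBracket n` and `10 * n - 28`. A graph without two disjoint seven-vertex paths is taken apart
by deleting vertices of minimum degree at most five. If minimum degree six is met while m ≥ 14
vertices remain, `degSum_le_of_six_le_degIn` bounds the degree sum by 7(m - 1), and reinserting the
deleted vertices, at most five edges each, leaves it below `10 * n - 28`. Otherwise fourteen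
vertices are reached, and these have no spanning path, since it would split into two halves.

Chvátal's degree condition for spanning paths now yields some k ≤ 6 such that k + 1 of the fourteen
degrees are at most k and 14 - k of them are at most 12 - k. For k = 5 and k = 6, a degree sum of
112 forces the join of K₅ with a single edge and isolated vertices: a denser or different pattern
leaves so few gaps between centres and outer vertices that Hall's theorem (`exists_slot_assignment`)
builds the two paths. A vertex reinserted into this join with five edges must be joined to the five
centres, so the join persists up to n vertices.

For k ≤ 4 the minimum degree is small and rises by at most one per reinsertion, so only a start with
degree sum at least `denseThreshold d` can catch up. For k = 0 and k = 1 this exhibits a nearly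
complete set of thirteen or twelve vertices. Either it leads to thirteen vertices without edges to
the rest, or there are too few edges; in the first case the rest has no seven-vertex path and
`degSum_le_sevenPathBound` applies. For k = 2, 3, 4 the first reinsertion already gives a
contradiction: the minimum degree either fails to rise, which costs too many edges, or rises, which
forces a regular closed set (`no_minDegree_jump`). -/

namespace SimpleGraph

open Finset
open scoped Classical

/-! ### Degree sums on vertex sets, and paths as lists. -/

section

variable {V : Type*}

/-- The number of neighbours of `v` in the finite set `A`. -/
noncomputable def degIn (G : SimpleGraph V) (A : Finset V) (v : V) : ℕ := #{w ∈ A | G.Adj v w}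

/-- The degree sum of the subgraph induced on `A`, that is, twice its number of edges. -/
noncomputable def degSum (G : SimpleGraph V) (A : Finset V) : ℕ := ∑ v ∈ A, G.degIn A v

variable {G : SimpleGraph V} {A B : Finset V} {v w : V}

lemma degIn_eq_sum (G : SimpleGraph V) (A : Finset V) (v : V) :
    G.degIn A v = ∑ w ∈ A, if G.Adj v w then 1 else 0 := by
  rw [degIn, Finset.card_filter]

lemma degIn_le_card (G : SimpleGraph V) (A : Finset V) (v : V) : G.degIn A v ≤ #A :=
  Finset.card_filter_le _ _

lemma degIn_mono (h : A ⊆ B) (v : V) : G.degIn A v ≤ G.degIn B v :=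
  Finset.card_le_card (Finset.filter_subset_filter _ h)

lemma degIn_mono_graph {K : SimpleGraph V} (h : G ≤ K) (A : Finset V) (v : V) :
    G.degIn A v ≤ K.degIn A v :=
  Finset.card_le_card (Finset.monotone_filter_right _ fun _ _ hw => h hw)

lemma degIn_union (h : Disjoint A B) (v : V) :
    G.degIn (A ∪ B) v = G.degIn A v + G.degIn B v := by
  simp only [degIn_eq_sum, Finset.sum_union h]

lemma degIn_erase_self (G : SimpleGraph V) (A : Finset V) (v : V) :
    G.degIn (A.erase v) v = G.degIn A v := by
  unfold degIn
  congr 1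
  ext w
  simp only [Finset.mem_filter, Finset.mem_erase]
  constructor
  · rintro ⟨⟨_, h⟩, h'⟩; exact ⟨h, h'⟩
  · rintro ⟨h, h'⟩; exact ⟨⟨h'.ne', h⟩, h'⟩

lemma degIn_erase (hw : w ∈ A) (v : V) :
    G.degIn A v = G.degIn (A.erase w) v + if G.Adj v w then 1 else 0 := by
  rw [degIn_eq_sum, degIn_eq_sum, Finset.sum_erase_add _ _ hw]

lemma degIn_insert (hw : w ∉ A) (v : V) :
    G.degIn (insert w A) v = G.degIn A v + if G.Adj v w then 1 else 0 := by
  rw [degIn_erase (Finset.mem_insert_self w A), Finset.erase_insert hw]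

lemma degIn_insert_self (G : SimpleGraph V) (A : Finset V) (v : V) :
    G.degIn (insert v A) v = G.degIn A v := by
  rw [← degIn_erase_self, ← degIn_erase_self G A, Finset.erase_insert_eq_erase]

lemma degIn_le_erase_add_one (hw : w ∈ A) (v : V) :
    G.degIn A v ≤ G.degIn (A.erase w) v + 1 := by
  rw [degIn_erase hw]; split_ifs <;> omega

lemma degIn_lt_card (hv : v ∈ A) : G.degIn A v < #A := by
  rw [← degIn_erase_self]
  exact (degIn_le_card _ _ _).trans_lt (Finset.card_erase_lt_of_mem hv)

lemma degIn_pos_iff : 0 < G.degIn A v ↔ ∃ w ∈ A, G.Adj v w := by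
  simp [degIn, Finset.card_pos, Finset.Nonempty]

lemma degIn_eq_zero_iff : G.degIn A v = 0 ↔ ∀ w ∈ A, ¬ G.Adj v w := by
  simp [degIn, Finset.filter_eq_empty_iff]

lemma degIn_eq_card_iff : G.degIn A v = #A ↔ ∀ w ∈ A, G.Adj v w := by
  simp [degIn, Finset.card_filter_eq_iff]

lemma sum_degIn_comm (G : SimpleGraph V) (A B : Finset V) :
    ∑ a ∈ A, G.degIn B a = ∑ b ∈ B, G.degIn A b := by
  simp only [degIn_eq_sum]
  rw [Finset.sum_comm]
  simp only [G.adj_comm]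

lemma degSum_union (h : Disjoint A B) :
    G.degSum (A ∪ B) = G.degSum A + G.degSum B + 2 * ∑ b ∈ B, G.degIn A b := by
  unfold degSum
  rw [Finset.sum_union h]
  simp only [degIn_union h, Finset.sum_add_distrib]
  rw [sum_degIn_comm G A B]
  ring

lemma degSum_sdiff (h : B ⊆ A) :
    G.degSum A = G.degSum B + G.degSum (A \ B) + 2 * ∑ v ∈ A \ B, G.degIn B v := by
  rw [← degSum_union Finset.disjoint_sdiff, Finset.union_sdiff_of_subset h]

lemma degSum_erase (hv : v ∈ A) :
    G.degSum A = G.degSum (A.erase v) + 2 * G.degIn A v := by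
  have h : A.erase v = A \ {v} := Finset.erase_eq A v
  have h' : Disjoint (A.erase v) {v} := by simp
  conv_lhs => rw [← Finset.insert_erase hv, Finset.insert_eq, Finset.union_comm]
  rw [degSum_union h', Finset.sum_singleton, degIn_erase_self]
  simp [degSum, degIn_eq_sum]

lemma degSum_insert (hv : v ∉ A) :
    G.degSum (insert v A) = G.degSum A + 2 * G.degIn A v := by
  rw [degSum_erase (Finset.mem_insert_self v A), Finset.erase_insert hv, degIn_insert_self]

lemma degSum_le (G : SimpleGraph V) (A : Finset V) : G.degSum A ≤ #A * (#A - 1) := by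
  rw [degSum, ← smul_eq_mul]
  exact Finset.sum_le_card_nsmul _ _ _ fun v hv => Nat.le_sub_one_of_lt (degIn_lt_card hv)

lemma degSum_mono_graph {K : SimpleGraph V} (h : G ≤ K) (A : Finset V) :
    G.degSum A ≤ K.degSum A :=
  Finset.sum_le_sum fun v _ => degIn_mono_graph h A v

lemma degSum_mono (h : A ⊆ B) : G.degSum A ≤ G.degSum B := by
  rw [degSum_sdiff h]; omega

lemma degSum_eq_iff : G.degSum A = #A * (#A - 1) ↔ ∀ v ∈ A, ∀ w ∈ A, v ≠ w → G.Adj v w := by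
  have h1 : ∀ v ∈ A, G.degIn A v ≤ #A - 1 := fun v hv => Nat.le_sub_one_of_lt (degIn_lt_card hv)
  have h2 : #A * (#A - 1) = ∑ v ∈ A, (#A - 1) := by simp
  rw [h2, degSum, Finset.sum_eq_sum_iff_of_le h1]
  refine forall₂_congr fun v hv => ?_
  rw [← degIn_erase_self, ← Finset.card_erase_of_mem hv, degIn_eq_card_iff]
  constructor
  · intro h w hw hne; exact h w (Finset.mem_erase.2 ⟨hne.symm, hw⟩)
  · intro h w hw; exact h w (Finset.mem_of_mem_erase hw) (Finset.ne_of_mem_erase hw).symm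

lemma degSum_univ [Fintype V] (G : SimpleGraph V) : G.degSum univ = 2 * G.edgeSet.ncard := by
  rw [Set.ncard_eq_toFinset_card', Set.toFinset_card, ← edgeFinset_card, ← sum_degrees_eq_twice_card_edges]
  refine Finset.sum_congr rfl fun v _ => ?_
  rw [← card_neighborFinset_eq_degree, degIn]
  congr 1
  ext w; simp

/-- `l` is the vertex list of a path of `G` with all vertices in `A`. -/
structure IsPathIn (G : SimpleGraph V) (A : Finset V) (l : List V) : Prop where
  chain : l.IsChain G.Adj
  nodup : l.Nodup
  subset : ∀ x ∈ l, x ∈ A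

/-- `G` has a path on `k` vertices, all of them in `A`. -/
def HasPathIn (G : SimpleGraph V) (A : Finset V) (k : ℕ) : Prop :=
  ∃ l, G.IsPathIn A l ∧ l.length = k

/-- `G` contains two vertex disjoint paths on seven vertices. -/
def HasTwoPaths (G : SimpleGraph V) : Prop :=
  ∃ l₁ l₂ : List V, l₁.length = 7 ∧ l₂.length = 7 ∧ l₁.IsChain G.Adj ∧ l₂.IsChain G.Adj ∧
    (l₁ ++ l₂).Nodup

lemma IsPathIn.mono {l : List V} (h : G.IsPathIn A l) (hAB : A ⊆ B) : G.IsPathIn B l :=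
  ⟨h.chain, h.nodup, fun x hx => hAB (h.subset x hx)⟩

lemma IsPathIn.length_le {l : List V} (h : G.IsPathIn A l) : l.length ≤ #A := by
  rw [← List.toFinset_card_of_nodup h.nodup]
  exact Finset.card_le_card fun x hx => h.subset x (List.mem_toFinset.1 hx)

lemma IsPathIn.reverse {l : List V} (h : G.IsPathIn A l) : G.IsPathIn A l.reverse :=
  ⟨by rw [List.isChain_reverse]; exact h.chain.imp fun _ _ hab => hab.symm,
    List.nodup_reverse.2 h.nodup, fun x hx => h.subset x (List.mem_reverse.1 hx)⟩

lemma HasPathIn.mono {k : ℕ} (h : G.HasPathIn A k) (hAB : A ⊆ B) : G.HasPathIn B k :=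
  let ⟨l, hl, hk⟩ := h
  ⟨l, hl.mono hAB, hk⟩

lemma IsPathIn.take {l : List V} (h : G.IsPathIn A l) (k : ℕ) : G.IsPathIn A (l.take k) :=
  ⟨h.chain.take k, h.nodup.sublist (List.take_sublist _ _),
    fun x hx => h.subset x (List.mem_of_mem_take hx)⟩

lemma IsPathIn.drop {l : List V} (h : G.IsPathIn A l) (k : ℕ) : G.IsPathIn A (l.drop k) :=
  ⟨h.chain.drop k, h.nodup.sublist (List.drop_sublist _ _),
    fun x hx => h.subset x (List.mem_of_mem_drop hx)⟩

lemma HasPathIn.of_le {j k : ℕ} (h : G.HasPathIn A k) (hjk : j ≤ k) : G.HasPathIn A j :=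
  let ⟨l, hl, hk⟩ := h
  ⟨l.take j, hl.take j, by rw [List.length_take]; omega⟩

lemma HasTwoPaths.of_path {l : List V} (hl : G.IsPathIn A l) (h : 14 ≤ l.length) :
    G.HasTwoPaths := by
  refine ⟨l.take 7, (l.drop 7).take 7, ?_, ?_, hl.chain.take 7, (hl.chain.drop 7).take 7, ?_⟩
  · simp; omega
  · simp; omega
  · have : (l.take 7 ++ (l.drop 7).take 7).Sublist (l.take 7 ++ l.drop 7) :=
      (List.take_sublist _ _).append_left _
    rw [List.take_append_drop] at this
    exact hl.nodup.sublist this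

lemma HasTwoPaths.of_hasPathIn (h : G.HasPathIn A 14) : G.HasTwoPaths :=
  let ⟨_, hl, hk⟩ := h
  HasTwoPaths.of_path hl hk.ge

lemma HasTwoPaths.of_disjoint (hA : G.HasPathIn A 7) (hB : G.HasPathIn B 7) (h : Disjoint A B) :
    G.HasTwoPaths := by
  obtain ⟨l, hl, hl7⟩ := hA
  obtain ⟨m, hm, hm7⟩ := hB
  refine ⟨l, m, hl7, hm7, hl.chain, hm.chain, hl.nodup.append hm.nodup fun x hx hx' => ?_⟩
  exact Finset.disjoint_left.1 h (hl.subset x hx) (hm.subset x hx')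

end

/-! ### Spanning paths: the conditions of Ore and Chvátal. -/

section

variable {V : Type*}
variable {G K : SimpleGraph V} {A B : Finset V} {u v w : V}

/-- Each consecutive pair is charged at most once, either to its first entry for `P` or to its
second for `Q`. The last entry starts no pair, so it must not satisfy `P`. -/
lemma countP_add_countP_tail_le (P Q : V → Prop) (x : V) (l : List V)
    (h : (x :: l).IsChain fun a b => ¬ (P a ∧ Q b)) (hlast : ∀ y ∈ (x :: l).getLast?, ¬ P y) :
    (x :: l).countP (fun a => decide (P a)) + l.countP (fun a => decide (Q a)) ≤ l.length := by
  induction l generalizing x with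
  | nil =>
    have : ¬ P x := hlast x (by simp)
    simp [this]
  | cons y t ih =>
    rw [List.isChain_cons_cons] at h
    have h1 := ih y h.2 (by simpa [List.getLast?_cons_cons] using hlast)
    rw [List.countP_cons (a := x), List.countP_cons (a := y) (p := fun a => decide (Q a)),
      List.length_cons]
    have h2 := h.1
    by_cases hP : P x <;> by_cases hQ : Q y <;> simp only [hP, hQ, decide_true, decide_false,
      if_true, if_false, Bool.false_eq_true, and_self, not_true_eq_false] at h2 ⊢ <;> omega

lemma countP_add_countP_lt (P Q : V → Prop) (l : List V) (hl : l ≠ [])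
    (h : l.IsChain fun a b => ¬ (P a ∧ Q b)) (hlast : ∀ y ∈ l.getLast?, ¬ P y)
    (hhead : ∀ y ∈ l.head?, ¬ Q y) :
    l.countP (fun a => decide (P a)) + l.countP (fun a => decide (Q a)) < l.length := by
  cases l with
  | nil => exact absurd rfl hl
  | cons x l =>
    have h1 := countP_add_countP_tail_le P Q x l h hlast
    have h2 : ¬ Q x := hhead x (by simp)
    rw [List.countP_cons (p := fun a => decide (Q a))]
    simp only [h2, decide_false, List.length_cons]
    simp; omega

lemma degIn_eq_countP {l : List V} (hl : l.Nodup) (hA : l.toFinset = A) (v : V) :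
    G.degIn A v = l.countP (fun a => decide (G.Adj v a)) := by
  subst hA
  rw [degIn, List.countP_eq_length_filter, ← List.toFinset_card_of_nodup (hl.filter _)]
  congr 1
  ext x; simp

lemma IsPathIn.toFinset_eq {l : List V} (h : G.IsPathIn A l) (hl : l.length = #A) :
    l.toFinset = A :=
  Finset.eq_of_subset_of_card_le (fun x hx => h.subset x (List.mem_toFinset.1 hx))
    (by rw [List.toFinset_card_of_nodup h.nodup, hl])

/-- Rotating the initial segment of a path in which one edge `uv` is missing. -/
lemma countP_initial_segment_lt (l₁ l₂ : List V) (u v : V)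
    (h₁ : (l₁ ++ [u]).IsChain G.Adj) (h₂ : (v :: l₂).IsChain G.Adj)
    (hno : ∀ l : List V, l.Perm (l₁ ++ [u] ++ v :: l₂) → ¬ l.IsChain G.Adj) :
    (l₁ ++ [u]).countP (fun a => decide (G.Adj u a)) +
      (l₁ ++ [u]).countP (fun a => decide (G.Adj v a)) < (l₁ ++ [u]).length := by
  refine countP_add_countP_lt (G.Adj u) (G.Adj v) _ (by simp) ?_ ?_ ?_
  · rw [List.isChain_iff_forall_rel_of_append_cons_cons]
    rintro a b p q hpq ⟨ha, hb⟩
    have hq : (b :: q).getLast? = some u := by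
      have := congrArg List.getLast? hpq
      simpa [List.getLast?_append, List.getLast?_cons_cons] using this.symm
    have hpq' : l₁ ++ [u] = (p ++ [a]) ++ (b :: q) := by rw [hpq]; simp
    rw [hpq'] at h₁
    -- Reversing the segment from `b` to `u` trades the edge `ab` and the missing edge `uv` for `au`
    -- and `bv`.
    refine hno ((p ++ [a]) ++ (b :: q).reverse ++ v :: l₂) ?_ ?_
    · rw [hpq']
      exact ((List.reverse_perm _).append_left _).append_right _
    · rw [List.isChain_append, List.isChain_append]
      refine ⟨⟨h₁.left_of_append, ?_, ?_⟩, h₂, ?_⟩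
      · rw [List.isChain_reverse]
        exact h₁.right_of_append.imp fun _ _ h => h.symm
      · intro x hx y hy
        rw [List.head?_reverse, hq] at hy
        simp at hx hy
        subst hx hy
        exact ha.symm
      · intro x hx y hy
        rw [List.getLast?_append, List.getLast?_reverse] at hx
        simp at hx hy
        subst hx hy
        exact hb.symm
  · intro y hy
    simp at hy
    subst hy
    exact G.loopless.irrefl _
  · intro y hy hvy
    refine hno ((l₁ ++ [u]).reverse ++ v :: l₂) ((List.reverse_perm _).append_right _) ?_
    rw [List.isChain_append]
    refine ⟨?_, h₂, ?_⟩
    · rw [List.isChain_reverse]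
      exact h₁.imp fun _ _ h => h.symm
    · intro x hx z hz
      rw [List.getLast?_reverse] at hx
      have hxy : x = y := Option.some.inj (hx.symm.trans hy)
      simp at hz
      subst hxy hz
      exact hvy.symm

lemma isChain_of_sup_edge {l : List V} (hl : l.IsChain (G ⊔ edge u v).Adj)
    (hu : u ∉ l ∨ v ∉ l) : l.IsChain G.Adj := by
  refine hl.imp_of_mem_imp ?_
  intro a b ha hb hab
  rw [sup_adj, edge_adj] at hab
  rcases hab with h | ⟨⟨rfl, rfl⟩ | ⟨rfl, rfl⟩, -⟩
  · exact h
  · tauto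
  · tauto

/-- Ore's lemma for spanning paths. -/
lemma degIn_add_degIn_of_sup_edge (hno : ¬ G.HasPathIn A #A)
    (huv : (G ⊔ edge u v).HasPathIn A #A) :
    G.degIn A u + G.degIn A v + 2 ≤ #A := by
  obtain ⟨l, hl, hlA⟩ := huv
  have hnot : ¬ l.IsChain G.Adj := fun h => hno ⟨l, ⟨h, hl.nodup, hl.subset⟩, hlA⟩
  have hno' : ∀ l' : List V, l'.Perm l → ¬ l'.IsChain G.Adj := fun l' hp h =>
    hno ⟨l', ⟨h, hp.nodup_iff.2 hl.nodup, fun x hx => hl.subset x (hp.mem_iff.1 hx)⟩,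
      hp.length_eq.trans hlA⟩
  rw [List.isChain_iff_forall_rel_of_append_cons_cons] at hnot
  push Not at hnot
  obtain ⟨a, b, p, q, hpq, hab⟩ := hnot
  have hadj : (G ⊔ edge u v).Adj a b :=
    (List.isChain_iff_forall_rel_of_append_cons_cons.1 hl.chain) hpq
  have hset : l.toFinset = A := hl.toFinset_eq hlA
  have key : ∀ u v : V, l = p ++ u :: v :: q → l.IsChain (G ⊔ edge u v).Adj →
      G.degIn A u + G.degIn A v + 2 ≤ #A := by
    intro u v hpq hch
    have hpq' : l = (p ++ [u]) ++ (v :: q) := by rw [hpq]; simp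
    have hnd := hl.nodup
    rw [hpq', List.nodup_append'] at hnd
    have hv : v ∉ p ++ [u] := fun h => hnd.2.2 h (by simp)
    have hu : u ∉ v :: q := fun h => hnd.2.2 (by simp) h
    rw [hpq'] at hch
    have h1 := isChain_of_sup_edge hch.left_of_append (Or.inr hv)
    have h2 := isChain_of_sup_edge hch.right_of_append (Or.inl hu)
    have c1 := countP_initial_segment_lt p q u v h1 h2 (by rw [← hpq']; exact hno')
    have h1' : (u :: p.reverse).IsChain G.Adj := by
      have := List.isChain_reverse.2 (h1.imp (S := fun a b => G.Adj b a) fun _ _ h => h.symm)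
      simpa using this
    have h2' : (q.reverse ++ [v]).IsChain G.Adj := by
      have := List.isChain_reverse.2 (h2.imp (S := fun a b => G.Adj b a) fun _ _ h => h.symm)
      simpa using this
    -- The same count beyond the missing edge, with the list read backwards. Each of the two strict
    -- inequalities saves one, hence the 2 in the conclusion.
    have c2 := countP_initial_segment_lt q.reverse p.reverse v u h2' h1' (by
      intro l' hp
      refine hno' l' (hp.trans ?_)
      have : q.reverse ++ [v] ++ u :: p.reverse = l.reverse := by rw [hpq]; simp
      rw [this]
      exact List.reverse_perm _)
    rw [degIn_eq_countP hl.nodup hset, degIn_eq_countP hl.nodup hset, ← hlA, hpq']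
    simp only [List.countP_append, List.countP_reverse, List.length_append, List.length_reverse,
      List.countP_cons, List.countP_nil, List.length_cons, List.length_nil] at c1 c2 ⊢
    omega
  rw [sup_adj, edge_adj] at hadj
  rcases hadj with h | ⟨⟨rfl, rfl⟩ | ⟨rfl, rfl⟩, -⟩
  · exact absurd h hab
  · exact key _ _ hpq hl.chain
  · have := key _ _ hpq (by rw [edge_comm]; exact hl.chain)
    omega

lemma hasPathIn_card_of_forall_adj (h : ∀ u ∈ A, ∀ v ∈ A, u ≠ v → G.Adj u v) :
    G.HasPathIn A #A := by
  refine ⟨A.toList, ⟨?_, A.nodup_toList, fun x hx => Finset.mem_toList.1 hx⟩, A.length_toList⟩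
  refine List.Pairwise.isChain (A.nodup_toList.imp_of_mem ?_)
  intro a b ha hb hab
  exact h a (Finset.mem_toList.1 ha) b (Finset.mem_toList.1 hb) hab

/-- A graph without spanning path on `A` extends to one in which any two nonadjacent vertices of
`A` have degree sum at most `#A - 2`. -/
lemma exists_saturated [Finite V] (hno : ¬ G.HasPathIn A #A) :
    ∃ K, G ≤ K ∧ ¬ K.HasPathIn A #A ∧ ∀ u ∈ A, ∀ v ∈ A, u ≠ v → ¬ K.Adj u v →
      K.degIn A u + K.degIn A v + 2 ≤ #A := by
  -- In an edge-maximal graph without a spanning path every new edge creates one, so Ore's lemma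
  -- applies to every nonadjacent pair.
  obtain ⟨K, hGK, hK⟩ := Finite.exists_le_maximal (p := fun K : SimpleGraph V => ¬ K.HasPathIn A #A) hno
  refine ⟨K, hGK, hK.1, fun u _ v _ huv hadj => degIn_add_degIn_of_sup_edge hK.1 ?_⟩
  by_contra hcon
  have := hK.2 hcon le_sup_left
  exact hadj (this (by rw [sup_adj, edge_adj]; exact Or.inr ⟨Or.inl ⟨rfl, rfl⟩, huv⟩))

/-- Chvátal's degree condition for spanning paths, with the saturated graph made explicit. -/
lemma exists_chvatal [Finite V] (hno : ¬ G.HasPathIn A #A) :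
    ∃ K, G ≤ K ∧ (∀ u ∈ A, ∀ v ∈ A, u ≠ v → ¬ K.Adj u v →
      K.degIn A u + K.degIn A v + 2 ≤ #A) ∧
    ∃ u ∈ A, ∃ v ∈ A, u ≠ v ∧ ¬ K.Adj u v ∧ K.degIn A u ≤ K.degIn A v ∧
      K.degIn A u + 1 ≤ #{x ∈ A | K.degIn A x ≤ K.degIn A u} ∧
      #A ≤ #{x ∈ A | K.degIn A x + K.degIn A u + 2 ≤ #A} + K.degIn A u := by
  obtain ⟨K, hGK, hK, hsum⟩ := exists_saturated hno
  refine ⟨K, hGK, hsum, ?_⟩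
  let S := (A ×ˢ A).filter fun p => p.1 ≠ p.2 ∧ ¬ K.Adj p.1 p.2
  have hS : S.Nonempty := by
    by_contra hcon
    refine hK (hasPathIn_card_of_forall_adj fun u hu v hv huv => ?_)
    by_contra hadj
    exact hcon ⟨(u, v), by simp [S, hu, hv, huv, hadj]⟩
  -- For a nonadjacent pair of maximum degree sum, every nonneighbour of the richer vertex `v` has
  -- degree at most that of the poorer vertex `u`. These nonneighbours give the first count, those
  -- of `u` the second.
  obtain ⟨p, hp, hmax⟩ := S.exists_max_image (fun p => K.degIn A p.1 + K.degIn A p.2) hS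
  obtain ⟨u, v, hu, hv, huv, hadj, hle, hmax⟩ : ∃ u v, u ∈ A ∧ v ∈ A ∧ u ≠ v ∧ ¬ K.Adj u v ∧
      K.degIn A u ≤ K.degIn A v ∧ ∀ x ∈ A, ∀ y ∈ A, x ≠ y → ¬ K.Adj x y →
        K.degIn A x + K.degIn A y ≤ K.degIn A u + K.degIn A v := by
    have hmax' : ∀ x ∈ A, ∀ y ∈ A, x ≠ y → ¬ K.Adj x y →
        K.degIn A x + K.degIn A y ≤ K.degIn A p.1 + K.degIn A p.2 := fun x hx y hy hxy hadj =>
      hmax (x, y) (by simp [S, hx, hy, hxy, hadj])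
    simp only [S, Finset.mem_filter, Finset.mem_product] at hp
    rcases le_total (K.degIn A p.1) (K.degIn A p.2) with h | h
    · exact ⟨p.1, p.2, hp.1.1, hp.1.2, hp.2.1, hp.2.2, h, hmax'⟩
    · refine ⟨p.2, p.1, hp.1.2, hp.1.1, hp.2.1.symm, fun h => hp.2.2 h.symm, h, ?_⟩
      intro x hx y hy hxy hadj
      rw [add_comm (K.degIn A p.2)]
      exact hmax' x hx y hy hxy hadj
  refine ⟨u, hu, v, hv, huv, hadj, hle, ?_, ?_⟩
  · have h1 : (A.filter fun x => ¬ K.Adj v x).erase v ⊆ {x ∈ A | K.degIn A x ≤ K.degIn A u} := by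
      intro x hx
      simp only [Finset.mem_erase, Finset.mem_filter] at hx ⊢
      have := hmax v hv x hx.2.1 hx.1.symm hx.2.2
      exact ⟨hx.2.1, by omega⟩
    have h2 := Finset.card_le_card h1
    rw [Finset.card_erase_of_mem (by simp [hv])] at h2
    have h3 := Finset.card_filter_add_card_filter_not (s := A) (fun x => K.Adj v x)
    have h4 := hsum u hu v hv huv hadj
    unfold degIn at h2 h4 ⊢
    omega
  · have h1 : (A.filter fun x => ¬ K.Adj u x) ⊆
        {x ∈ A | K.degIn A x + K.degIn A u + 2 ≤ #A} := by
      intro x hx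
      simp only [Finset.mem_filter] at hx ⊢
      refine ⟨hx.1, ?_⟩
      by_cases hxu : x = u
      · subst hxu
        have := hsum x hu v hv huv hadj
        omega
      · exact hsum x hx.1 u hu hxu fun h => hx.2 h.symm
    have h2 := Finset.card_le_card h1
    have h3 := Finset.card_filter_add_card_filter_not (s := A) (fun x => K.Adj u x)
    unfold degIn at h2 ⊢
    omega

/-- Compared with degree `N - 1`, each of at least `N - k` vertices loses `k + 1`, and the `k + 1`
poorest lose a further `N - 2 - 2 * k`. -/
lemma degSum_le_of_low_degrees {k N : ℕ} (hA : #A = N) (hkN : 2 * k + 2 ≤ N)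
    (h1 : k + 1 ≤ #{x ∈ A | G.degIn A x ≤ k})
    (h2 : N ≤ #{x ∈ A | G.degIn A x + k + 2 ≤ N} + k) :
    G.degSum A + (k + 1) * (N - k) + (k + 1) * (N - 2 - 2 * k) ≤ N * (N - 1) := by
  have key : ∀ x ∈ A, G.degIn A x + ((if G.degIn A x + k + 2 ≤ N then k + 1 else 0) +
      if G.degIn A x ≤ k then N - 2 - 2 * k else 0) ≤ N - 1 := by
    intro x hx
    have := degIn_lt_card (G := G) hx
    split_ifs <;> omega
  have hsum := Finset.sum_le_card_nsmul A _ (N - 1) key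
  rw [Finset.sum_add_distrib, Finset.sum_add_distrib, ← Finset.sum_filter, ← Finset.sum_filter,
    Finset.sum_const, Finset.sum_const, smul_eq_mul, smul_eq_mul, smul_eq_mul, hA] at hsum
  have e1 : (k + 1) * (N - k) ≤ #{x ∈ A | G.degIn A x + k + 2 ≤ N} * (k + 1) := by
    rw [mul_comm]; exact Nat.mul_le_mul_right _ (by omega)
  have e2 := Nat.mul_le_mul_right (N - 2 - 2 * k) h1
  have : G.degSum A = ∑ x ∈ A, G.degIn A x := rfl
  omega

lemma low_degrees_of_le {k N : ℕ} (hGK : G ≤ K)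
    (h1 : k + 1 ≤ #{x ∈ A | K.degIn A x ≤ k})
    (h2 : N ≤ #{x ∈ A | K.degIn A x + k + 2 ≤ N} + k) :
    k + 1 ≤ #{x ∈ A | G.degIn A x ≤ k} ∧ N ≤ #{x ∈ A | G.degIn A x + k + 2 ≤ N} + k := by
  refine ⟨h1.trans (Finset.card_le_card fun x => ?_),
    h2.trans (Nat.add_le_add_right (Finset.card_le_card fun x => ?_) _)⟩ <;>
  · simp only [Finset.mem_filter]
    have := degIn_mono_graph hGK A x
    intro hx
    exact ⟨hx.1, by omega⟩

end

/-! ### Longest paths, and graphs without a path on seven vertices. -/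

section

variable {V : Type*}
variable {G K : SimpleGraph V} {A B : Finset V} {u v w : V}

/-- A spanning cycle of a vertex list can be cut open at any vertex. -/
lemma exists_perm_chain_head {c : List V} (hc : c.IsChain G.Adj)
    (hcyc : ∀ b ∈ c.getLast?, ∀ a ∈ c.head?, G.Adj b a) {x : V} (hx : x ∈ c) :
    ∃ c', (x :: c').Perm c ∧ (x :: c').IsChain G.Adj := by
  obtain ⟨c₁, c₂, rfl⟩ := List.append_of_mem hx
  refine ⟨c₂ ++ c₁, ?_, ?_⟩
  · rw [← List.cons_append]; exact List.perm_append_comm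
  · rw [← List.cons_append, List.isChain_append]
    refine ⟨hc.right_of_append, hc.left_of_append, fun b hb a ha => hcyc b ?_ a ?_⟩
    · rw [List.getLast?_append]; rw [Option.mem_def] at hb; simp [hb]
    · rw [List.head?_append]; rw [Option.mem_def] at ha; simp [ha]

lemma IsPathIn.cons {l : List V} (h : G.IsPathIn A l) (hvA : v ∈ A) (hv : v ∉ l)
    (hadj : ∀ u ∈ l.head?, G.Adj v u) : G.IsPathIn A (v :: l) :=
  ⟨h.chain.cons hadj, List.nodup_cons.2 ⟨hv, h.nodup⟩, by
    intro x hx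
    rcases List.mem_cons.1 hx with rfl | hx
    · exact hvA
    · exact h.subset x hx⟩

lemma degIn_eq_countP_of_subset {l : List V} (hl : l.Nodup) (hA : ∀ x ∈ l, x ∈ A)
    (h : ∀ x ∈ A, G.Adj v x → x ∈ l) :
    G.degIn A v = l.countP (fun a => decide (G.Adj v a)) := by
  rw [← degIn_eq_countP hl rfl, degIn, degIn]
  congr 1
  ext x
  simp only [Finset.mem_filter, List.mem_toFinset]
  exact ⟨fun ⟨h1, h2⟩ => ⟨h x h1 h2, h2⟩, fun ⟨h1, h2⟩ => ⟨hA x h1, h2⟩⟩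

/-- The end vertices of a longest path have small degree sum, unless the path spans a component. -/
lemma longest_path_dichotomy {l : List V} (hl : G.IsPathIn A l)
    (hmax : ¬ G.HasPathIn A (l.length + 1)) (hu : l.head? = some u) (hv : l.getLast? = some v) :
    G.degIn A u + G.degIn A v + 1 ≤ l.length ∨ ∀ x ∈ l, ∀ y ∈ A, y ∉ l → ¬ G.Adj x y := by
  have hnb : ∀ l' : List V, l'.Perm l → l'.IsChain G.Adj → ∀ z, l'.head? = some z →
      ∀ x ∈ A, G.Adj z x → x ∈ l := by
    intro l' hp hch z hz x hx hadj
    by_contra hxl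
    have hpath : G.IsPathIn A l' := ⟨hch, hp.nodup_iff.2 hl.nodup,
      fun y hy => hl.subset y (hp.mem_iff.1 hy)⟩
    refine hmax ⟨x :: l', hpath.cons hx (fun h => hxl (hp.mem_iff.1 h)) ?_, by
      simp [hp.length_eq]⟩
    intro y hy
    rw [Option.mem_def, hz, Option.some_inj] at hy
    exact hy ▸ hadj.symm
  have hne : l ≠ [] := by rintro rfl; simp at hu
  -- A crossing is a consecutive pair `a`, `b` with `v` adjacent to `a` and `u` to `b`. Without
  -- crossings the counting lemma bounds the degree sum. A crossing closes the path into a cycle;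
  -- cutting it open at a vertex with a neighbour outside would give a longer path.
  by_cases hcr : l.IsChain fun a b => ¬ (G.Adj v a ∧ G.Adj u b)
  · left
    have h := countP_add_countP_lt (G.Adj v) (G.Adj u) l hne hcr
      (by intro y hy; rw [Option.mem_def, hv, Option.some_inj] at hy; subst hy
          exact G.loopless.irrefl _)
      (by intro y hy; rw [Option.mem_def, hu, Option.some_inj] at hy; subst hy
          exact G.loopless.irrefl _)
    rw [degIn_eq_countP_of_subset hl.nodup hl.subset (hnb l (List.Perm.refl l) hl.chain u hu),
      degIn_eq_countP_of_subset hl.nodup hl.subset (hnb l.reverse (List.reverse_perm _)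
        hl.reverse.chain v (by rw [List.head?_reverse, hv]))]
    omega
  · right
    rw [List.isChain_iff_forall_rel_of_append_cons_cons] at hcr
    push Not at hcr
    obtain ⟨a, b, p, q, hpq, hva, hub⟩ := hcr
    have hpq' : l = (p ++ [a]) ++ (b :: q) := by rw [hpq]; simp
    have hch := hl.chain
    rw [hpq'] at hch
    have hlast : (b :: q).getLast? = some v := by
      rw [hpq', List.getLast?_append] at hv
      simpa [List.getLast?_cons] using hv
    have hperm : ((p ++ [a]) ++ (b :: q).reverse).Perm l := by
      rw [hpq']; exact (List.reverse_perm _).append_left _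
    have hc : ((p ++ [a]) ++ (b :: q).reverse).IsChain G.Adj := by
      rw [List.isChain_append]
      refine ⟨hch.left_of_append, ?_, ?_⟩
      · rw [List.isChain_reverse]
        exact hch.right_of_append.imp fun _ _ h => h.symm
      · intro x hx y hy
        rw [List.head?_reverse, hlast] at hy
        simp at hx hy
        subst hx hy
        exact hva.symm
    intro x hx y hy hyl hadj
    obtain ⟨c', hp, hc'⟩ := exists_perm_chain_head hc (by
      intro z hz t ht
      have hz' : z = b := by
        rw [List.getLast?_append, List.getLast?_reverse] at hz
        simpa using hz.symm
      have ht' : t = u := by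
        have : ((p ++ [a]) ++ (b :: q).reverse).head? = l.head? := by
          rw [hpq', List.head?_append, List.head?_append]
          cases p <;> simp
        rw [this, hu] at ht
        simpa using ht.symm
      rw [hz', ht']
      exact hub.symm) (hperm.mem_iff.2 hx)
    exact hyl (hnb _ (hp.trans hperm) hc' x rfl y hy hadj)

lemma exists_longest_path (hA : A.Nonempty) :
    ∃ l, G.IsPathIn A l ∧ ¬ G.HasPathIn A (l.length + 1) ∧ l ≠ [] := by
  obtain ⟨a, ha⟩ := hA
  have h1 : G.HasPathIn A 1 := ⟨[a], ⟨List.isChain_singleton a, List.nodup_singleton a, by simpa⟩, rfl⟩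
  have hb : ∀ k, G.HasPathIn A k → k ≤ #A := fun k ⟨l, hl, hk⟩ => hk ▸ hl.length_le
  have h2 := Nat.findGreatest_spec (P := fun k => G.HasPathIn A k) (hb 1 h1) h1
  obtain ⟨l, hl, hk⟩ := h2
  have h3 : 1 ≤ Nat.findGreatest (fun k => G.HasPathIn A k) (#A) :=
    Nat.le_findGreatest (hb 1 h1) h1
  refine ⟨l, hl, fun h => ?_, fun h => by simp [h] at hk; omega⟩
  have := Nat.le_findGreatest (P := fun k => G.HasPathIn A k) (hb _ h) h
  omega

/-- A longest path has at most six vertices. If it does not span a component, the degrees of its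
ends add up to at most five, so one of them is at most two. -/
lemma exists_closed_or_degIn_le_two (hA : A.Nonempty) (h7 : ¬ G.HasPathIn A 7) :
    (∃ C ⊆ A, C.Nonempty ∧ #C ≤ 6 ∧ ∀ x ∈ A \ C, G.degIn C x = 0) ∨
      ∃ v ∈ A, G.degIn A v ≤ 2 := by
  obtain ⟨l, hl, hmax, hne⟩ := exists_longest_path (G := G) hA
  have hlen : l.length ≤ 6 := by
    by_contra hcon
    exact h7 (HasPathIn.of_le ⟨l, hl, rfl⟩ (by omega))
  obtain ⟨u, hu⟩ := Option.ne_none_iff_exists'.1 (fun h => hne (List.head?_eq_none_iff.1 h))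
  obtain ⟨v, hv⟩ := Option.ne_none_iff_exists'.1 (fun h => hne (List.getLast?_eq_none_iff.1 h))
  rcases longest_path_dichotomy hl hmax hu hv with h | h
  · right
    by_cases h2 : G.degIn A u ≤ 2
    · exact ⟨u, hl.subset u (List.mem_of_head? hu), h2⟩
    · exact ⟨v, hl.subset v (List.mem_of_getLast? hv), by omega⟩
  · left
    refine ⟨l.toFinset, fun x hx => hl.subset x (List.mem_toFinset.1 hx), ?_, ?_, ?_⟩
    · exact ⟨u, List.mem_toFinset.2 (List.mem_of_head? hu)⟩
    · exact (List.toFinset_card_le l).trans hlen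
    · intro x hx
      rw [degIn_eq_zero_iff]
      intro y hy hadj
      rw [Finset.mem_sdiff, List.mem_toFinset] at hx
      exact h y (List.mem_toFinset.1 hy) x hx.1 hx.2 hadj.symm

lemma degSum_of_closed {C : Finset V} (hC : C ⊆ A) (h : ∀ x ∈ A \ C, G.degIn C x = 0) :
    G.degSum A = G.degSum C + G.degSum (A \ C) := by
  rw [degSum_sdiff hC, Finset.sum_eq_zero h, mul_zero, add_zero]

/-- The Erdős–Gallai bound. By induction, a closed set of at most six vertices contributes at most
five per vertex, and a vertex of degree at most two contributes at most four. -/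
lemma degSum_le_five_mul_card (h7 : ¬ G.HasPathIn A 7) : G.degSum A ≤ 5 * #A := by
  induction hn : #A using Nat.strong_induction_on generalizing A with
  | _ n ih =>
  subst hn
  rcases A.eq_empty_or_nonempty with rfl | hA
  · simp [degSum]
  rcases exists_closed_or_degIn_le_two hA h7 with ⟨C, hCA, hCne, hC6, hC⟩ | ⟨v, hv, hdeg⟩
  · have h1 := ih #(A \ C) (by
      rw [Finset.card_sdiff_of_subset hCA]
      have := Finset.card_pos.2 hCne
      have := Finset.card_le_card hCA
      omega) (fun h => h7 (h.mono Finset.sdiff_subset)) rfl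
    rw [degSum_of_closed hCA hC]
    have h2 := degSum_le G C
    have h3 := Finset.card_sdiff_add_card_eq_card hCA
    have h4 : #C * (#C - 1) ≤ #C * 5 := Nat.mul_le_mul_left _ (by omega)
    omega
  · have h1 := ih #(A.erase v) (Finset.card_erase_lt_of_mem hv)
      (fun h => h7 (h.mono (Finset.erase_subset _ _))) rfl
    rw [degSum_erase hv]
    have := Finset.card_erase_add_one hv
    omega

/-- Twice the number of edges of the disjoint union of copies of `K₆` and one smaller complete
graph, on `m` vertices. -/
def sevenPathBound (m : ℕ) : ℕ := m / 6 * 30 + m % 6 * (m % 6 - 1)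

/-- The induction of the Erdős–Gallai bound, made exact for small orders. Ten vertices suffice: this
is needed for thirteen vertices removed from at most 23, or twelve from at most 22. -/
lemma degSum_le_sevenPathBound [Finite V] (h7 : ¬ G.HasPathIn A 7) (hA10 : #A ≤ 10) :
    G.degSum A ≤ sevenPathBound #A := by
  induction hn : #A using Nat.strong_induction_on generalizing A with
  | _ n ih =>
  rcases Nat.lt_or_ge n 7 with hn6 | hn7
  · have := degSum_le G A
    rw [hn] at this
    refine this.trans ?_
    interval_cases n <;> decide
  -- Chvátal's condition on seven vertices: k = 0 gives an isolated vertex and at most 30, while k =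
  -- 1 and k = 2 both give at most 24.
  have chv : ∀ B ⊆ A, #B = 7 → G.degSum B ≤ 24 ∨ G.degSum B ≤ 30 ∧ ∃ x ∈ B, G.degIn B x = 0 := by
    intro B hBA hB
    obtain ⟨K, hGK, hsum, u, hu, v, hv, huv, hadj, hle, h1, h2⟩ :=
      exists_chvatal (G := G) (A := B) (by rw [hB]; exact fun h => h7 (h.mono hBA))
    have hk : 2 * K.degIn B u + 2 ≤ 7 := by
      have := hsum u hu v hv huv hadj
      omega
    obtain ⟨h1', h2'⟩ := low_degrees_of_le hGK h1 h2
    rw [hB] at h2'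
    have h3 := degSum_le_of_low_degrees hB hk h1' h2'
    generalize K.degIn B u = k at h1' h3 hk
    have : k ≤ 2 := by omega
    interval_cases k
    · right
      refine ⟨by omega, ?_⟩
      obtain ⟨x, hx⟩ := Finset.card_pos.1 (by omega : 0 < #{x ∈ B | G.degIn B x ≤ 0})
      rw [Finset.mem_filter] at hx
      exact ⟨x, hx.1, by omega⟩
    · left; omega
    · left; omega
  rcases Nat.lt_or_ge 7 n with hn8 | hn8
  swap
  · obtain rfl : n = 7 := by omega
    have : sevenPathBound 7 = 30 := rfl
    rcases chv A subset_rfl hn with h | h <;> omega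
  have hA : A.Nonempty := Finset.card_pos.1 (by omega)
  rcases exists_closed_or_degIn_le_two hA h7 with ⟨C, hCA, hCne, hC6, hC⟩ | ⟨v, hv, hdeg⟩
  · have hCpos := Finset.card_pos.2 hCne
    have h3 := Finset.card_sdiff_add_card_eq_card hCA
    have h1 := ih #(A \ C) (by omega) (fun h => h7 (h.mono Finset.sdiff_subset)) (by omega) rfl
    rw [degSum_of_closed hCA hC]
    have h2 := degSum_le G C
    have key : ∀ n ≤ 10, 7 < n → ∀ c ≤ 6, 0 < c → c * (c - 1) + sevenPathBound (n - c) ≤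
        sevenPathBound n := by decide
    have := key n (by omega) hn8 #C hC6 hCpos
    rw [show n - #C = #(A \ C) by omega] at this
    omega
  · have h3 := Finset.card_erase_add_one hv
    have h1 := ih #(A.erase v) (by omega) (fun h => h7 (h.mono (Finset.erase_subset _ _)))
      (by omega) rfl
    rw [degSum_erase hv]
    rw [show #(A.erase v) = n - 1 by omega] at h1
    have e7 : sevenPathBound 7 = 30 := rfl
    have e8 : sevenPathBound 8 = 32 := rfl
    have e9 : sevenPathBound 9 = 36 := rfl
    have e10 : sevenPathBound 10 = 42 := rfl
    have hn10 : n ≤ 10 := by omega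
    interval_cases n
    -- On eight vertices a deleted vertex of degree two would allow 34 instead of 32. But if all
    -- degrees are at least two, the seven remaining vertices include no isolated one, and the
    -- sharper bound 24 applies.
    · norm_num at h1
      by_cases hmin : ∃ x ∈ A, G.degIn A x ≤ 1
      · obtain ⟨x, hx, hx1⟩ := hmin
        have h4 := Finset.card_erase_add_one hx
        have h5 := ih #(A.erase x) (by omega) (fun h => h7 (h.mono (Finset.erase_subset _ _)))
          (by omega) rfl
        rw [show #(A.erase x) = 7 by omega] at h5
        have := degSum_erase (G := G) hx
        have := degSum_erase (G := G) hv
        omega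
      · push Not at hmin
        rcases chv (A.erase v) (Finset.erase_subset _ _) (by omega) with h | ⟨-, x, hx, hx0⟩
        · omega
        · have := hmin x (Finset.mem_of_mem_erase hx)
          have := degIn_le_erase_add_one (G := G) hv x
          omega
    · norm_num at h1; omega
    · norm_num at h1; omega

end

/-! ### Graphs of minimum degree six. -/

section

variable {V : Type*}
variable {G K : SimpleGraph V} {A B H : Finset V} {u v w : V}

/-- A closed set of at most six vertices has degrees at most five, and degrees at most two are
excluded outright. -/
lemma hasPathIn_seven_of_six_le_degIn (hA : A.Nonempty) (h6 : ∀ x ∈ A, 6 ≤ G.degIn A x) :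
    G.HasPathIn A 7 := by
  by_contra h7
  rcases exists_closed_or_degIn_le_two hA h7 with ⟨C, hCA, ⟨x, hx⟩, hC6, hC⟩ | ⟨v, hv, hdeg⟩
  · have h1 := h6 x (hCA hx)
    rw [← Finset.union_sdiff_of_subset hCA, degIn_union Finset.disjoint_sdiff] at h1
    have h2 : G.degIn (A \ C) x = 0 := by
      rw [degIn_eq_zero_iff]
      intro y hy hadj
      exact degIn_eq_zero_iff.1 (hC y hy) x hx hadj.symm
    have := degIn_lt_card (G := G) hx
    omega
  · have := h6 v hv
    omega

lemma getLast?_take_succ {l : List V} {i : ℕ} {y : V} (h : l[i]? = some y) :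
    (l.take (i + 1)).getLast? = some y := by
  rw [List.take_add_one, h]
  simp

lemma countP_eq_sum_range (p : V → Prop) (l : List V) :
    l.countP (fun y => decide (p y)) =
      ∑ i ∈ range l.length, l[i]?.elim 0 fun y => if p y then 1 else 0 := by
  induction l with
  | nil => simp
  | cons x l ih =>
    rw [List.length_cons, Finset.sum_range_succ', List.countP_cons, ih]
    simp

/-- If both ends of a path `q` outside a path `p` are adjacent to vertices of `p`, then `q` can be
inserted between them. -/
lemma IsPathIn.insert_path {p q : List V} {i j : ℕ} {x y a b : V} (hp : G.IsPathIn A p)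
    (hq : G.IsPathIn A q) (hpq : p.Disjoint q) (hi : p[i]? = some x) (hj : p[j]? = some y)
    (hij : i < j) (ha : q.head? = some a) (hb : q.getLast? = some b)
    (hax : G.Adj a x) (hby : G.Adj b y) :
    G.HasPathIn A (i + 1 + q.length + (p.length - j)) := by
  have hi' : i < p.length := (List.getElem?_eq_some_iff.1 hi).1
  refine ⟨p.take (i + 1) ++ q ++ p.drop j, ⟨?_, ?_, ?_⟩, ?_⟩
  · rw [List.isChain_append, List.isChain_append]
    refine ⟨⟨hp.chain.take _, hq.chain, ?_⟩, hp.chain.drop _, ?_⟩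
    · intro s hs t ht
      rw [getLast?_take_succ hi] at hs
      rw [ha] at ht
      simp at hs ht
      subst hs ht
      exact hax.symm
    · intro s hs t ht
      rw [List.getLast?_append, hb] at hs
      rw [List.head?_drop, hj] at ht
      simp at hs ht
      subst hs ht
      exact hby
  · have hsub : (p.take (i + 1) ++ p.drop j).Sublist p := by
      conv_rhs => rw [← List.take_append_drop (i + 1) p]
      exact (List.Sublist.refl _).append (List.drop_sublist_drop_left _ (by omega))
    have h1 : (p.take (i + 1) ++ p.drop j ++ q).Nodup :=
      (hp.nodup.sublist hsub).append hq.nodup fun s hs hs' => hpq (hsub.subset hs) hs'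
    refine (List.Perm.nodup_iff ?_).1 h1
    rw [List.append_assoc, List.append_assoc]
    exact List.perm_append_comm.append_left _
  · intro s hs
    rw [List.mem_append, List.mem_append] at hs
    rcases hs with (hs | hs) | hs
    · exact hp.subset s (List.mem_of_mem_take hs)
    · exact hq.subset s hs
    · exact hp.subset s (List.mem_of_mem_drop hs)
  · simp; omega

lemma IsPathIn.append {p q : List V} (hp : G.IsPathIn A p)
    (hq : G.IsPathIn A q) (hpq : p.Disjoint q)
    (h : ∀ x ∈ p.getLast?, ∀ y ∈ q.head?, G.Adj x y) : G.IsPathIn A (p ++ q) :=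
  ⟨hp.chain.append hq.chain h, hp.nodup.append hq.nodup hpq, fun x hx =>
    (List.mem_append.1 hx).elim (hp.subset x) (hq.subset x)⟩

/-- The indicators `a` and `b` record where the two ends of a path on `k` vertices attach to a path
on thirteen. The allowed positions lie in {1,…,4}, {6}, {8,…,11}, shrinking from both outer sides as
`k` grows. Without two consecutive positions, at most 5, 5, 3, 3, 1 remain for `k` = 1,…,5, against
the required `7 - k`. Equality occurs for `k` = 2 and 4 only, where both ends use the same positions
and `hab` fails. -/
lemma attachment_arith (a b : ℕ → ℕ) (k : ℕ) (hk1 : 1 ≤ k) (hk6 : k ≤ 6)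
    (ha : ∀ i, a i ≤ 1) (hb : ∀ i, b i ≤ 1)
    (ha1 : ∀ i < 13, i < k ∨ 13 ≤ i + k → a i = 0) (hb1 : ∀ i < 13, i < k ∨ 13 ≤ i + k → b i = 0)
    (ha5 : a 5 = 0) (ha7 : a 7 = 0) (hb5 : b 5 = 0) (hb7 : b 7 = 0)
    (haa : ∀ i < 12, a i + a (i + 1) ≤ 1) (hbb : ∀ i < 12, b i + b (i + 1) ≤ 1)
    (hab : ∀ i j, i < j → j ≤ i + k → j < 13 → a i + b j ≤ 1)
    (hsa : 7 ≤ k + ∑ i ∈ range 13, a i) (hsb : 7 ≤ k + ∑ i ∈ range 13, b i) :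
    k = 6 ∧ ∀ i < 13, i ≠ 6 → a i = 0 := by
  simp only [Finset.sum_range_succ, Finset.sum_range_zero] at hsa hsb
  have a0 := ha1 0 (by norm_num) (by omega)
  have a12 := ha1 12 (by norm_num) (by omega)
  have b0 := hb1 0 (by norm_num) (by omega)
  have b12 := hb1 12 (by norm_num) (by omega)
  have p1 : a 1 + a 2 ≤ 1 := haa 1 (by norm_num)
  have p2 : a 2 + a 3 ≤ 1 := haa 2 (by norm_num)
  have p3 : a 3 + a 4 ≤ 1 := haa 3 (by norm_num)
  have p8 : a 8 + a 9 ≤ 1 := haa 8 (by norm_num)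
  have p9 : a 9 + a 10 ≤ 1 := haa 9 (by norm_num)
  have p10 : a 10 + a 11 ≤ 1 := haa 10 (by norm_num)
  have q3 : b 3 + b 4 ≤ 1 := hbb 3 (by norm_num)
  have q2 : b 2 + b 3 ≤ 1 := hbb 2 (by norm_num)
  have q8 : b 8 + b 9 ≤ 1 := hbb 8 (by norm_num)
  have q9 : b 9 + b 10 ≤ 1 := hbb 9 (by norm_num)
  have a6 := ha 6
  have b6 := hb 6
  have hkk : k = 1 ∨ 2 ≤ k := by omega
  rcases hkk with rfl | hk2
  · omega
  have a1 := ha1 1 (by norm_num) (by omega)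
  have a11 := ha1 11 (by norm_num) (by omega)
  have b1 := hb1 1 (by norm_num) (by omega)
  have b11 := hb1 11 (by norm_num) (by omega)
  have hkk : k = 2 ∨ 3 ≤ k := by omega
  rcases hkk with rfl | hk3
  · have := hab 2 4 (by norm_num) (by norm_num) (by norm_num)
    omega
  have a2 := ha1 2 (by norm_num) (by omega)
  have a10 := ha1 10 (by norm_num) (by omega)
  have b2 := hb1 2 (by norm_num) (by omega)
  have b10 := hb1 10 (by norm_num) (by omega)
  have hkk : k = 3 ∨ 4 ≤ k := by omega
  rcases hkk with rfl | hk4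
  · omega
  have a3 := ha1 3 (by norm_num) (by omega)
  have a9 := ha1 9 (by norm_num) (by omega)
  have b3 := hb1 3 (by norm_num) (by omega)
  have b9 := hb1 9 (by norm_num) (by omega)
  have a4 := ha 4
  have a8 := ha 8
  have b4 := hb 4
  have b8 := hb 8
  have hkk : k = 4 ∨ 5 ≤ k := by omega
  rcases hkk with rfl | hk5
  · have := hab 4 6 (by norm_num) (by norm_num) (by norm_num)
    omega
  have a4 := ha1 4 (by norm_num) (by omega)
  have a8 := ha1 8 (by norm_num) (by omega)
  refine ⟨by omega, fun i hi hi6 => ?_⟩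
  interval_cases i <;> first | assumption | omega

/-- The number of the first vertices adjacent to `w` at position `i` of the list `p`: `0` or `1`. -/
noncomputable def adjAt (G : SimpleGraph V) (p : List V) (w : V) (i : ℕ) : ℕ :=
  p[i]?.elim 0 fun y => if G.Adj w y then 1 else 0

lemma adjAt_le_one (G : SimpleGraph V) (p : List V) (w : V) (i : ℕ) : G.adjAt p w i ≤ 1 := by
  unfold adjAt
  cases p[i]? with
  | none => simp
  | some y => simp only [Option.elim_some]; split_ifs <;> omega

lemma adjAt_eq_zero {p : List V} {i : ℕ} (h : ∀ y, p[i]? = some y → ¬ G.Adj w y) :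
    G.adjAt p w i = 0 := by
  unfold adjAt
  cases hy : p[i]? with
  | none => simp
  | some y => simp [h y hy]

lemma exists_of_adjAt_pos {p : List V} {i : ℕ} (h : 0 < G.adjAt p w i) :
    ∃ y, p[i]? = some y ∧ G.Adj w y := by
  by_contra hcon
  push Not at hcon
  have := adjAt_eq_zero hcon
  omega

lemma insert_path_adjAt {p q : List V} {i j : ℕ} {a b : V} (hp : G.IsPathIn A p)
    (h14 : ¬ G.HasPathIn A 14) (hp13 : p.length = 13)
    (hq : G.IsPathIn A q) (hpq : p.Disjoint q)
    (hij : i < j) (hjk : j ≤ i + q.length) (hj : j < 13)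
    (ha : q.head? = some a) (hb : q.getLast? = some b) :
    G.adjAt p a i + G.adjAt p b j ≤ 1 := by
  by_contra hcon
  have h1 := adjAt_le_one G p a i
  have h2 := adjAt_le_one G p b j
  obtain ⟨x, hx, hax⟩ := exists_of_adjAt_pos (G := G) (p := p) (w := a) (i := i) (by omega)
  obtain ⟨y, hy, hby⟩ := exists_of_adjAt_pos (G := G) (p := p) (w := b) (i := j) (by omega)
  exact h14 ((hp.insert_path hq hpq hx hy hij ha hb hax hby).of_le (by omega))

/-- Attaching too close to an end of `p` yields fourteen vertices in a row. Attaching at position 5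
or 7 completes one half of `p` to seven vertices while the other half has seven already. Two
consecutive attachments would let `a` be inserted. -/
lemma end_attachment {p q : List V} {a : V} (hp : G.IsPathIn A p) (hG : ¬ G.HasTwoPaths)
    (hp13 : p.length = 13) (hq : G.IsPathIn A q) (hpq : p.Disjoint q) (ha : q.head? = some a) :
    (∀ i < 13, i < q.length ∨ 13 ≤ i + q.length → G.adjAt p a i = 0) ∧ G.adjAt p a 5 = 0 ∧
      G.adjAt p a 7 = 0 ∧ ∀ i < 12, G.adjAt p a i + G.adjAt p a (i + 1) ≤ 1 := by
  have haq : a ∈ q := List.mem_of_head? ha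
  have hap : a ∉ p := fun h => hpq h haq
  have haA : a ∈ A := hq.subset a haq
  have h14 : ¬ G.HasPathIn A 14 := fun h => hG (.of_hasPathIn h)
  have hsing : G.IsPathIn A [a] := ⟨List.isChain_singleton a, List.nodup_singleton a, by simpa⟩
  have hpsing : p.Disjoint [a] := by simpa using hap
  have hpnd := hp.nodup
  refine ⟨fun i hi h => adjAt_eq_zero fun y hy hadj => ?_, adjAt_eq_zero fun y hy hadj => ?_,
    adjAt_eq_zero fun y hy hadj => ?_, fun i hi => ?_⟩
  · rcases h with h | h
    · refine h14 (HasPathIn.of_le ⟨q.reverse ++ p.drop i, hq.reverse.append (hp.drop i) ?_ ?_, rfl⟩ ?_)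
      · intro x hx hx'
        exact hpq (List.mem_of_mem_drop hx') (List.mem_reverse.1 hx)
      · intro s hs t ht
        rw [List.getLast?_reverse, ha] at hs
        rw [List.head?_drop, hy] at ht
        simp at hs ht
        subst hs ht
        exact hadj
      · simp; omega
    · refine h14 (HasPathIn.of_le ⟨p.take (i + 1) ++ q, (hp.take _).append hq ?_ ?_, rfl⟩ ?_)
      · intro x hx hx'
        exact hpq (List.mem_of_mem_take hx) hx'
      · intro s hs t ht
        rw [getLast?_take_succ hy] at hs
        rw [ha] at ht
        simp at hs ht
        subst hs ht
        exact hadj.symm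
      · simp; omega
  · refine hG ⟨p.take 6 ++ [a], p.drop 6, by simp; omega, by simp; omega, ?_, hp.chain.drop _, ?_⟩
    · refine (hp.chain.take _).append (List.isChain_singleton a) ?_
      intro s hs t ht
      rw [getLast?_take_succ hy] at hs
      simp at hs ht
      subst hs ht
      exact hadj.symm
    · have h1 : (p.take 6 ++ p.drop 6 ++ [a]).Nodup := by
        rw [List.take_append_drop]
        exact hpnd.append (List.nodup_singleton a) hpsing
      refine (List.Perm.nodup_iff ?_).1 h1
      rw [List.append_assoc, List.append_assoc]
      exact List.perm_append_comm.append_left _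
  · refine hG ⟨p.take 7, [a] ++ p.drop 7, by simp; omega, by simp; omega, hp.chain.take _, ?_, ?_⟩
    · refine (List.isChain_singleton a).append (hp.chain.drop _) ?_
      intro s hs t ht
      rw [List.head?_drop, hy] at ht
      simp at hs ht
      subst hs ht
      exact hadj
    · have h1 : (p.take 7 ++ p.drop 7 ++ [a]).Nodup := by
        rw [List.take_append_drop]
        exact hpnd.append (List.nodup_singleton a) hpsing
      refine (List.Perm.nodup_iff ?_).1 h1
      rw [List.append_assoc]
      exact List.perm_append_comm.append_left _
  · exact insert_path_adjAt hp h14 hp13 hsing hpsing (by omega) (by simp) (by omega) rfl rfl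

lemma degIn_le_of_nonextendable {p q : List V} {a : V} (hp : p.Nodup) (hp13 : p.length = 13)
    (hext : ∀ y ∈ A, G.Adj a y → y ∈ p ∨ y ∈ q) :
    G.degIn A a ≤ G.degIn q.toFinset a + ∑ i ∈ range 13, G.adjAt p a i := by
  have h1 : G.degIn A a ≤ G.degIn (q.toFinset ∪ p.toFinset) a := by
    refine Finset.card_le_card fun y hy => ?_
    simp only [Finset.mem_filter, Finset.mem_union, List.mem_toFinset] at hy ⊢
    exact ⟨(hext y hy.1 hy.2).symm, hy.2⟩
  have h2 : G.degIn (q.toFinset ∪ p.toFinset) a ≤ G.degIn q.toFinset a + G.degIn p.toFinset a := by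
    unfold degIn
    rw [Finset.filter_union]
    exact Finset.card_union_le _ _
  have h3 : G.degIn p.toFinset a = ∑ i ∈ range 13, G.adjAt p a i := by
    rw [degIn_eq_countP hp rfl, countP_eq_sum_range, hp13]
    rfl
  omega

/-- An end of `q` has at most `q.length - 1` neighbours in `q`, so degree six asks for at least `7 -
q.length` neighbours on `p`, which is the input of `attachment_arith`. -/
lemma nonextendable_path {p q : List V} {a b : V} (hG : ¬ G.HasTwoPaths)
    (h6 : ∀ x ∈ A, 6 ≤ G.degIn A x) (hp : G.IsPathIn A p)
    (hp13 : p.length = 13) (hq : G.IsPathIn A q) (hpq : p.Disjoint q)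
    (ha : q.head? = some a) (hb : q.getLast? = some b)
    (hexta : ∀ y ∈ A, G.Adj a y → y ∈ p ∨ y ∈ q) (hextb : ∀ y ∈ A, G.Adj b y → y ∈ p ∨ y ∈ q) :
    q.length = 6 ∧ ∀ i < 13, i ≠ 6 → G.adjAt p a i = 0 := by
  have h14 : ¬ G.HasPathIn A 14 := fun h => hG (.of_hasPathIn h)
  have haq := List.mem_of_head? ha
  have hbq := List.mem_of_getLast? hb
  have hq7 : q.length ≤ 6 := by
    by_contra hcon
    refine hG (.of_disjoint (A := p.toFinset) (B := q.toFinset) ?_ ?_ ?_)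
    · exact HasPathIn.of_le ⟨p, ⟨hp.chain, hp.nodup, by simp⟩, rfl⟩ (by omega)
    · exact HasPathIn.of_le ⟨q, ⟨hq.chain, hq.nodup, by simp⟩, rfl⟩ (by omega)
    · rw [Finset.disjoint_left]
      simpa [List.Disjoint] using hpq
  have hpq' : p.Disjoint q.reverse := by
    intro x hx hx'; exact hpq hx (List.mem_reverse.1 hx')
  obtain ⟨a1, a2, a3, a4⟩ := end_attachment hp hG hp13 hq hpq ha
  obtain ⟨b1, b2, b3, b4⟩ := end_attachment hp hG hp13 hq.reverse hpq'
    (by rw [List.head?_reverse, hb])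
  rw [List.length_reverse] at b1
  have hcard := List.toFinset_card_of_nodup hq.nodup
  have da := degIn_le_of_nonextendable hp.nodup hp13 hexta
  have db := degIn_le_of_nonextendable hp.nodup hp13 hextb
  have ha6 := h6 a (hq.subset a haq)
  have hb6 := h6 b (hq.subset b hbq)
  have la := degIn_lt_card (G := G) (List.mem_toFinset.2 haq)
  have lb := degIn_lt_card (G := G) (List.mem_toFinset.2 hbq)
  refine attachment_arith (G.adjAt p a) (G.adjAt p b) q.length (List.length_pos_of_mem haq) hq7
    (adjAt_le_one G p a) (adjAt_le_one G p b) a1 b1 a2 a3 b2 b3 a4 b4 ?_ (by omega) (by omega)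
  intro i j hij hjk hj
  exact insert_path_adjAt hp h14 hp13 hq hpq hij hjk hj ha hb

lemma sum_adjAt_le {p : List V} {a : V} (h : ∀ i < 13, i ≠ 6 → G.adjAt p a i = 0) :
    ∑ i ∈ range 13, G.adjAt p a i = G.adjAt p a 6 := by
  refine Finset.sum_eq_single_of_mem 6 (by simp) ?_
  intro i hi hi6
  exact h i (Finset.mem_range.1 hi) hi6

/-- A longest path off `p` through `x` has six vertices, and its ends see only the middle of `p`
besides the path itself. Degree six then makes the ends adjacent, so the path closes to a cycle. Cut
open at `x`, it becomes a path starting at `x`, to which the same argument applies. -/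
lemma off_path_structure {p : List V} (hG : ¬ G.HasTwoPaths)
    (h6 : ∀ x ∈ A, 6 ≤ G.degIn A x) (hp : G.IsPathIn A p)
    (hp13 : p.length = 13) {x : V} (hxA : x ∈ A) (hxp : x ∉ p) :
    G.degIn A x ≤ 6 ∧ ∃ q, G.IsPathIn A q ∧ p.Disjoint q ∧ q.length = 6 ∧ q.head? = some x ∧
      ∃ y, p[6]? = some y ∧ G.Adj x y := by
  have hpA : G.HasPathIn p.toFinset 7 :=
    HasPathIn.of_le ⟨p, ⟨hp.chain, hp.nodup, by simp⟩, rfl⟩ (by omega)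
  have hno7 : ∀ q, G.IsPathIn A q → p.Disjoint q → q.length ≤ 6 := by
    intro q hq hpq
    by_contra hcon
    refine hG (.of_disjoint (A := p.toFinset) (B := q.toFinset) hpA ?_ ?_)
    · exact HasPathIn.of_le ⟨q, ⟨hq.chain, hq.nodup, by simp⟩, rfl⟩ (by omega)
    · rw [Finset.disjoint_left]
      simpa [List.Disjoint] using hpq
  obtain ⟨q, hq, hpq, hxq, hmax⟩ : ∃ q, G.IsPathIn A q ∧ p.Disjoint q ∧ x ∈ q ∧
      ∀ q', G.IsPathIn A q' → p.Disjoint q' → x ∈ q' → q'.length ≤ q.length := by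
    let P : ℕ → Prop := fun k => ∃ q, G.IsPathIn A q ∧ p.Disjoint q ∧ x ∈ q ∧ q.length = k
    have h1 : P 1 := ⟨[x], ⟨List.isChain_singleton x, List.nodup_singleton x, by simpa⟩,
      by simpa using hxp, by simp, rfl⟩
    have hb : ∀ k, P k → k ≤ 6 := fun k ⟨q, hq, hpq, _, hk⟩ => hk ▸ hno7 q hq hpq
    obtain ⟨q, hq, hpq, hxq, hk⟩ := Nat.findGreatest_spec (P := P) (hb 1 h1) h1
    refine ⟨q, hq, hpq, hxq, fun q' hq' hpq' hxq' => ?_⟩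
    rw [hk]
    exact Nat.le_findGreatest (hno7 q' hq' hpq') ⟨q', hq', hpq', hxq', rfl⟩
  have hcons : ∀ q', G.IsPathIn A q' → p.Disjoint q' → ∀ a, q'.head? = some a → ∀ y ∈ A,
      G.Adj a y → ¬ (y ∈ p ∨ y ∈ q') → G.IsPathIn A (y :: q') ∧ p.Disjoint (y :: q') := by
    intro q' hq' hpq' a ha y hy hadj hyn
    push Not at hyn
    refine ⟨hq'.cons hy hyn.2 ?_, ?_⟩
    · intro t ht
      rw [ha] at ht
      simp at ht
      subst ht
      exact hadj.symm
    · rw [List.disjoint_cons_right]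
      exact ⟨hyn.1, hpq'⟩
  obtain ⟨a, ha⟩ := Option.ne_none_iff_exists'.1
    (fun h => List.ne_nil_of_mem hxq (List.head?_eq_none_iff.1 h))
  obtain ⟨b, hb⟩ := Option.ne_none_iff_exists'.1
    (fun h => List.ne_nil_of_mem hxq (List.getLast?_eq_none_iff.1 h))
  have hpr : p.Disjoint q.reverse := by
    intro x hx hx'; exact hpq hx (List.mem_reverse.1 hx')
  have hexta : ∀ y ∈ A, G.Adj a y → y ∈ p ∨ y ∈ q := by
    intro y hy hadj
    by_contra hcon
    obtain ⟨h1, h2⟩ := hcons q hq hpq a ha y hy hadj hcon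
    have := hmax _ h1 h2 (List.mem_cons_of_mem _ hxq)
    simp at this
  have hextb : ∀ y ∈ A, G.Adj b y → y ∈ p ∨ y ∈ q := by
    intro y hy hadj
    by_contra hcon
    obtain ⟨h1, h2⟩ := hcons q.reverse hq.reverse hpr b (by rw [List.head?_reverse, hb]) y hy hadj
      (by simpa using hcon)
    have := hmax _ h1 h2 (List.mem_cons_of_mem _ (List.mem_reverse.2 hxq))
    simp at this
  obtain ⟨hq6, hadj6⟩ := nonextendable_path hG h6 hp hp13 hq hpq ha hb hexta hextb
  have haq := List.mem_of_head? ha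
  have hbq := List.mem_of_getLast? hb
  have hcard := List.toFinset_card_of_nodup hq.nodup
  have hab : G.Adj a b := by
    have h1 := degIn_le_of_nonextendable hp.nodup hp13 hexta
    rw [sum_adjAt_le hadj6] at h1
    have h2 := h6 a (hq.subset a haq)
    have h3 := adjAt_le_one G p a 6
    have h4 : G.degIn (q.toFinset.erase a) a = #(q.toFinset.erase a) := by
      refine le_antisymm (degIn_le_card _ _ _) ?_
      rw [Finset.card_erase_of_mem (List.mem_toFinset.2 haq), hcard, hq6, degIn_erase_self]
      omega
    refine degIn_eq_card_iff.1 h4 b (Finset.mem_erase.2 ⟨?_, List.mem_toFinset.2 hbq⟩)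
    rintro rfl
    obtain ⟨q', rfl⟩ := List.head?_eq_some_iff.1 ha
    have hnd := hq.nodup
    cases q' with
    | nil => simp at hq6
    | cons c t =>
      rw [List.getLast?_cons_cons] at hb
      exact (List.nodup_cons.1 hnd).1 (List.mem_of_getLast? hb)
  obtain ⟨q', hperm, hch⟩ := exists_perm_chain_head hq.chain (by
    intro s hs t ht
    rw [hb] at hs
    rw [ha] at ht
    simp at hs ht
    subst hs ht
    exact hab.symm) hxq
  have hq' : G.IsPathIn A (x :: q') := ⟨hch, hperm.nodup_iff.2 hq.nodup,
    fun y hy => hq.subset y (hperm.mem_iff.1 hy)⟩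
  have hpq' : p.Disjoint (x :: q') := fun y hy hy' => hpq hy (hperm.mem_iff.1 hy')
  have hlen' : (x :: q').length = 6 := hperm.length_eq.trans hq6
  obtain ⟨c, hc⟩ := Option.ne_none_iff_exists'.1
    (fun h => List.cons_ne_nil x q' (List.getLast?_eq_none_iff.1 h))
  have hext : ∀ q', G.IsPathIn A q' → p.Disjoint q' → q'.length = 6 → ∀ a, q'.head? = some a →
      ∀ y ∈ A, G.Adj a y → y ∈ p ∨ y ∈ q' := by
    intro q' hq' hpq' h6' a ha y hy hadj
    by_contra hcon
    obtain ⟨h1, h2⟩ := hcons q' hq' hpq' a ha y hy hadj hcon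
    have := hno7 _ h1 h2
    simp at this
    omega
  have hpr' : p.Disjoint (x :: q').reverse := by
    intro x hx hx'; exact hpq' hx (List.mem_reverse.1 hx')
  have hextx := hext _ hq' hpq' hlen' x rfl
  obtain ⟨-, hx6⟩ := nonextendable_path hG h6 hp hp13 hq' hpq' rfl hc hextx (by
      intro y hy hadj
      have := hext _ hq'.reverse hpr' (by rw [List.length_reverse, hlen']) c
        (by rw [List.head?_reverse, hc]) y hy hadj
      rwa [List.mem_reverse] at this)
  have h1 := degIn_le_of_nonextendable hp.nodup hp13 hextx
  rw [sum_adjAt_le hx6] at h1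
  have h2 := h6 x hxA
  have h3 := adjAt_le_one G p x 6
  have h4 := degIn_lt_card (G := G) (A := (x :: q').toFinset) (v := x) (by simp)
  rw [List.toFinset_card_of_nodup hq'.nodup, hlen'] at h4
  exact ⟨by omega, x :: q', hq', hpq', hlen', rfl, exists_of_adjAt_pos (by omega)⟩

/-- A graph of minimum degree six on at least fourteen vertices without two disjoint paths on seven
vertices has few edges. -/
lemma degSum_le_of_six_le_degIn (hG : ¬ G.HasTwoPaths) (hA : 14 ≤ #A)
    (h6 : ∀ x ∈ A, 6 ≤ G.degIn A x) : G.degSum A ≤ 7 * (#A - 1) := by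
  obtain ⟨p, hp, hmax, hne⟩ := exists_longest_path (G := G) (A := A) (Finset.card_pos.1 (by omega))
  have hp14 : p.length ≤ 13 := by
    by_contra hcon
    exact hG (.of_path hp (by omega))
  obtain ⟨u, hu⟩ := Option.ne_none_iff_exists'.1 (fun h => hne (List.head?_eq_none_iff.1 h))
  obtain ⟨v, hv⟩ := Option.ne_none_iff_exists'.1 (fun h => hne (List.getLast?_eq_none_iff.1 h))
  have hpA : p.toFinset ⊆ A := fun x hx => hp.subset x (List.mem_toFinset.1 hx)
  have hpc := List.toFinset_card_of_nodup hp.nodup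
  -- Either the two end degrees force thirteen vertices, or the path spans a component. In that case
  -- the component and its nonempty complement both keep minimum degree six, so each contains a path
  -- on seven vertices.
  have hp13 : p.length = 13 := by
    rcases longest_path_dichotomy hp hmax hu hv with h | h
    · have := h6 u (hp.subset u (List.mem_of_head? hu))
      have := h6 v (hp.subset v (List.mem_of_getLast? hv))
      omega
    · exfalso
      have hdeg : ∀ x ∈ A, G.degIn A x = G.degIn p.toFinset x + G.degIn (A \ p.toFinset) x := by
        intro x _
        rw [← degIn_union Finset.disjoint_sdiff, Finset.union_sdiff_of_subset hpA]
      refine hG (.of_disjoint (A := p.toFinset) (B := A \ p.toFinset) ?_ ?_ Finset.disjoint_sdiff)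
      · refine hasPathIn_seven_of_six_le_degIn ⟨u, List.mem_toFinset.2 (List.mem_of_head? hu)⟩ ?_
        intro x hx
        have h1 := h6 x (hpA hx)
        have h2 : G.degIn (A \ p.toFinset) x = 0 := by
          rw [degIn_eq_zero_iff]
          intro y hy
          rw [Finset.mem_sdiff, List.mem_toFinset] at hy
          exact h x (List.mem_toFinset.1 hx) y hy.1 hy.2
        rw [hdeg x (hpA hx)] at h1
        omega
      · refine hasPathIn_seven_of_six_le_degIn ?_ ?_
        · rw [← Finset.card_pos, Finset.card_sdiff_of_subset hpA]
          omega
        · intro x hx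
          rw [Finset.mem_sdiff, List.mem_toFinset] at hx
          have h1 := h6 x hx.1
          have h2 : G.degIn p.toFinset x = 0 := by
            rw [degIn_eq_zero_iff]
            intro y hy hadj
            exact h y (List.mem_toFinset.1 hy) x hx.1 hx.2 hadj.symm
          rw [hdeg x hx.1] at h1
          omega
  obtain ⟨x, hx⟩ : (A \ p.toFinset).Nonempty := by
    rw [← Finset.card_pos, Finset.card_sdiff_of_subset hpA]
    omega
  rw [Finset.mem_sdiff, List.mem_toFinset] at hx
  obtain ⟨-, q, hq, hpq, hq6, hqx, c, hc, hxc⟩ := off_path_structure hG h6 hp hp13 hx.1 hx.2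
  have hcp : c ∈ p := List.mem_of_getElem? hc
  -- A vertex `y` of `p` other than the middle `c` is moved off the path by exchanging its half of
  -- `p` for `q`, which is attached at `c`. So every vertex but `c` has degree at most six.
  have hle : ∀ y ∈ A.erase c, G.degIn A y ≤ 6 := by
    intro y hy
    rw [Finset.mem_erase] at hy
    by_cases hyp : y ∈ p
    swap
    · exact (off_path_structure hG h6 hp hp13 hy.2 hyp).1
    have hsplit : y ∈ p.take 6 ∨ y ∈ p.drop 7 := by
      have h1 : p = p.take 6 ++ (c :: p.drop 7) := by
        conv_lhs => rw [← List.take_append_drop 6 p]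
        rw [List.drop_eq_getElem_cons (by omega)]
        rw [List.getElem?_eq_some_iff] at hc
        obtain ⟨_, hc⟩ := hc
        rw [hc]
      rw [h1] at hyp
      simpa [hy.1] using hyp
    have hnd := hp.nodup
    rcases hsplit with hy' | hy'
    · have hp' : G.IsPathIn A (q.reverse ++ p.drop 6) := by
        refine hq.reverse.append (hp.drop 6) ?_ ?_
        · intro z hz hz'
          exact hpq (List.mem_of_mem_drop hz') (List.mem_reverse.1 hz)
        · intro s hs t ht
          rw [List.getLast?_reverse, hqx] at hs
          rw [List.head?_drop, hc] at ht
          simp at hs ht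
          subst hs ht
          exact hxc
      refine (off_path_structure hG h6 hp' (by simp; omega) hy.2 ?_).1
      rw [List.mem_append, List.mem_reverse]
      rintro (h | h)
      · exact hpq hyp h
      · rw [← List.take_append_drop 6 p, List.nodup_append'] at hnd
        exact hnd.2.2 hy' h
    · have hp' : G.IsPathIn A (p.take 7 ++ q) := by
        refine (hp.take 7).append hq ?_ ?_
        · intro z hz hz'
          exact hpq (List.mem_of_mem_take hz) hz'
        · intro s hs t ht
          rw [getLast?_take_succ hc] at hs
          rw [hqx] at ht
          simp at hs ht
          subst hs ht
          exact hxc.symm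
      refine (off_path_structure hG h6 hp' (by simp; omega) hy.2 ?_).1
      rw [List.mem_append]
      rintro (h | h)
      · rw [← List.take_append_drop 7 p, List.nodup_append'] at hnd
        exact hnd.2.2 h hy'
      · exact hpq hyp h
  have hcA : c ∈ A := hp.subset c hcp
  have h1 : G.degSum A = ∑ y ∈ A.erase c, G.degIn A y + G.degIn A c :=
    (Finset.sum_erase_add _ _ hcA).symm
  have h2 : ∑ y ∈ A.erase c, G.degIn A y ≤ _ := Finset.sum_le_card_nsmul _ _ 6 hle
  rw [Finset.card_erase_of_mem hcA, smul_eq_mul] at h2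
  have h3 := degIn_lt_card (G := G) hcA
  omega

end

/-! ### Building two paths with Hall's theorem. -/

section

variable {V : Type*}
variable {G K : SimpleGraph V} {A B H S L : Finset V} {u v w : V}

/-- Each element `l` of `L` is to be placed in a slot `j` all of whose prescribed vertices `m i`,
`i ∈ C j`, are adjacent to `l`. By Hall's theorem this is possible when few adjacencies fail. -/
lemma exists_slot_assignment {p k : ℕ} (s : ℕ) (C : Fin p → Finset (Fin k))
    (hC : ∀ i, #{j | i ∈ C j} ≤ 2) (m : Fin k → V) (hL : #L = p)
    (hs : ∑ l ∈ L, #{i | ¬ G.Adj l (m i)} ≤ s)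
    (hne : ∀ l ∈ L, p ≤ 2 * #{i | ¬ G.Adj l (m i)} → ∃ j, ∀ i ∈ C j, G.Adj l (m i))
    (harith : ∀ ν a, 1 ≤ ν → a * ν ≤ s → a ≤ 1 ∨ a + 2 * ν ≤ p ∨ p < a + 2)
    (hbig : ∀ I ⊆ L, (∀ l ∈ I, ∃ i, ¬ G.Adj l (m i)) → p < #I + 2 →
      ∀ j, ∃ l ∈ I, ∀ i ∈ C j, G.Adj l (m i)) :
    ∃ x : Fin p → V, Function.Injective x ∧ ∀ j, x j ∈ L ∧ ∀ i ∈ C j, G.Adj (x j) (m i) := by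
  let t : L → Finset (Fin p) := fun l => {j | ∀ i ∈ C j, G.Adj l (m i)}
  let ν : V → ℕ := fun l => #{i | ¬ G.Adj l (m i)}
  -- Each centre not adjacent to `l` blocks at most two slots, those on its two sides.
  have ht : ∀ l : L, p ≤ #(t l) + 2 * ν l := by
    intro l
    have h1 : #(univ.filter fun j : Fin p => ¬ ∀ i ∈ C j, G.Adj l (m i)) ≤ ν l * 2 := by
      have : (univ.filter fun j : Fin p => ¬ ∀ i ∈ C j, G.Adj l (m i)) ⊆
          ({i | ¬ G.Adj l (m i)} : Finset (Fin k)).biUnion fun i => {j | i ∈ C j} := by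
        intro j hj
        simp only [Finset.mem_filter, Finset.mem_univ, true_and, Finset.mem_biUnion] at hj ⊢
        push Not at hj
        obtain ⟨i, hi, hadj⟩ := hj
        exact ⟨i, hadj, hi⟩
      exact (Finset.card_le_card this).trans (Finset.card_biUnion_le_card_mul _ _ _ fun i _ => hC i)
    have h2 := Finset.card_filter_add_card_filter_not (s := (univ : Finset (Fin p)))
      (fun j => ∀ i ∈ C j, G.Adj (l : V) (m i))
    rw [Finset.card_univ, Fintype.card_fin] at h2
    change #(t l) + _ = p at h2
    omega
  have hall : ∀ I : Finset L, #I ≤ #(I.biUnion t) := by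
    intro I
    rcases I.eq_empty_or_nonempty with rfl | hI
    · simp
    have hIp : #I ≤ p := by
      have := Finset.card_le_univ I
      rwa [Fintype.card_coe, hL] at this
    obtain ⟨l, hl, hmin⟩ := I.exists_min_image (fun l => ν l) hI
    have hsub : #(t l) ≤ #(I.biUnion t) :=
      Finset.card_le_card (Finset.subset_biUnion_of_mem t hl)
    have htl := ht l
    rcases Nat.eq_zero_or_pos (ν l) with h0 | hpos
    · omega
    have hsum : #I * ν l ≤ s := by
      have h1 : #I • ν l ≤ ∑ l ∈ I, ν l := Finset.card_nsmul_le_sum I (fun l => ν l) _ hmin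
      have h2 : ∑ l ∈ I, ν (l : V) ≤ ∑ l : L, ν l :=
        Finset.sum_le_sum_of_subset (Finset.subset_univ I)
      rw [Finset.univ_eq_attach, Finset.sum_attach L ν] at h2
      rw [smul_eq_mul] at h1
      exact h1.trans (h2.trans hs)
    -- Hall's condition for `I`: a single vertex needs only one slot, an intermediate set is served
    -- by the slots open to one member, and a set of at least `p - 1` vertices is handed to `hbig`.
    rcases harith (ν l) #I hpos hsum with h | h | h
    · have : 0 < #(t l) := by
        by_contra hcon
        obtain ⟨j, hj⟩ := hne l l.2 (by change p ≤ 2 * ν l; omega)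
        exact hcon (Finset.card_pos.2 ⟨j, by simpa [t] using hj⟩)
      omega
    · omega
    · have hb := hbig (I.map (Function.Embedding.subtype _)) (by
        intro x hx
        simp only [Finset.mem_map, Function.Embedding.subtype_apply] at hx
        obtain ⟨y, -, rfl⟩ := hx
        exact y.2) (by
        intro x hx
        simp only [Finset.mem_map, Function.Embedding.subtype_apply] at hx
        obtain ⟨y, hy, rfl⟩ := hx
        have h1 : 0 < ν y := lt_of_lt_of_le hpos (hmin y hy)
        obtain ⟨i, hi⟩ := Finset.card_pos.1 h1
        exact ⟨i, by simpa using hi⟩) (by rw [Finset.card_map]; exact h)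
      have huniv : I.biUnion t = univ := by
        rw [Finset.eq_univ_iff_forall]
        intro j
        obtain ⟨l, hl, hlj⟩ := hb j
        simp only [Finset.mem_map, Function.Embedding.subtype_apply] at hl
        obtain ⟨y, hy, rfl⟩ := hl
        exact Finset.mem_biUnion.2 ⟨y, hy, by simpa [t] using hlj⟩
      rw [huniv, Finset.card_univ, Fintype.card_fin]
      exact hIp
  obtain ⟨f, hf, hft⟩ := (Finset.all_card_le_biUnion_card_iff_exists_injective t).1 hall
  have hbij : Function.Bijective f := by
    rw [Fintype.bijective_iff_injective_and_card]
    exact ⟨hf, by rw [Fintype.card_coe, hL, Fintype.card_fin]⟩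
  let e := Equiv.ofBijective f hbij
  refine ⟨fun j => e.symm j, fun i j h => e.symm.injective (Subtype.ext h), fun j => ⟨(e.symm j).2, ?_⟩⟩
  have := hft (e.symm j)
  have he : f (e.symm j) = j := e.apply_symm_apply j
  rw [he] at this
  simpa [t] using this

lemma exists_perm_two {k : ℕ} {i j a b : Fin k} (hij : i ≠ j) (hab : a ≠ b) :
    ∃ σ : Equiv.Perm (Fin k), σ i = a ∧ σ j = b := by
  refine ⟨(Equiv.swap i a).trans (Equiv.swap (Equiv.swap i a j) b), ?_, ?_⟩
  · rw [Equiv.trans_apply, Equiv.swap_apply_left]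
    refine Equiv.swap_apply_of_ne_of_ne (fun h => hij ?_) hab
    have : Equiv.swap i a i = Equiv.swap i a j := by rw [Equiv.swap_apply_left, ← h]
    exact (Equiv.swap i a).injective this
  · rw [Equiv.trans_apply, Equiv.swap_apply_left]

/-- Enumerate a finite set so that two given elements get two given positions. -/
lemma exists_enum {k : ℕ} (hS : #S = k) {i j : Fin k} (hij : i ≠ j) {a b : V} (ha : a ∈ S)
    (hb : b ∈ S) (hab : a ≠ b) :
    ∃ m : Fin k → V, Function.Injective m ∧ (∀ i, m i ∈ S) ∧ (∀ v ∈ S, ∃ i, m i = v) ∧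
      m i = a ∧ m j = b := by
  let e : S ≃ Fin k := S.equivFinOfCardEq hS
  obtain ⟨σ, h1, h2⟩ := exists_perm_two (i := i) (j := j) (a := e ⟨a, ha⟩) (b := e ⟨b, hb⟩) hij
    (fun h => hab (by simpa using h))
  refine ⟨fun i => e.symm (σ i), fun i j h => σ.injective (e.symm.injective (Subtype.ext h)),
    fun i => (e.symm (σ i)).2, fun v hv => ⟨σ.symm (e ⟨v, hv⟩), by simp⟩, by simp [h1], by simp [h2]⟩

lemma degIn_add_card_not_adj {k : ℕ} {m : Fin k → V} (hm : Function.Injective m)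
    (hmS : ∀ i, m i ∈ S) (hSm : ∀ v ∈ S, ∃ i, m i = v) (l : V) :
    G.degIn S l + #{i | ¬ G.Adj l (m i)} = k := by
  have h1 : G.degIn S l = #{i | G.Adj l (m i)} := by
    rw [degIn]
    symm
    refine Finset.card_bij (fun i _ => m i) ?_ (fun i _ j _ h => hm h) ?_
    · intro i hi
      simp only [Finset.mem_filter, Finset.mem_univ, true_and] at hi ⊢
      exact ⟨hmS i, hi⟩
    · intro v hv
      simp only [Finset.mem_filter, Finset.mem_univ, true_and] at hv ⊢
      obtain ⟨i, rfl⟩ := hSm v hv.1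
      exact ⟨i, hv.2, rfl⟩
  rw [h1, Finset.card_filter_add_card_filter_not, Finset.card_univ, Fintype.card_fin]

lemma sum_card_not_adj {k : ℕ} {m : Fin k → V} (hm : Function.Injective m)
    (hmS : ∀ i, m i ∈ S) (hSm : ∀ v ∈ S, ∃ i, m i = v) (L : Finset V) :
    ∑ l ∈ L, G.degIn S l + ∑ l ∈ L, #{i | ¬ G.Adj l (m i)} = #L * k := by
  rw [← Finset.sum_add_distrib, Finset.sum_congr rfl fun l _ => degIn_add_card_not_adj hm hmS hSm l,
    Finset.sum_const, smul_eq_mul]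

/-- The entry of the slot table at `j` lists the centres that `x j` stands next to. The first path
ends in the block `t₀ t₁ t₂`, which saves centres: five suffice instead of six. -/
lemma hasTwoPaths_of_slots_three_block {x : Fin 6 → V} {m : Fin 5 → V} {t₀ t₁ t₂ : V}
    (hx : Function.Injective x) (hm : Function.Injective m)
    (hxm : ∀ i j, x i ≠ m j) (hxt₀ : ∀ i, x i ≠ t₀) (hxt₁ : ∀ i, x i ≠ t₁) (hxt₂ : ∀ i, x i ≠ t₂)
    (hmt₀ : ∀ i, m i ≠ t₀) (hmt₁ : ∀ i, m i ≠ t₁) (hmt₂ : ∀ i, m i ≠ t₂)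
    (h01 : G.Adj t₀ t₁) (h12 : G.Adj t₁ t₂) (h02 : t₀ ≠ t₂) (hmt : G.Adj (m 1) t₀)
    (h : ∀ j, ∀ i ∈ (![{0}, {0, 1}, {2}, {2, 3}, {3, 4}, {4}] : Fin 6 → Finset (Fin 5)) j,
      G.Adj (x j) (m i)) : G.HasTwoPaths := by
  have hmx : ∀ i j, m j ≠ x i := fun i j => (hxm i j).symm
  have a0 := h 0
  have a1 := h 1
  have a2 := h 2
  have a3 := h 3
  have a4 := h 4
  have a5 := h 5
  simp at a0 a1 a2 a3 a4 a5
  refine ⟨[x 0, m 0, x 1, m 1, t₀, t₁, t₂], [x 2, m 2, x 3, m 3, x 4, m 4, x 5], rfl, rfl, ?_, ?_, ?_⟩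
  · simp [a0, a1.1.symm, a1.2, hmt, h01, h12]
  · simp [a2, a3.1.symm, a3.2, a4.1.symm, a4.2, a5.symm]
  · simp [hx.eq_iff, hm.eq_iff, hxm, hmx, hxt₀, hxt₁, hxt₂, (hxt₀ _).symm, (hxt₁ _).symm,
      (hxt₂ _).symm, hmt₀, hmt₁, hmt₂, (hmt₀ _).symm, (hmt₁ _).symm, (hmt₂ _).symm, h01.ne, h12.ne,
      h02]

lemma add_le_sum_of_ne {ι : Type*} {s : Finset ι} (f : ι → ℕ) {i j : ι} (hi : i ∈ s) (hj : j ∈ s)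
    (hij : i ≠ j) : f i + f j ≤ ∑ x ∈ s, f x := by
  rw [← Finset.sum_pair hij]
  exact Finset.sum_le_sum_of_subset (by
    intro x hx
    rcases Finset.mem_insert.1 hx with rfl | hx
    · exact hi
    · rwa [Finset.mem_singleton.1 hx])

lemma card_le_sum_card_not_adj {k : ℕ} {m : Fin k → V} {I : Finset V} (hI : I ⊆ L)
    (h : ∀ l ∈ I, ∃ i, ¬ G.Adj l (m i)) : #I ≤ ∑ l ∈ L, #{i | ¬ G.Adj l (m i)} := by
  have h1 : #I • 1 ≤ ∑ l ∈ I, #{i | ¬ G.Adj l (m i)} := Finset.card_nsmul_le_sum _ _ _ fun l hl => by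
    obtain ⟨i, hi⟩ := h l hl
    exact Finset.card_pos.2 ⟨i, by simpa using hi⟩
  have h2 : ∑ l ∈ I, #{i | ¬ G.Adj l (m i)} ≤ ∑ l ∈ L, #{i | ¬ G.Adj l (m i)} :=
    Finset.sum_le_sum_of_subset hI
  rw [smul_eq_mul] at h1
  omega

/-- At most four of the thirty pairs between `L` and `S` are nonadjacent. A neighbour `c` of the
poorest vertex `y` takes position 2, so that `y` fits the slot `{2}`, and a different neighbour `d`
of `t₀` takes position 1, where the block hangs. A second vertex missing three centres would make
six missing pairs. -/
lemma hasTwoPaths_of_three_block {t₀ t₁ t₂ : V} (hS : #S = 5) (hL : #L = 6) (hSL : Disjoint S L)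
    (hdeg : 26 ≤ ∑ l ∈ L, G.degIn S l) (h01 : G.Adj t₀ t₁) (h12 : G.Adj t₁ t₂) (h02 : t₀ ≠ t₂)
    (h₀S : t₀ ∉ S) (h₁S : t₁ ∉ S) (h₂S : t₂ ∉ S) (h₀L : t₀ ∉ L) (h₁L : t₁ ∉ L) (h₂L : t₂ ∉ L)
    (ht : 2 ≤ G.degIn S t₀) : G.HasTwoPaths := by
  obtain ⟨y, hy, hmin⟩ := L.exists_min_image (fun l => G.degIn S l) (Finset.card_pos.1 (by omega))
  have hle : ∀ l ∈ L, G.degIn S l ≤ 5 := fun l _ => hS ▸ degIn_le_card G S l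
  have hy1 : 1 ≤ G.degIn S y := by
    have h1 := Finset.sum_erase_add L (G.degIn S) hy
    have h2 : ∑ l ∈ L.erase y, G.degIn S l ≤ _ :=
      Finset.sum_le_card_nsmul _ _ 5 fun l hl => hle l (Finset.mem_of_mem_erase hl)
    rw [Finset.card_erase_of_mem hy, hL, smul_eq_mul] at h2
    omega
  obtain ⟨c, hcS, hyc⟩ := degIn_pos_iff.1 hy1
  obtain ⟨d, hdS, hdc, htd⟩ : ∃ d ∈ S, d ≠ c ∧ G.Adj t₀ d := by
    have h1 := degIn_le_erase_add_one (G := G) hcS t₀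
    obtain ⟨d, hd, hdt⟩ := degIn_pos_iff.1 (by omega : 0 < G.degIn (S.erase c) t₀)
    exact ⟨d, Finset.mem_of_mem_erase hd, Finset.ne_of_mem_erase hd, hdt⟩
  obtain ⟨m, hm, hmS, hSm, hm1, hm2⟩ := exists_enum hS (i := 1) (j := 2) (by decide) hdS hcS hdc
  have hsum := sum_card_not_adj (G := G) hm hmS hSm L
  have hind := degIn_add_card_not_adj (G := G) hm hmS hSm
  let C : Fin 6 → Finset (Fin 5) := ![{0}, {0, 1}, {2}, {2, 3}, {3, 4}, {4}]
  have hC : ∀ i, #{j | i ∈ C j} ≤ 2 := by decide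
  have hne : ∀ l ∈ L, 6 ≤ 2 * #{i | ¬ G.Adj l (m i)} → ∃ j, ∀ i ∈ C j, G.Adj l (m i) := by
    intro l hl h6
    by_cases hly : l = y
    · exact ⟨2, by simpa [C, hm2, hly] using hyc⟩
    · have := add_le_sum_of_ne (fun l => #{i | ¬ G.Adj l (m i)}) hl hy hly
      have := hind l
      have := hind y
      have := hmin l hl
      omega
  have harith : ∀ ν a, 1 ≤ ν → a * ν ≤ 4 → a ≤ 1 ∨ a + 2 * ν ≤ 6 ∨ 6 < a + 2 := by
    intro ν a hν haν
    have : ν = 1 ∨ ν = 2 ∨ 3 ≤ ν := by omega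
    rcases this with rfl | rfl | h3
    · omega
    · omega
    · left; nlinarith
  obtain ⟨x, hx, hxL⟩ := exists_slot_assignment (G := G) 4 C hC m hL (by omega) hne harith
    fun I hI hI' hcard => absurd (card_le_sum_card_not_adj hI hI') (by omega)
  exact hasTwoPaths_of_slots_three_block hx hm
    (fun i j h => Finset.disjoint_left.1 hSL (hmS j) (h ▸ (hxL i).1))
    (fun i => ne_of_mem_of_not_mem (hxL i).1 h₀L) (fun i => ne_of_mem_of_not_mem (hxL i).1 h₁L)
    (fun i => ne_of_mem_of_not_mem (hxL i).1 h₂L) (fun i => ne_of_mem_of_not_mem (hmS i) h₀S)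
    (fun i => ne_of_mem_of_not_mem (hmS i) h₁S) (fun i => ne_of_mem_of_not_mem (hmS i) h₂S)
    h01 h12 h02 (by rw [hm1]; exact htd.symm) fun j => (hxL j).2

lemma hasTwoPaths_of_slots_two_pairs {x : Fin 5 → V} {m : Fin 5 → V} {z₁ z₂ z₃ z₄ : V}
    (hx : Function.Injective x) (hm : Function.Injective m) (hxm : ∀ i j, x i ≠ m j)
    (hz : [z₁, z₂, z₃, z₄].Nodup) (hxz : ∀ i, x i ∉ [z₁, z₂, z₃, z₄])
    (hmz : ∀ i, m i ∉ [z₁, z₂, z₃, z₄]) (h12 : G.Adj z₁ z₂) (h34 : G.Adj z₃ z₄)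
    (h2 : G.Adj z₂ (m 0)) (h3 : G.Adj z₃ (m 0)) (h4 : G.Adj z₄ (m 1))
    (h : ∀ j, ∀ i ∈ (![{1}, {2}, {2, 3}, {3, 4}, {4}] : Fin 5 → Finset (Fin 5)) j,
      G.Adj (x j) (m i)) : G.HasTwoPaths := by
  have hmx : ∀ i j, m j ≠ x i := fun i j => (hxm i j).symm
  have a0 := h 0
  have a1 := h 1
  have a2 := h 2
  have a3 := h 3
  have a4 := h 4
  simp at a0 a1 a2 a3 a4
  simp only [List.mem_cons, List.not_mem_nil, or_false, not_or] at hxz hmz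
  simp only [List.nodup_cons, List.mem_cons, List.not_mem_nil, or_false, not_or, not_false_eq_true,
    List.nodup_nil, and_true] at hz
  obtain ⟨⟨q12, q13, q14⟩, ⟨q23, q24⟩, q34⟩ := hz
  refine ⟨[z₁, z₂, m 0, z₃, z₄, m 1, x 0], [x 1, m 2, x 2, m 3, x 3, m 4, x 4], rfl, rfl, ?_, ?_, ?_⟩
  · simp [h12, h2, h3.symm, h34, h4, a0.symm]
  · simp [a1, a2.1.symm, a2.2, a3.1.symm, a3.2, a4.symm]
  · simp [hx.eq_iff, hm.eq_iff, hxm, hmx, hmz, Ne.symm (hxz _).1, Ne.symm (hxz _).2.1,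
      Ne.symm (hxz _).2.2.1, Ne.symm (hxz _).2.2.2, Ne.symm (hmz _).1, Ne.symm (hmz _).2.1,
      Ne.symm (hmz _).2.2.1, Ne.symm (hmz _).2.2.2, q12, q13, q14, q23, q24, q34]

lemma two_le_card_common {a b : V} {k : ℕ} (hS : #S = k)
    (h : k + 2 ≤ G.degIn S a + G.degIn S b) : 2 ≤ #{s ∈ S | G.Adj a s ∧ G.Adj b s} := by
  have h1 := Finset.card_union_add_card_inter (S.filter fun s => G.Adj a s)
    (S.filter fun s => G.Adj b s)
  have h2 : #((S.filter fun s => G.Adj a s) ∪ (S.filter fun s => G.Adj b s)) ≤ #S :=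
    Finset.card_le_card (Finset.union_subset (Finset.filter_subset _ _) (Finset.filter_subset _ _))
  have h3 : (S.filter fun s => G.Adj a s) ∩ (S.filter fun s => G.Adj b s) =
      {s ∈ S | G.Adj a s ∧ G.Adj b s} := by
    ext s
    simp only [Finset.mem_inter, Finset.mem_filter]
    tauto
  rw [h3] at h1
  unfold degIn at h
  omega

/-- Of 25 pairs between `L` and `S` and 15 at `z₂`, `z₃`, `z₄`, at most three are missing. So `z₂`
and `z₃` have a common neighbour `c` linking the two edges, and `z₄` and the poorest vertex `y` of
`L` have a common neighbour `d ≠ c`, which leaves the slot `{1}` open to `y`. -/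
lemma hasTwoPaths_of_two_pairs {z₁ z₂ z₃ z₄ : V} (hS : #S = 5) (hL : #L = 5) (hSL : Disjoint S L)
    (hdeg : 37 ≤ ∑ l ∈ L, G.degIn S l + G.degIn S z₂ + G.degIn S z₃ + G.degIn S z₄)
    (hz : [z₁, z₂, z₃, z₄].Nodup) (hzS : ∀ z ∈ [z₁, z₂, z₃, z₄], z ∉ S)
    (hzL : ∀ z ∈ [z₁, z₂, z₃, z₄], z ∉ L) (h12 : G.Adj z₁ z₂) (h34 : G.Adj z₃ z₄) :
    G.HasTwoPaths := by
  obtain ⟨y, hy, hmin⟩ := L.exists_min_image (fun l => G.degIn S l) (Finset.card_pos.1 (by omega))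
  have hle : ∀ l, G.degIn S l ≤ 5 := fun l => hS ▸ degIn_le_card G S l
  have h1 := Finset.sum_erase_add L (G.degIn S) hy
  have h2 : ∑ l ∈ L.erase y, G.degIn S l ≤ _ :=
    Finset.sum_le_card_nsmul _ _ 5 fun l hl => hle l
  rw [Finset.card_erase_of_mem hy, hL, smul_eq_mul] at h2
  have d1 := hle y
  have d2 := hle z₂
  have d3 := hle z₃
  have d4 := hle z₄
  obtain ⟨c, hc⟩ := Finset.card_pos.1 (zero_lt_two.trans_le
    (two_le_card_common (G := G) hS (a := z₂) (b := z₃) (by omega)))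
  obtain ⟨d, hd, hdc⟩ := Finset.exists_mem_ne (one_lt_two.trans_le
    (two_le_card_common (G := G) hS (a := z₄) (b := y) (by omega))) c
  rw [Finset.mem_filter] at hc hd
  obtain ⟨m, hm, hmS, hSm, hm0, hm1⟩ := exists_enum hS (i := 0) (j := 1) (by decide) hc.1 hd.1 hdc.symm
  have hsum := sum_card_not_adj (G := G) hm hmS hSm L
  have hind := degIn_add_card_not_adj (G := G) hm hmS hSm
  let C : Fin 5 → Finset (Fin 5) := ![{1}, {2}, {2, 3}, {3, 4}, {4}]
  have hC : ∀ i, #{j | i ∈ C j} ≤ 2 := by decide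
  have hne : ∀ l ∈ L, 5 ≤ 2 * #{i | ¬ G.Adj l (m i)} → ∃ j, ∀ i ∈ C j, G.Adj l (m i) := by
    intro l hl h6
    by_cases hly : l = y
    · exact ⟨0, by simpa [C, hm1, hly] using hd.2.2⟩
    · have := add_le_sum_of_ne (fun l => #{i | ¬ G.Adj l (m i)}) hl hy hly
      have := hind l
      have := hind y
      have := hmin l hl
      omega
  have harith : ∀ ν a, 1 ≤ ν → a * ν ≤ 3 → a ≤ 1 ∨ a + 2 * ν ≤ 5 ∨ 5 < a + 2 := by
    intro ν a hν haν
    have : ν = 1 ∨ 2 ≤ ν := by omega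
    rcases this with rfl | h3
    · omega
    · left; nlinarith
  obtain ⟨x, hx, hxL⟩ := exists_slot_assignment (G := G) 3 C hC m hL (by omega) hne harith
    fun I hI hI' hcard => absurd (card_le_sum_card_not_adj hI hI') (by omega)
  exact hasTwoPaths_of_slots_two_pairs hx hm
    (fun i j h => Finset.disjoint_left.1 hSL (hmS j) (h ▸ (hxL i).1)) hz
    (fun i h => hzL _ h (hxL i).1) (fun i h => hzS _ h (hmS i)) h12 h34
    (hm0 ▸ hc.2.1) (hm0 ▸ hc.2.2) (hm1 ▸ hd.2.1) fun j => (hxL j).2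

lemma hasTwoPaths_of_slots_bipartite {x : Fin 8 → V} {m : Fin 6 → V}
    (hx : Function.Injective x) (hm : Function.Injective m) (hxm : ∀ i j, x i ≠ m j)
    (h : ∀ j, ∀ i ∈ (![{0}, {0, 1}, {1, 2}, {2}, {3}, {3, 4}, {4, 5}, {5}] :
      Fin 8 → Finset (Fin 6)) j, G.Adj (x j) (m i)) : G.HasTwoPaths := by
  have hmx : ∀ i j, m j ≠ x i := fun i j => (hxm i j).symm
  have a0 := h 0
  have a1 := h 1
  have a2 := h 2
  have a3 := h 3
  have a4 := h 4
  have a5 := h 5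
  have a6 := h 6
  have a7 := h 7
  simp at a0 a1 a2 a3 a4 a5 a6 a7
  refine ⟨[x 0, m 0, x 1, m 1, x 2, m 2, x 3], [x 4, m 3, x 5, m 4, x 6, m 5, x 7], rfl, rfl,
    ?_, ?_, ?_⟩
  · simp [a0, a1.1.symm, a1.2, a2.1.symm, a2.2, a3.symm]
  · simp [a4, a5.1.symm, a5.2, a6.1.symm, a6.2, a7.symm]
  · simp [hx.eq_iff, hm.eq_iff, hxm, hmx]

/-- An almost complete bipartite graph between six and eight vertices contains two disjoint paths
on seven vertices, unless all seven missing edges but at most one go to a single centre. -/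
lemma exists_common_missed_center (hG : ¬ G.HasTwoPaths) (hS : #S = 6) (hL : #L = 8)
    (hSL : Disjoint S L) (hdeg : 41 ≤ ∑ l ∈ L, G.degIn S l) (hpos : ∀ l ∈ L, 1 ≤ G.degIn S l) :
    ∃ c ∈ S, ∃ d ∈ L, (∀ l ∈ L, l ≠ d → ∀ s ∈ S, G.Adj l s ↔ s ≠ c) ∧ ∀ s ∈ S, G.Adj d s := by
  let C : Fin 8 → Finset (Fin 6) := ![{0}, {0, 1}, {1, 2}, {2}, {3}, {3, 4}, {4, 5}, {5}]
  have hC : ∀ i, #{j | i ∈ C j} ≤ 2 := by decide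
  have harith : ∀ ν a, 1 ≤ ν → a * ν ≤ 7 → a ≤ 1 ∨ a + 2 * ν ≤ 8 ∨ 8 < a + 2 := by
    intro ν a hν haν
    have : ν = 1 ∨ ν = 2 ∨ ν = 3 ∨ 4 ≤ ν := by omega
    rcases this with rfl | rfl | rfl | h3
    · omega
    · omega
    · omega
    · left; nlinarith
  have hle : ∀ l, G.degIn S l ≤ 6 := fun l => hS ▸ degIn_le_card G S l
  -- Since no placement exists, the obstruction must be at least seven vertices, each missing some
  -- centre, that are all barred from one slot.
  have key : ∀ m : Fin 6 → V, Function.Injective m → (∀ i, m i ∈ S) → (∀ v ∈ S, ∃ i, m i = v) →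
      (∀ l ∈ L, 8 ≤ 2 * #{i | ¬ G.Adj l (m i)} → ∃ j, ∀ i ∈ C j, G.Adj l (m i)) →
      ∃ I ⊆ L, (∀ l ∈ I, ∃ i, ¬ G.Adj l (m i)) ∧ 8 < #I + 2 ∧
        ∃ j, ∀ l ∈ I, ¬ ∀ i ∈ C j, G.Adj l (m i) := by
    intro m hm hmS hSm hne
    have hsum := sum_card_not_adj (G := G) hm hmS hSm L
    by_contra! hcon
    obtain ⟨x, hx, hxL⟩ := exists_slot_assignment (G := G) 7 C hC m hL (by omega) hne harith
      fun I hI hI' hcard j => by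
        obtain ⟨l, hl, h⟩ := hcon I hI hI' hcard j
        exact ⟨l, hl, h⟩
    exact hG (hasTwoPaths_of_slots_bipartite hx hm
      (fun i j h => Finset.disjoint_left.1 hSL (hmS j) (h ▸ (hxL i).1)) fun j => (hxL j).2)
  -- Put a neighbour of the poorest vertex in the first position.
  have h7 : ∃ N ⊆ L, #N = 7 ∧ ∀ l ∈ N, G.degIn S l = 5 := by
    obtain ⟨y, hy, hmin⟩ := L.exists_min_image (fun l => G.degIn S l) (Finset.card_pos.1 (by omega))
    obtain ⟨c, hcS, hyc⟩ := degIn_pos_iff.1 (hpos y hy)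
    obtain ⟨c', hc'S, hc'⟩ := Finset.exists_mem_ne (by omega : 1 < #S) c
    obtain ⟨m, hm, hmS, hSm, hm0, -⟩ :=
      exists_enum hS (i := 0) (j := 1) (by decide) hcS hc'S hc'.symm
    have hsum := sum_card_not_adj (G := G) hm hmS hSm L
    have hind := degIn_add_card_not_adj (G := G) hm hmS hSm
    obtain ⟨I, hI, hI', hcard, -⟩ := key m hm hmS hSm (by
      intro l hl h6
      by_cases hly : l = y
      · exact ⟨0, by simpa [C, hm0, hly] using hyc⟩
      · have := add_le_sum_of_ne (fun l => #{i | ¬ G.Adj l (m i)}) hl hy hly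
        have := hind l
        have := hind y
        have := hmin l hl
        omega)
    have hc7 := card_le_sum_card_not_adj hI hI'
    refine ⟨I, hI, by omega, fun l hl => ?_⟩
    have h2 : ∑ l ∈ I, #{i | ¬ G.Adj l (m i)} ≤ ∑ l ∈ L, #{i | ¬ G.Adj l (m i)} :=
      Finset.sum_le_sum_of_subset hI
    have h3 := Finset.sum_erase_add I (fun l => #{i | ¬ G.Adj l (m i)}) hl
    have h4 := card_le_sum_card_not_adj (Finset.Subset.refl (I.erase l))
      fun l' hl' => hI' l' (Finset.mem_of_mem_erase hl')
    rw [Finset.card_erase_of_mem hl] at h4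
    obtain ⟨i, hi⟩ := hI' l hl
    have h5 : 0 < #{i | ¬ G.Adj l (m i)} := Finset.card_pos.2 ⟨i, by simpa using hi⟩
    have := hind l
    omega
  obtain ⟨N, hN, hN7, hN5⟩ := h7
  have hmiss : ∀ l ∈ N, ∃ c ∈ S, ∀ s ∈ S, G.Adj l s ↔ s ≠ c := by
    intro l hl
    have h1 : #{s ∈ S | ¬ G.Adj l s} = 1 := by
      have := Finset.card_filter_add_card_filter_not (s := S) (fun s => G.Adj l s)
      have h2 := hN5 l hl
      unfold degIn at h2
      omega
    obtain ⟨c, hc⟩ := Finset.card_eq_one.1 h1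
    have h2 : ∀ s, s ∈ S ∧ ¬ G.Adj l s ↔ s = c := fun s => by
      rw [← Finset.mem_singleton, ← hc, Finset.mem_filter]
    refine ⟨c, ((h2 c).2 rfl).1, fun s hs => ?_⟩
    have := h2 s
    tauto
  have hNsum : ∑ l ∈ N, G.degIn S l = 35 := by
    rw [Finset.sum_congr rfl hN5, Finset.sum_const, hN7]
    rfl
  have hLN : #(L \ N) = 1 := by rw [Finset.card_sdiff_of_subset hN]; omega
  obtain ⟨d, hd⟩ := Finset.card_eq_one.1 hLN
  have hdL : d ∈ L \ N := hd ▸ Finset.mem_singleton_self d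
  have hd6 : G.degIn S d = 6 := by
    have := Finset.sum_sdiff (f := G.degIn S) hN
    rw [hd, Finset.sum_singleton, hNsum] at this
    have := hle d
    omega
  have hdfull : ∀ s ∈ S, G.Adj d s := degIn_eq_card_iff.1 (hd6.trans hS.symm)
  have hmemN : ∀ l ∈ L, l ≠ d → l ∈ N := by
    intro l hl hld
    by_contra h
    exact hld (Finset.mem_singleton.1 (hd ▸ Finset.mem_sdiff.2 ⟨hl, h⟩))
  obtain ⟨l₀, hl₀⟩ := Finset.card_pos.1 (by omega : 0 < #N)
  obtain ⟨c, hcS, hc⟩ := hmiss l₀ hl₀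
  refine ⟨c, hcS, d, (Finset.mem_sdiff.1 hdL).1, fun l hl hld => ?_, hdfull⟩
  obtain ⟨c', hc'S, hc'⟩ := hmiss l (hmemN l hl hld)
  by_cases hcc : c' = c
  · rw [← hcc]; exact hc'
  exfalso
  -- No slot touches both positions 0 and 3. With the two different missed centres placed there,
  -- every slot is open to `l₀` or to `l`, against `key`.
  obtain ⟨m, hm, hmS, hSm, hm0, hm3⟩ :=
    exists_enum hS (i := 0) (j := 3) (by decide) hcS hc'S (Ne.symm hcc)
  have hind := degIn_add_card_not_adj (G := G) hm hmS hSm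
  obtain ⟨I, hI, hI', hcard, j, hj⟩ := key m hm hmS hSm (by
    intro l hl h8
    have := hind l
    by_cases hld : l = d
    · subst hld; omega
    · have := hN5 l (hmemN l hl hld)
      omega)
  have hIN : I = N := by
    refine Finset.eq_of_subset_of_card_le (fun l hl => hmemN l (hI hl) ?_) (by omega)
    rintro rfl
    obtain ⟨i, hi⟩ := hI' l hl
    exact hi (hdfull _ (hmS i))
  subst hIN
  have hadj : ∀ i, (G.Adj l₀ (m i) ↔ i ≠ 0) ∧ (G.Adj l (m i) ↔ i ≠ 3) := by
    intro i
    rw [hc _ (hmS i), hc' _ (hmS i), ← hm0, ← hm3, hm.ne_iff, hm.ne_iff]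
    exact ⟨Iff.rfl, Iff.rfl⟩
  have h0 := hj l₀ hl₀
  have h3 := hj l (hmemN l hl hld)
  simp only [hadj] at h0 h3
  clear hj
  revert h0 h3
  revert j
  decide

end

/-! ### The join on fourteen vertices: six vertices of degree at most five. -/

section

variable {V : Type*}
variable {G K : SimpleGraph V} {A B H S L : Finset V} {u v w : V}

/-- On `A`, the graph `G` is the join of a complete graph on the five vertices of `S` with a graph
whose only edge is `ab`. -/
structure IsJoinOn (G : SimpleGraph V) (A S : Finset V) (a b : V) : Prop where
  subset : S ⊆ A
  card : #S = 5
  left_mem : a ∈ A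
  right_mem : b ∈ A
  left_notMem : a ∉ S
  right_notMem : b ∉ S
  adj_iff : ∀ x ∈ A, ∀ y ∈ A,
    G.Adj x y ↔ x ≠ y ∧ (x ∈ S ∨ y ∈ S) ∨ x = a ∧ y = b ∨ x = b ∧ y = a

lemma IsJoinOn.of_parts {a b : V} (hS : #S = 5) (hSL : Disjoint S L) (hA : A = S ∪ L) (ha : a ∈ L)
    (hb : b ∈ L) (hab : G.Adj a b) (hSS : ∀ x ∈ S, ∀ y ∈ S, x ≠ y → G.Adj x y)
    (hLS : ∀ l ∈ L, ∀ s ∈ S, G.Adj l s)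
    (hLL : ∀ x ∈ L, ∀ y ∈ L, G.Adj x y → x = a ∧ y = b ∨ x = b ∧ y = a) : G.IsJoinOn A S a b := by
  have haS : a ∉ S := Finset.disjoint_right.1 hSL ha
  have hbS : b ∉ S := Finset.disjoint_right.1 hSL hb
  subst hA
  refine ⟨Finset.subset_union_left, hS, Finset.mem_union_right _ ha, Finset.mem_union_right _ hb,
    haS, hbS, fun x hx y hy => ⟨fun h => ?_, ?_⟩⟩
  · by_cases hxS : x ∈ S
    · exact Or.inl ⟨h.ne, Or.inl hxS⟩
    by_cases hyS : y ∈ S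
    · exact Or.inl ⟨h.ne, Or.inr hyS⟩
    exact Or.inr (hLL x ((Finset.mem_union.1 hx).resolve_left hxS) y
      ((Finset.mem_union.1 hy).resolve_left hyS) h)
  · rintro (⟨hne, h⟩ | ⟨rfl, rfl⟩ | ⟨rfl, rfl⟩)
    · rcases Finset.mem_union.1 hx with hx | hx <;> rcases Finset.mem_union.1 hy with hy | hy
      · exact hSS x hx y hy hne
      · exact (hLS y hy x hx).symm
      · exact hLS x hx y hy
      · rcases h with h | h
        · exact absurd hx (Finset.disjoint_left.1 hSL h)
        · exact absurd hy (Finset.disjoint_left.1 hSL h)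
    · exact hab
    · exact hab.symm

lemma degIn_insert_erase_sum {w' : V} (hw' : w' ∈ L) (hw : w ∉ L) :
    ∑ l ∈ insert w (L.erase w'), G.degIn S l + G.degIn S w' = ∑ l ∈ L, G.degIn S l + G.degIn S w := by
  rw [Finset.sum_insert fun h => hw (Finset.mem_of_mem_erase h), ← Finset.sum_erase_add L _ hw']
  ring

lemma card_insert_erase {w' : V} (hw' : w' ∈ L) (hw : w ∉ L) : #(insert w (L.erase w')) = #L := by
  rw [Finset.card_insert_of_notMem fun h => hw (Finset.mem_of_mem_erase h),
    Finset.card_erase_add_one hw']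

/-- A graph on three vertices has a spanning path, or at most one edge. -/
lemma spanning_path_or_degSum_le_two {T : Finset V} (hT : #T = 3) :
    (∃ a ∈ T, ∃ b ∈ T, ∃ c ∈ T, G.Adj a b ∧ G.Adj b c ∧ a ≠ c) ∨ G.degSum T = 0 ∨
      ∃ a b w, a ≠ b ∧ a ≠ w ∧ b ≠ w ∧ T = {a, b, w} ∧ G.Adj a b ∧ G.degSum T = 2 := by
  by_cases hP : ∃ a ∈ T, ∃ b ∈ T, ∃ c ∈ T, G.Adj a b ∧ G.Adj b c ∧ a ≠ c
  · exact Or.inl hP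
  right
  by_cases h0 : ∃ a ∈ T, ∃ b ∈ T, G.Adj a b
  · right
    obtain ⟨a, ha, b, hb, hab⟩ := h0
    have h1 : #((T.erase a).erase b) = 1 := by
      rw [Finset.card_erase_of_mem (Finset.mem_erase.2 ⟨hab.ne', hb⟩), Finset.card_erase_of_mem ha, hT]
    obtain ⟨w, hw⟩ := Finset.card_eq_one.1 h1
    have hw' : w ∈ (T.erase a).erase b := hw ▸ Finset.mem_singleton_self w
    have hwb := Finset.ne_of_mem_erase hw'
    have hwa := Finset.ne_of_mem_erase (Finset.mem_of_mem_erase hw')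
    have hwT := Finset.mem_of_mem_erase (Finset.mem_of_mem_erase hw')
    have hTe : T = {a, b, w} := by
      rw [← hw, Finset.insert_erase (Finset.mem_erase.2 ⟨hab.ne', hb⟩), Finset.insert_erase ha]
    refine ⟨a, b, w, hab.ne, hwa.symm, hwb.symm, hTe, hab, ?_⟩
    have haw : ¬ G.Adj a w := fun h => hP ⟨b, hb, a, ha, w, hwT, hab.symm, h, hwb.symm⟩
    have hbw : ¬ G.Adj b w := fun h => hP ⟨a, ha, b, hb, w, hwT, hab, h, hwa.symm⟩
    have hw0 : G.degIn T w = 0 := by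
      rw [degIn_eq_zero_iff, hTe]
      intro x hx
      simp only [Finset.mem_insert, Finset.mem_singleton] at hx
      rcases hx with rfl | rfl | rfl
      · exact fun h => haw h.symm
      · exact fun h => hbw h.symm
      · exact G.irrefl
    rw [degSum_erase hwT, hw0]
    have h2 : T.erase w = {a, b} := by
      rw [hTe]
      ext x
      simp only [Finset.mem_erase, Finset.mem_insert, Finset.mem_singleton]
      constructor
      · rintro ⟨h1, h2⟩; tauto
      · rintro (rfl | rfl)
        · exact ⟨hwa.symm, Or.inl rfl⟩
        · exact ⟨hwb.symm, Or.inr (Or.inl rfl)⟩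
    have h3 : #(T.erase w) = 2 := by rw [Finset.card_erase_of_mem hwT, hT]
    have h4 : G.degSum (T.erase w) = #(T.erase w) * (#(T.erase w) - 1) := by
      rw [degSum_eq_iff, h2]
      intro x hx y hy hxy
      simp only [Finset.mem_insert, Finset.mem_singleton] at hx hy
      rcases hx with rfl | rfl <;> rcases hy with rfl | rfl
      · exact absurd rfl hxy
      · exact hab
      · exact hab.symm
      · exact absurd rfl hxy
    rw [h4, h3]
  · left
    push Not at h0
    exact Finset.sum_eq_zero fun a ha => degIn_eq_zero_iff.2 fun b hb => h0 a ha b hb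

/-- This is the case k = 5 of Chvátal's condition. Let `W` be six vertices of degree at most five,
`T` three more of degree at most seven, and `M` the other five. A path spanning `T` would be a
three-vertex block, and no edge in `T` gives at most 110. With one edge in `T` every estimate is
tight, so `M` is complete, `W` is independent and `T` is fully joined to `M`. It remains to exclude
edges between `T` and `W`. -/
lemma exists_isJoinOn_of_six_low_degrees (hG : ¬ G.HasTwoPaths) (hA : #A = 14)
    (hD : 112 ≤ G.degSum A) (h5 : 6 ≤ #{x ∈ A | G.degIn A x ≤ 5})
    (h7 : 9 ≤ #{x ∈ A | G.degIn A x ≤ 7}) : ∃ S a b, G.IsJoinOn A S a b := by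
  obtain ⟨W, hW5, hW⟩ := Finset.exists_subset_card_eq h5
  have hWA : W ⊆ A := hW5.trans (Finset.filter_subset _ _)
  have hWd : ∀ x ∈ W, G.degIn A x ≤ 5 := fun x hx => (Finset.mem_filter.1 (hW5 hx)).2
  have hW7 : W ⊆ {x ∈ A | G.degIn A x ≤ 7} := fun x hx =>
    Finset.mem_filter.2 ⟨hWA hx, (hWd x hx).trans (by norm_num)⟩
  obtain ⟨T, hT7, hT⟩ := Finset.exists_subset_card_eq
    (show 3 ≤ #({x ∈ A | G.degIn A x ≤ 7} \ W) by
      rw [Finset.card_sdiff_of_subset hW7]; omega)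
  have hTA : T ⊆ A := fun x hx =>
    (Finset.mem_filter.1 (Finset.mem_sdiff.1 (hT7 hx)).1).1
  have hTd : ∀ x ∈ T, G.degIn A x ≤ 7 := fun x hx =>
    (Finset.mem_filter.1 (Finset.mem_sdiff.1 (hT7 hx)).1).2
  have hTW : Disjoint T W := Finset.disjoint_left.2 fun x hx => (Finset.mem_sdiff.1 (hT7 hx)).2
  obtain ⟨M, hM⟩ : ∃ M, M = (A \ W) \ T := ⟨_, rfl⟩
  have hTQ : T ⊆ A \ W := fun x hx => Finset.mem_sdiff.2 ⟨hTA hx, Finset.disjoint_left.1 hTW hx⟩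
  have hMT : Disjoint M T := hM ▸ Finset.sdiff_disjoint
  have hMTQ : M ∪ T = A \ W := by rw [hM, Finset.sdiff_union_of_subset hTQ]
  have hQW : Disjoint (M ∪ T) W := hMTQ ▸ Finset.sdiff_disjoint
  have hAe : A = (M ∪ T) ∪ W := by rw [hMTQ, Finset.sdiff_union_of_subset hWA]
  have hMW : Disjoint M W := hQW.mono_left Finset.subset_union_left
  have hM5 : #M = 5 := by
    rw [hM, Finset.card_sdiff_of_subset hTQ, Finset.card_sdiff_of_subset hWA]; omega
  have hQ8 : #(M ∪ T) = 8 := by rw [Finset.card_union_of_disjoint hMT]; omega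
  have dA : ∀ x, G.degIn A x = G.degIn M x + G.degIn T x + G.degIn W x := fun x => by
    rw [hAe, degIn_union hQW, degIn_union hMT]
  have e1 : G.degSum A = G.degSum (M ∪ T) + G.degSum W + 2 * ∑ l ∈ W, G.degIn (M ∪ T) l := by
    conv_lhs => rw [hAe]
    exact degSum_union hQW
  have e2 : G.degSum (M ∪ T) = G.degSum M + G.degSum T + 2 * ∑ t ∈ T, G.degIn M t := degSum_union hMT
  have e3 : ∑ l ∈ W, G.degIn (M ∪ T) l = ∑ l ∈ W, G.degIn M l + ∑ l ∈ W, G.degIn T l := by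
    rw [← Finset.sum_add_distrib]
    exact Finset.sum_congr rfl fun l _ => degIn_union hMT l
  have e4 : ∑ l ∈ W, G.degIn A l = ∑ l ∈ W, G.degIn M l + ∑ l ∈ W, G.degIn T l + G.degSum W := by
    rw [degSum, ← Finset.sum_add_distrib, ← Finset.sum_add_distrib]
    exact Finset.sum_congr rfl fun l _ => dA l
  have e5 : ∑ t ∈ T, G.degIn A t = ∑ t ∈ T, G.degIn M t + G.degSum T + ∑ t ∈ T, G.degIn W t := by
    rw [degSum, ← Finset.sum_add_distrib, ← Finset.sum_add_distrib]
    exact Finset.sum_congr rfl fun l _ => dA l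
  have e6 : ∑ t ∈ T, G.degIn W t = ∑ l ∈ W, G.degIn T l := sum_degIn_comm G T W
  have b1 : ∑ l ∈ W, G.degIn A l ≤ 30 := by
    have := Finset.sum_le_card_nsmul W (G.degIn A) 5 hWd
    rwa [hW] at this
  have b2 : ∑ t ∈ T, G.degIn A t ≤ 21 := by
    have := Finset.sum_le_card_nsmul T (G.degIn A) 7 hTd
    rwa [hT] at this
  have hM5' : ∀ x, G.degIn M x ≤ 5 := fun x => hM5 ▸ degIn_le_card G M x
  have b3 : ∑ t ∈ T, G.degIn M t ≤ 15 := by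
    have := Finset.sum_le_card_nsmul T (G.degIn M) 5 fun t _ => hM5' t
    rwa [hT] at this
  have b4 : G.degSum M ≤ 20 := by
    have := degSum_le G M
    rwa [hM5] at this
  have b5 : G.degSum T ≤ 6 := by
    have := degSum_le G T
    rwa [hT] at this
  have hMW26 : 26 ≤ ∑ l ∈ W, G.degIn M l := by omega
  have nM : ∀ t ∈ T, t ∉ M := fun t ht => Finset.disjoint_right.1 hMT ht
  have nW : ∀ t ∈ T, t ∉ W := fun t ht => Finset.disjoint_left.1 hTW ht
  have nWM : ∀ t ∈ W, t ∉ M := fun t ht => Finset.disjoint_right.1 hMW ht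
  rcases spanning_path_or_degSum_le_two (G := G) hT with
    ⟨a, ha, b, hb, c, hc, hab, hbc, hac⟩ | h0 | ⟨a, b, w, hab, haw, hbw, hTe, hadj, hT2⟩
  · refine absurd (hasTwoPaths_of_three_block hM5 hW hMW hMW26 hab hbc hac (nM a ha) (nM b hb)
      (nM c hc) (nW a ha) (nW b hb) (nW c hc) ?_) hG
    have h1 := Finset.sum_erase_add T (G.degIn M) ha
    have h2 : ∑ t ∈ T.erase a, G.degIn M t ≤ _ :=
      Finset.sum_le_card_nsmul _ _ 5 fun t _ => hM5' t
    rw [Finset.card_erase_of_mem ha, hT, smul_eq_mul] at h2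
    omega
  · omega
  have haT : a ∈ T := by simp [hTe]
  have hbT : b ∈ T := by simp [hTe]
  have hwT : w ∈ T := by simp [hTe]
  have hW0 : G.degSum W = 0 := by omega
  have hM20 : G.degSum M = 20 := by omega
  have hsumT : ∀ f : V → ℕ, ∑ t ∈ T, f t = f a + f b + f w := fun f => by
    rw [hTe, Finset.sum_insert (by simp [hab, haw]), Finset.sum_pair hbw, add_assoc]
  have hTM : G.degIn M a = 5 ∧ G.degIn M b = 5 ∧ G.degIn M w = 5 := by
    have h1 := hsumT (G.degIn M)
    have := hM5' a
    have := hM5' b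
    have := hM5' w
    omega
  have hWind : ∀ x ∈ W, ∀ y ∈ W, ¬ G.Adj x y := fun x hx => degIn_eq_zero_iff.1
    ((Finset.sum_eq_zero_iff.1 hW0) x hx)
  have hTdeg : ∀ y ∈ W, ∀ t ∈ T, G.Adj y t → G.degIn M y ≤ 4 := by
    intro y hy t ht h
    have h1 := hWd y hy
    have h2 : 0 < G.degIn T y := degIn_pos_iff.2 ⟨t, ht, h⟩
    have := dA y
    omega
  -- An edge from `p` to `y ∈ W` would give the block `q p y`. The isolated vertex `w` of `T`
  -- replaces `y` in `W`, which loses nothing because `w` sees all of `M`.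
  have hblock : ∀ p q y, p ∈ T → q ∈ T → p ≠ w → q ≠ w → G.Adj q p → G.degIn M q = 5 →
      y ∈ W → ¬ G.Adj p y := by
    intro p q y hp hq hpw hqw hqp hq5 hy hpy
    have hqy : q ≠ y := fun h => nW q hq (h ▸ hy)
    have hpy' : p ≠ y := fun h => nW p hp (h ▸ hy)
    have hwW := nW w hwT
    refine hG (hasTwoPaths_of_three_block hM5 ((card_insert_erase hy hwW).trans hW) ?_ ?_ hqp hpy
      hqy (nM q hq) (nM p hp) (nWM y hy) ?_ ?_ ?_ (by omega))
    · rw [Finset.disjoint_insert_right]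
      exact ⟨nM w hwT, hMW.mono_right (Finset.erase_subset _ _)⟩
    · have h1 := degIn_insert_erase_sum (G := G) (S := M) hy hwW
      have := hTdeg y hy p hp hpy.symm
      omega
    · rw [Finset.mem_insert, not_or]
      exact ⟨hqw, fun h => nW q hq (Finset.mem_of_mem_erase h)⟩
    · rw [Finset.mem_insert, not_or]
      exact ⟨hpw, fun h => nW p hp (Finset.mem_of_mem_erase h)⟩
    · rw [Finset.mem_insert, not_or]
      exact ⟨fun h => hwW (h ▸ hy), Finset.notMem_erase _ _⟩
  have haW : ∀ y ∈ W, ¬ G.Adj a y := fun y hy =>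
    hblock a b y haT hbT haw hbw hadj.symm hTM.2.1 hy
  have hbW : ∀ y ∈ W, ¬ G.Adj b y := fun y hy =>
    hblock b a y hbT haT hbw haw hadj hTM.1 hy
  -- The edges `yw` and `ab` would be the two pairs of `hasTwoPaths_of_two_pairs`.
  have hwW : ∀ y ∈ W, ¬ G.Adj w y := by
    intro y hy hwy
    have hne : ∀ t ∈ T, y ≠ t := fun t ht h => nW t ht (h ▸ hy)
    have h1 := hsumT (G.degIn W)
    rw [degIn_eq_zero_iff.2 haW, degIn_eq_zero_iff.2 hbW] at h1
    have h3 := dA w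
    have h4 := hTd w hwT
    have h5 := Finset.sum_erase_add W (G.degIn M) hy
    have h6 := hTdeg y hy w hwT hwy.symm
    refine hG (hasTwoPaths_of_two_pairs (z₁ := y) (z₂ := w) (z₃ := a) (z₄ := b) (S := M)
      (L := W.erase y) hM5 (by rw [Finset.card_erase_of_mem hy, hW])
      (hMW.mono_right (Finset.erase_subset _ _)) (by omega) ?_ ?_ ?_ hwy.symm hadj)
    · simp [hab, haw.symm, hbw.symm, hne a haT, hne b hbT, hne w hwT]
    · simp [nM a haT, nM b hbT, nM w hwT, nWM y hy]
    · simp [nW a haT, nW b hbT, nW w hwT]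
  have hsum0 : ∑ t ∈ T, G.degIn W t = 0 := by
    rw [hsumT, degIn_eq_zero_iff.2 haW, degIn_eq_zero_iff.2 hbW, degIn_eq_zero_iff.2 hwW]
  have hWM : ∀ y ∈ W, G.degIn M y = 5 := by
    intro y hy
    have h5 := Finset.sum_erase_add W (G.degIn M) hy
    have h2 : ∑ t ∈ W.erase y, G.degIn M t ≤ _ :=
      Finset.sum_le_card_nsmul _ _ 5 fun t _ => hM5' t
    rw [Finset.card_erase_of_mem hy, hW, smul_eq_mul] at h2
    have := hM5' y
    omega
  have hnab : ¬ G.Adj a w ∧ ¬ G.Adj b w := by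
    have h1 := hsumT (G.degIn T)
    have ha1 : 0 < G.degIn T a := degIn_pos_iff.2 ⟨b, hbT, hadj⟩
    have hb1 : 0 < G.degIn T b := degIn_pos_iff.2 ⟨a, haT, hadj.symm⟩
    have h2 : G.degIn T w = 0 := by
      change G.degSum T = _ at h1
      omega
    rw [degIn_eq_zero_iff] at h2
    exact ⟨fun h => h2 a haT h.symm, fun h => h2 b hbT h.symm⟩
  have hTW0 : ∀ t ∈ T, ∀ y ∈ W, ¬ G.Adj t y := by
    intro t ht
    rw [hTe] at ht
    simp only [Finset.mem_insert, Finset.mem_singleton] at ht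
    rcases ht with rfl | rfl | rfl
    · exact haW
    · exact hbW
    · exact hwW
  refine ⟨M, a, b, IsJoinOn.of_parts hM5 (L := T ∪ W) ?_ (by rw [hAe, Finset.union_assoc])
    (Finset.mem_union_left _ haT) (Finset.mem_union_left _ hbT) hadj ?_ ?_ ?_⟩
  · rw [Finset.disjoint_union_right]; exact ⟨hMT, hMW⟩
  · rw [← degSum_eq_iff, hM20, hM5]
  · intro l hl
    rw [← degIn_eq_card_iff, hM5]
    rcases Finset.mem_union.1 hl with h | h
    · rw [hTe] at h
      simp only [Finset.mem_insert, Finset.mem_singleton] at h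
      rcases h with rfl | rfl | rfl
      exacts [hTM.1, hTM.2.1, hTM.2.2]
    · exact hWM l h
  · intro x hx y hy hxy
    rcases Finset.mem_union.1 hx with hx | hx <;> rcases Finset.mem_union.1 hy with hy | hy
    · rw [hTe] at hx hy
      simp only [Finset.mem_insert, Finset.mem_singleton] at hx hy
      rcases hx with rfl | rfl | rfl <;> rcases hy with rfl | rfl | rfl
      · exact absurd hxy G.irrefl
      · simp
      · exact absurd hxy hnab.1
      · simp
      · exact absurd hxy G.irrefl
      · exact absurd hxy hnab.2
      · exact absurd hxy.symm hnab.1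
      · exact absurd hxy.symm hnab.2
      · exact absurd hxy G.irrefl
    · exact absurd hxy (hTW0 x hx y hy)
    · exact absurd hxy.symm (hTW0 y hy x hx)
    · exact absurd hxy (hWind x hx y hy)

end

/-! ### The join on fourteen vertices: two nonadjacent vertices of degree six. -/

section

variable {V : Type*}
variable {G K : SimpleGraph V} {A B H S L : Finset V} {u v w : V}

/-- Two disjoint edges inside `L` would be the two pairs of `hasTwoPaths_of_two_pairs`. With only
one edge in `L` the degree sum is at most 20 + 90 + 2 = 112, so everything is tight. -/
lemma exists_isJoinOn_of_matching (hG : ¬ G.HasTwoPaths) (hS : #S = 5) (hL : #L = 9)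
    (hSL : Disjoint S L) (hD : 112 ≤ G.degSum (S ∪ L)) (hdeg : ∀ l ∈ L, G.degIn L l ≤ 1) :
    ∃ S' a b, G.IsJoinOn (S ∪ L) S' a b := by
  have e1 : G.degSum (S ∪ L) = _ := degSum_union hSL
  have b1 := degSum_le G S
  rw [hS] at b1
  have b2 : ∑ l ∈ L, G.degIn S l ≤ _ :=
    Finset.sum_le_card_nsmul _ _ 5 fun l _ => hS ▸ degIn_le_card G S l
  have b3 : G.degSum L ≤ _ := Finset.sum_le_card_nsmul _ _ 1 hdeg
  rw [hL, smul_eq_mul] at b2 b3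
  have hle : ∀ l, G.degIn S l ≤ 5 := fun l => hS ▸ degIn_le_card G S l
  obtain ⟨a, ha, ha0⟩ : ∃ a ∈ L, G.degIn L a ≠ 0 := by
    by_contra! hcon
    have : G.degSum L = 0 := Finset.sum_eq_zero hcon
    omega
  obtain ⟨b, hb, hab⟩ := degIn_pos_iff.1 (Nat.pos_of_ne_zero ha0)
  have huniq : ∀ x ∈ L, ∀ y ∈ L, ∀ z ∈ L, G.Adj x y → G.Adj x z → y = z := by
    intro x hx y hy z hz hxy hxz
    have h1 := hdeg x hx
    rw [degIn, Finset.card_le_one] at h1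
    exact h1 y (Finset.mem_filter.2 ⟨hy, hxy⟩) z (Finset.mem_filter.2 ⟨hz, hxz⟩)
  by_cases h2 : ∃ x ∈ L, ∃ y ∈ L, G.Adj x y ∧ x ≠ a ∧ x ≠ b
  · exfalso
    obtain ⟨x, hx, y, hy, hxy, hxa, hxb⟩ := h2
    have hya : y ≠ a := by
      rintro rfl
      exact hxb (huniq y hy x hx b hb hxy.symm hab)
    have hyb : y ≠ b := by
      rintro rfl
      exact hxa (huniq y hy x hx a ha hxy.symm hab.symm)
    have hxy' := hxy.ne
    have hm1 : y ∈ ((L.erase a).erase b).erase x := by simp [*, hxy'.symm]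
    have hm2 : x ∈ (L.erase a).erase b := by simp [*]
    have hm3 : b ∈ L.erase a := by simp [*, hab.ne']
    have s1 := Finset.sum_erase_add _ (G.degIn S) ha
    have s2 := Finset.sum_erase_add _ (G.degIn S) hm3
    have s3 := Finset.sum_erase_add _ (G.degIn S) hm2
    have s4 := Finset.sum_erase_add _ (G.degIn S) hm1
    have := hle a
    refine hG (hasTwoPaths_of_two_pairs (z₁ := a) (z₂ := b) (z₃ := x) (z₄ := y) (S := S)
      (L := (((L.erase a).erase b).erase x).erase y) hS ?_ ?_ (by omega) ?_ ?_ ?_ hab hxy)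
    · rw [Finset.card_erase_of_mem hm1, Finset.card_erase_of_mem hm2, Finset.card_erase_of_mem hm3,
        Finset.card_erase_of_mem ha, hL]
    · refine hSL.mono_right fun z hz => ?_
      simp only [Finset.mem_erase] at hz
      tauto
    · simp [hab.ne, hxa.symm, hxb.symm, hya.symm, hyb.symm, hxy']
    · simp [Finset.disjoint_right.1 hSL ha, Finset.disjoint_right.1 hSL hb,
        Finset.disjoint_right.1 hSL hx, Finset.disjoint_right.1 hSL hy]
    · simp
  · push Not at h2
    have hD2 : G.degSum L ≤ 2 := by
      have hz : ∀ x ∈ L, x ≠ a → x ≠ b → G.degIn L x = 0 := fun x hx hxa hxb =>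
        degIn_eq_zero_iff.2 fun y hy hxy => hxb (h2 x hx y hy hxy hxa)
      have h3 : G.degSum L = ∑ x ∈ ({a, b} : Finset V), G.degIn L x := by
        symm
        refine Finset.sum_subset ?_ fun x hx hx' => ?_
        · intro x hx
          rcases Finset.mem_insert.1 hx with rfl | hx
          · exact ha
          · rwa [Finset.mem_singleton.1 hx]
        · simp only [Finset.mem_insert, Finset.mem_singleton, not_or] at hx'
          exact hz x hx hx'.1 hx'.2
      rw [h3, Finset.sum_pair hab.ne]
      exact Nat.add_le_add (hdeg a ha) (hdeg b hb)
    refine ⟨S, a, b, IsJoinOn.of_parts hS hSL rfl ha hb hab ?_ ?_ ?_⟩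
    · rw [← degSum_eq_iff, hS]; omega
    · intro l hl
      rw [← degIn_eq_card_iff, hS]
      have h5 := Finset.sum_erase_add L (G.degIn S) hl
      have h2 : ∑ t ∈ L.erase l, G.degIn S t ≤ _ :=
        Finset.sum_le_card_nsmul _ _ 5 fun t _ => hle t
      rw [Finset.card_erase_of_mem hl, hL, smul_eq_mul] at h2
      have := hle l
      omega
    · intro x hx y hy hxy
      by_cases hxa : x = a
      · subst hxa
        exact Or.inl ⟨rfl, huniq x hx y hy b hb hxy hab⟩
      · have hxb := h2 x hx y hy hxy hxa
        subst hxb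
        exact Or.inr ⟨rfl, huniq x hx y hy a ha hxy hab.symm⟩

/-- At most seven of the 48 pairs between `S` and `L` are missing, and they all sit at one centre
`c`. Moving `c` to the other side leaves five centres, and its only neighbour `d` in `L` provides
the edge. -/
lemma exists_isJoinOn_of_independent (hG : ¬ G.HasTwoPaths) (hS : #S = 6) (hL : #L = 8)
    (hSL : Disjoint S L) (hD : 112 ≤ G.degSum (S ∪ L)) (hpos : ∀ l ∈ L, 1 ≤ G.degIn S l)
    (hind : ∀ x ∈ L, ∀ y ∈ L, ¬ G.Adj x y) : ∃ S' a b, G.IsJoinOn (S ∪ L) S' a b := by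
  have e1 : G.degSum (S ∪ L) = _ := degSum_union hSL
  have b1 := degSum_le G S
  rw [hS] at b1
  have hL0 : G.degSum L = 0 :=
    Finset.sum_eq_zero fun x hx => degIn_eq_zero_iff.2 fun y hy => hind x hx y hy
  obtain ⟨c, hc, d, hd, h1, h2⟩ := exists_common_missed_center hG hS hL hSL (by omega) hpos
  have hle : ∑ l ∈ L, G.degIn S l ≤ 41 := by
    rw [← Finset.sum_erase_add _ _ hd]
    have h3 : ∀ l ∈ L.erase d, G.degIn S l ≤ 5 := by
      intro l hl
      have h4 := degIn_le_erase_add_one (G := G) hc l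
      have h5 := degIn_le_card G (S.erase c) l
      rw [Finset.card_erase_of_mem hc, hS] at h5
      have h6 : ¬ G.Adj l c := fun h => (h1 l (Finset.mem_of_mem_erase hl)
        (Finset.ne_of_mem_erase hl) c hc).1 h rfl
      have h7 : G.degIn S l < 6 := by
        refine lt_of_le_of_ne (hS ▸ degIn_le_card G S l) fun h => h6 ?_
        exact degIn_eq_card_iff.1 (h.trans hS.symm) c hc
      omega
    have h4 : ∑ l ∈ L.erase d, G.degIn S l ≤ _ := Finset.sum_le_card_nsmul _ _ 5 h3
    rw [Finset.card_erase_of_mem hd, hL, smul_eq_mul] at h4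
    have h5 := degIn_le_card G S d
    omega
  have hSS : ∀ x ∈ S, ∀ y ∈ S, x ≠ y → G.Adj x y := by
    rw [← degSum_eq_iff, hS]; omega
  have hcL : c ∉ L := Finset.disjoint_left.1 hSL hc
  refine ⟨S.erase c, c, d, IsJoinOn.of_parts (L := insert c L) (by
      rw [Finset.card_erase_of_mem hc, hS]) ?_ ?_ (Finset.mem_insert_self _ _)
      (Finset.mem_insert_of_mem hd) (h2 c hc).symm ?_ ?_ ?_⟩
  · rw [Finset.disjoint_insert_right]
    exact ⟨Finset.notMem_erase _ _, hSL.mono_left (Finset.erase_subset _ _)⟩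
  · ext x
    simp only [Finset.mem_union, Finset.mem_erase, Finset.mem_insert]
    by_cases hx : x = c
    · simp [hx, hc]
    · simp [hx]
  · exact fun x hx y hy => hSS x (Finset.mem_of_mem_erase hx) y (Finset.mem_of_mem_erase hy)
  · intro l hl s hs
    rw [Finset.mem_erase] at hs
    rcases Finset.mem_insert.1 hl with rfl | hl
    · exact hSS l hc s hs.2 hs.1.symm
    · by_cases hld : l = d
      · exact hld ▸ h2 s hs.2
      · exact (h1 l hl hld s hs.2).2 hs.1
  · intro x hx y hy hxy
    have key : ∀ y ∈ L, G.Adj c y → y = d := fun y hy h => by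
      by_contra hyd
      exact (h1 y hy hyd c hc).1 h.symm rfl
    rcases Finset.mem_insert.1 hx with hxc | hx' <;> rcases Finset.mem_insert.1 hy with hyc | hy'
    · exact absurd (hxc.trans hyc.symm) hxy.ne
    · exact Or.inl ⟨hxc, key y hy' (hxc ▸ hxy)⟩
    · exact Or.inr ⟨key x hx' (hyc ▸ hxy.symm), hyc⟩
    · exact absurd hxy (hind x hx' y hy')

/-- In this form everything outside `S` is charged to vertices of `L`, where both summands are
bounded by degree conditions. -/
lemma degSum_union_eq_sum (hSL : Disjoint S L) :
    G.degSum (S ∪ L) = G.degSum S + ∑ l ∈ L, (G.degIn S l + G.degIn (S ∪ L) l) := by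
  rw [degSum_union hSL, Finset.sum_add_distrib,
    Finset.sum_congr rfl fun l _ => degIn_union hSL l, Finset.sum_add_distrib]
  simp only [degSum]
  ring

/-- The structure of a dense graph on fourteen vertices in which nonadjacent vertices have degree
sum at most twelve, with two nonadjacent vertices of degree six. -/
lemma exists_isJoinOn_of_degree_six (hG : ¬ G.HasTwoPaths) (hA : #A = 14) (hD : 112 ≤ G.degSum A)
    (hpos : ∀ x ∈ A, 1 ≤ G.degIn A x) (hlow : ∃ x ∈ A, G.degIn A x ≤ 5) (hGK : G ≤ K)
    (hK : ∀ x ∈ A, ∀ y ∈ A, x ≠ y → ¬ K.Adj x y → K.degIn A x + K.degIn A y ≤ 12)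
    (hu : u ∈ A) (hv : v ∈ A) (huv : u ≠ v) (hu6 : K.degIn A u = 6) (hv6 : K.degIn A v = 6)
    (h8 : 8 ≤ #{x ∈ A | K.degIn A x ≤ 6}) : ∃ S a b, G.IsJoinOn A S a b := by
  obtain ⟨L, hLdef⟩ : ∃ L, L = {x ∈ A | K.degIn A x ≤ 6} := ⟨_, rfl⟩
  obtain ⟨S, hSdef⟩ : ∃ S, S = {x ∈ A | ¬ K.degIn A x ≤ 6} := ⟨_, rfl⟩
  have hcard : #L + #S = 14 := by
    rw [hLdef, hSdef, Finset.card_filter_add_card_filter_not, hA]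
  have hSL : Disjoint S L := by
    rw [hLdef, hSdef]
    exact (Finset.disjoint_filter_filter_not _ _ _).symm
  have hAe : A = S ∪ L := by
    rw [hLdef, hSdef, Finset.union_comm, Finset.filter_union_filter_not_eq]
  have hL6 : ∀ l ∈ L, K.degIn A l ≤ 6 := fun l hl => by
    rw [hLdef] at hl; exact (Finset.mem_filter.1 hl).2
  have hS7 : ∀ s ∈ S, 7 ≤ K.degIn A s := fun s hs => by
    rw [hSdef] at hs
    have := (Finset.mem_filter.1 hs).2
    omega
  have hSA : S ⊆ A := hAe ▸ Finset.subset_union_left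
  have hLA : L ⊆ A := hAe ▸ Finset.subset_union_right
  have h13 : ∀ x ∈ A, K.degIn A x ≤ 13 := fun x hx => by
    have := degIn_lt_card (G := K) hx
    omega
  have hDK : 112 ≤ K.degSum A := hD.trans (degSum_mono_graph hGK A)
  have hclique : ∀ s ∈ S, ∀ y ∈ A, y ≠ s → 6 ≤ K.degIn A y → K.Adj y s := by
    intro s hs y hy hys h
    by_contra hcon
    have := hK y hy s (hSA hs) hys hcon
    have := hS7 s hs
    omega
  rw [← hLdef] at h8
  -- Four vertices of degree 13 and ten of degree 6 give exactly 112, and the vertex of degree at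
  -- most five pushes this below 112.
  have hS5 : 5 ≤ #S := by
    by_contra hcon
    obtain ⟨x, hx, hx5⟩ := hlow
    have h1 : ∑ y ∈ L, G.degIn A y ≤ #L * 6 := Finset.sum_le_card_nsmul _ _ 6 fun y hy =>
      (degIn_mono_graph hGK A y).trans (hL6 y hy)
    have h2 : ∑ y ∈ S, G.degIn A y ≤ #S * 13 := Finset.sum_le_card_nsmul _ _ 13 fun y hy =>
      (degIn_mono_graph hGK A y).trans (h13 y (hSA hy))
    have h3 : G.degSum A = ∑ y ∈ S, G.degIn A y + ∑ y ∈ L, G.degIn A y := by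
      rw [degSum, ← Finset.sum_union hSL, ← hAe]
    rw [hAe] at hx
    rcases Finset.mem_union.1 hx with hx | hx
    · have h4 := Finset.sum_erase_add S (G.degIn A) hx
      have h5 : ∑ y ∈ S.erase x, G.degIn A y ≤ #(S.erase x) * 13 :=
        Finset.sum_le_card_nsmul _ _ 13 fun y hy =>
          (degIn_mono_graph hGK A y).trans (h13 y (hSA (Finset.mem_of_mem_erase hy)))
      rw [Finset.card_erase_of_mem hx] at h5
      have := Finset.card_pos.2 ⟨x, hx⟩
      omega
    · have h4 := Finset.sum_erase_add L (G.degIn A) hx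
      have h5 : ∑ y ∈ L.erase x, G.degIn A y ≤ #(L.erase x) * 6 :=
        Finset.sum_le_card_nsmul _ _ 6 fun y hy =>
          (degIn_mono_graph hGK A y).trans (hL6 y (Finset.mem_of_mem_erase hy))
      rw [Finset.card_erase_of_mem hx] at h5
      have := Finset.card_pos.2 ⟨x, hx⟩
      omega
  -- The vertices of `L` are split into those joined to all of `S` and those missing some of it.
  obtain ⟨F, hF⟩ : ∃ F, F = {l ∈ L | K.degIn S l = #S} := ⟨_, rfl⟩
  obtain ⟨N, hN⟩ : ∃ N, N = {l ∈ L | ¬ K.degIn S l = #S} := ⟨_, rfl⟩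
  have hFN : #F + #N = #L := by
    rw [hF, hN, Finset.card_filter_add_card_filter_not]
  have hFL : F ⊆ L := hF ▸ Finset.filter_subset _ _
  have hNL : N ⊆ L := hN ▸ Finset.filter_subset _ _
  have hfull : ∀ l ∈ L, K.degIn A l = 6 → l ∈ F := by
    intro l hl h6
    rw [hF, Finset.mem_filter]
    refine ⟨hl, degIn_eq_card_iff.2 fun s hs => hclique s hs l (hLA hl) ?_ h6.ge⟩
    rintro rfl
    exact Finset.disjoint_left.1 hSL hs hl
  have huL : u ∈ L := by rw [hLdef]; exact Finset.mem_filter.2 ⟨hu, hu6.le⟩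
  have hvL : v ∈ L := by rw [hLdef]; exact Finset.mem_filter.2 ⟨hv, hv6.le⟩
  have hF2 : 2 ≤ #F := by
    rw [← Finset.card_pair huv]
    refine Finset.card_le_card fun x hx => ?_
    rcases Finset.mem_insert.1 hx with rfl | hx
    · exact hfull _ huL hu6
    · rw [Finset.mem_singleton.1 hx]; exact hfull _ hvL hv6
  have dA : ∀ x, K.degIn A x = K.degIn S x + K.degIn L x := fun x => by
    rw [hAe, degIn_union hSL]
  -- The degrees of the vertices of `S`, and of the vertices they miss.
  have hSdeg : ∀ s ∈ S, #S - 1 + #F + K.degIn N s ≤ K.degIn A s := by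
    intro s hs
    have h1 : K.degIn S s = #S - 1 := by
      have h2 : K.degIn (S.erase s) s = #(S.erase s) := degIn_eq_card_iff.2 fun t ht =>
        (hclique s hs t (hSA (Finset.mem_of_mem_erase ht)) (Finset.ne_of_mem_erase ht)
          (by have := hS7 t (Finset.mem_of_mem_erase ht); omega)).symm
      rw [degIn_erase_self, Finset.card_erase_of_mem hs] at h2
      exact h2
    have h2 : K.degIn F s = #F := degIn_eq_card_iff.2 fun l hl => by
      rw [hF, Finset.mem_filter] at hl
      exact (degIn_eq_card_iff.1 hl.2 s hs).symm
    have h3 : L = F ∪ N := by rw [hF, hN, Finset.filter_union_filter_not_eq]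
    have h4 : Disjoint F N := by rw [hF, hN]; exact Finset.disjoint_filter_filter_not _ _ _
    rw [dA, h3, degIn_union h4, h1, h2]
    omega
  -- Every `s ∈ S` sees the rest of `S` and all of `F`, so its degree is large and a vertex missing
  -- it must be poor. In numbers, a vertex of `N` has degree at most `#N - 1`.
  have hmiss : ∀ l ∈ L, ∀ s ∈ S, ¬ K.Adj l s → K.degIn A l + (#S - 1 + #F + K.degIn N s) ≤ 12 := by
    intro l hl s hs h
    have h1 := hK l (hLA hl) s (hSA hs) (by
      rintro rfl; exact Finset.disjoint_left.1 hSL hs hl) h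
    have := hSdeg s hs
    omega
  have hNmiss : ∀ l ∈ N, ∃ s ∈ S, ¬ K.Adj l s := by
    intro l hl
    rw [hN, Finset.mem_filter, degIn_eq_card_iff] at hl
    have := hl.2
    push Not at this
    exact this
  have hNd : ∀ l ∈ N, K.degIn A l + 1 ≤ #N ∧ K.degIn A l ≤ 5 ∧ K.degIn S l + 1 ≤ #S ∧
      K.degIn S l ≤ K.degIn A l := by
    intro l hl
    obtain ⟨s, hs, hls⟩ := hNmiss l hl
    have h1 := hmiss l (hNL hl) s hs hls
    have h2 := hL6 l (hNL hl)
    have h3 : K.degIn A l ≠ 6 := fun h => by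
      have h4 := hfull l (hNL hl) h
      rw [hN, Finset.mem_filter] at hl
      rw [hF, Finset.mem_filter] at h4
      exact hl.2 h4.2
    have h4 := degIn_le_card K S l
    have h5 : K.degIn S l ≠ #S := by
      rw [hN, Finset.mem_filter] at hl
      exact hl.2
    have h6 := degIn_mono (G := K) hSA l
    refine ⟨?_, ?_, ?_, h6⟩ <;> omega
  have hFd : ∀ l ∈ F, K.degIn S l = #S ∧ K.degIn A l ≤ 6 := by
    intro l hl
    have := hL6 l (hFL hl)
    rw [hF, Finset.mem_filter] at hl
    exact ⟨hl.2, this⟩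
  have hsum : K.degSum A = K.degSum S + ∑ l ∈ F, (K.degIn S l + K.degIn A l) +
      ∑ l ∈ N, (K.degIn S l + K.degIn A l) := by
    have h1 := degSum_union_eq_sum (G := K) hSL
    rw [← hAe] at h1
    rw [h1, hF, hN, add_assoc, Finset.sum_filter_add_sum_filter_not]
  have hSsum := degSum_le K S
  have hFsum : ∑ l ∈ F, (K.degIn S l + K.degIn A l) ≤ #F * (#S + 6) :=
    Finset.sum_le_card_nsmul F (fun l => K.degIn S l + K.degIn A l) (#S + 6) fun l hl => by
      have := hFd l hl
      omega
  have hNsum : ∀ c, (∀ l ∈ N, K.degIn S l + K.degIn A l ≤ c) →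
      ∑ l ∈ N, (K.degIn S l + K.degIn A l) ≤ #N * c := fun c h =>
    Finset.sum_le_card_nsmul N (fun l => K.degIn S l + K.degIn A l) c h
  rw [hAe] at hD
  have h56 : #S = 5 ∨ #S = 6 := by omega
  rcases h56 with h5 | h6
  · rw [h5] at hSsum hFsum
    have hN0 : #N = 0 := by
      have hN7 : #N ≤ 7 := by omega
      have hc1 := hNsum (2 * (#N - 1)) fun l hl => by
        have := hNd l hl
        omega
      have hc2 := hNsum 9 fun l hl => by
        have := hNd l hl
        omega
      have hF' : #F = 9 - #N := by omega
      rw [hF'] at hFsum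
      generalize #N = f at *
      interval_cases f <;> omega
    rw [hAe]
    refine exists_isJoinOn_of_matching hG h5 (by omega) hSL hD fun l hl => ?_
    have hlF : l ∈ F := by
      have h1 : F = L := Finset.eq_of_subset_of_card_le hFL (by omega)
      rwa [h1]
    have h1 := hFd l hlF
    have h2 := dA l
    have h3 := degIn_mono_graph hGK L l
    omega
  · rw [h6] at hSsum hFsum
    -- Vertices of `F` spend all their six edges on `S`, so an edge inside `L` has both ends in `N`.
    -- The count then leaves only `#N = 6`.
    have hKL : ∀ l ∈ L, K.degIn L l = 0 := by
      have hFL0 : ∀ l ∈ F, K.degIn L l = 0 := fun l hl => by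
        have h1 := hFd l hl
        have h2 := dA l
        omega
      by_contra! hcon
      obtain ⟨a, ha, ha0⟩ := hcon
      have hFLN : ∀ l ∈ L, l ∉ F → l ∈ N := fun l hl h => by
        rw [hN, Finset.mem_filter]
        rw [hF, Finset.mem_filter] at h
        exact ⟨hl, fun h' => h ⟨hl, h'⟩⟩
      have haN : a ∈ N := hFLN a ha fun h => ha0 (hFL0 a h)
      obtain ⟨b, hb, hab⟩ := degIn_pos_iff.1 (Nat.pos_of_ne_zero ha0)
      have hb0 : 0 < K.degIn L b := degIn_pos_iff.2 ⟨a, ha, hab.symm⟩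
      have hbN : b ∈ N := hFLN b hb fun h => hb0.ne' (hFL0 b h)
      have hN6 : #N = 6 := by
        have hN7 : #N ≤ 6 := by omega
        have hN2 : 2 ≤ #N := by
          rw [← Finset.card_pair hab.ne]
          refine Finset.card_le_card fun x hx => ?_
          rcases Finset.mem_insert.1 hx with rfl | hx
          · exact haN
          · rwa [Finset.mem_singleton.1 hx]
        have hc1 := hNsum (2 * (#N - 1)) fun l hl => by
          have := hNd l hl
          omega
        have hF' : #F = 8 - #N := by omega
        rw [hF'] at hFsum
        generalize #N = f at *
        interval_cases f <;> omega
      have hF2' : #F = 2 := by omega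
      rw [hF2'] at hFsum
      -- All bounds are tight: each vertex of `N` has degree five.
      have hN58 : 58 ≤ ∑ l ∈ N, (K.degIn S l + K.degIn A l) := by omega
      have s1 := Finset.sum_erase_add N (fun l => K.degIn S l + K.degIn A l) haN
      have hbNa : b ∈ N.erase a := Finset.mem_erase.2 ⟨hab.ne', hbN⟩
      have s2 := Finset.sum_erase_add (N.erase a) (fun l => K.degIn S l + K.degIn A l) hbNa
      have hle : ∀ l ∈ N, K.degIn S l + K.degIn A l ≤ 10 := fun l hl => by
        have := hNd l hl
        omega
      have s3 : ∑ l ∈ (N.erase a).erase b, (K.degIn S l + K.degIn A l) ≤ _ :=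
        Finset.sum_le_card_nsmul _ _ 10 fun l hl =>
          hle l (Finset.mem_of_mem_erase (Finset.mem_of_mem_erase hl))
      rw [Finset.card_erase_of_mem hbNa, Finset.card_erase_of_mem haN, hN6, smul_eq_mul] at s3
      have da := dA a
      have db := dA b
      have na := hNd a haN
      have nb := hNd b hbN
      have ha5 : K.degIn A a = 5 ∧ K.degIn S a = 4 := by omega
      obtain ⟨c, hc⟩ : ∃ c, c ∈ (N.erase a).erase b := Finset.card_pos.1 (by
        rw [Finset.card_erase_of_mem hbNa, Finset.card_erase_of_mem haN, hN6]; norm_num)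
      have hcN : c ∈ N := Finset.mem_of_mem_erase (Finset.mem_of_mem_erase hc)
      have s4 := Finset.sum_erase_add _ (fun l => K.degIn S l + K.degIn A l) hc
      have s5 : ∑ l ∈ ((N.erase a).erase b).erase c, (K.degIn S l + K.degIn A l) ≤ _ :=
        Finset.sum_le_card_nsmul _ _ 10 fun l hl =>
          hle l (Finset.mem_of_mem_erase (Finset.mem_of_mem_erase (Finset.mem_of_mem_erase hl)))
      rw [Finset.card_erase_of_mem hc, Finset.card_erase_of_mem hbNa,
        Finset.card_erase_of_mem haN, hN6, smul_eq_mul] at s5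
      have nc := hNd c hcN
      have hc5 : K.degIn S c = 5 := by omega
      -- The two vertices of `S` missed by `a` are missed by all of `N`.
      have hsub : {s ∈ S | ¬ K.Adj a s} ⊆ {s ∈ S | ¬ K.Adj c s} := by
        intro s hs
        rw [Finset.mem_filter] at hs ⊢
        refine ⟨hs.1, fun hcs => ?_⟩
        have h1 := hmiss a ha s hs.1 hs.2
        have h2 : 0 < K.degIn N s := degIn_pos_iff.2 ⟨c, hcN, hcs.symm⟩
        omega
      have h1 := Finset.card_le_card hsub
      have h2 := Finset.card_filter_add_card_filter_not (s := S) (fun s => K.Adj a s)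
      have h3 := Finset.card_filter_add_card_filter_not (s := S) (fun s => K.Adj c s)
      have h4 := ha5.2
      unfold degIn at h4 hc5
      omega
    have hGL : ∀ l ∈ L, G.degIn L l = 0 := fun l hl =>
      Nat.le_zero.1 ((degIn_mono_graph hGK L l).trans (hKL l hl).le)
    rw [hAe]
    refine exists_isJoinOn_of_independent hG h6 (by omega) hSL hD (fun l hl => ?_) fun x hx =>
      degIn_eq_zero_iff.1 (hGL x hx)
    have h1 := hpos l (hLA hl)
    rw [hAe, degIn_union hSL, hGL l hl] at h1
    exact h1

end

/-! ### Fourteen vertices in general, and dense sets of twelve vertices. -/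

section

variable {V : Type*}
variable {G K : SimpleGraph V} {A B H S L : Finset V} {u v w : V}

lemma exists_low_degrees [Finite V] (hG : ¬ G.HasTwoPaths) (hA : #A = 14) :
    ∃ k ≤ 6, k + 1 ≤ #{x ∈ A | G.degIn A x ≤ k} ∧
      14 ≤ #{x ∈ A | G.degIn A x + k + 2 ≤ 14} + k ∧
      G.degSum A + (k + 1) * (14 - k) + (k + 1) * (14 - 2 - 2 * k) ≤ 14 * (14 - 1) := by
  have hno : ¬ G.HasPathIn A #A := fun h => hG (HasTwoPaths.of_hasPathIn (hA ▸ h))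
  obtain ⟨K, hGK, hK, u, hu, v, hv, huv, hadj, hle, h1, h2⟩ := exists_chvatal hno
  have h3 := hK u hu v hv huv hadj
  rw [hA] at h2 h3
  obtain ⟨h4, h5⟩ := low_degrees_of_le hGK h1 h2
  exact ⟨K.degIn A u, by omega, h4, h5, degSum_le_of_low_degrees hA (by omega) h4 h5⟩

/-- Chvátal's cases k = 5 and k = 6 lead to the join. Isolated vertices are treated separately as k
= 0, because the analysis of degree six needs positive degrees. -/
lemma low_degrees_or_exists_isJoinOn [Finite V] (hG : ¬ G.HasTwoPaths) (hA : #A = 14)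
    (hD : 112 ≤ G.degSum A) (hlow : ∃ x ∈ A, G.degIn A x ≤ 5) :
    (∃ k ≤ 4, k + 1 ≤ #{x ∈ A | G.degIn A x ≤ k} ∧
      G.degSum A + (k + 1) * (14 - k) + (k + 1) * (14 - 2 - 2 * k) ≤ 14 * (14 - 1)) ∨
    ∃ S a b, G.IsJoinOn A S a b := by
  by_cases hpos : ∀ x ∈ A, 1 ≤ G.degIn A x
  swap
  · push Not at hpos
    obtain ⟨x, hx, hx0⟩ := hpos
    have hx0' : G.degIn A x = 0 := by omega
    refine Or.inl ⟨0, by norm_num, Finset.card_pos.2 ⟨x, Finset.mem_filter.2 ⟨hx, hx0'.le⟩⟩, ?_⟩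
    have h1 := degSum_le G (A.erase x)
    rw [Finset.card_erase_of_mem hx, hA] at h1
    rw [degSum_erase hx]
    omega
  have hno : ¬ G.HasPathIn A #A := fun h => hG (HasTwoPaths.of_hasPathIn (hA ▸ h))
  obtain ⟨K, hGK, hK, u, hu, v, hv, huv, hadj, hle, h1, h2⟩ := exists_chvatal hno
  have h3 := hK u hu v hv huv hadj
  rw [hA] at h2 h3 hK
  obtain ⟨h4, h5⟩ := low_degrees_of_le hGK h1 h2
  have hk : K.degIn A u ≤ 4 ∨ K.degIn A u = 5 ∨ K.degIn A u = 6 := by omega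
  rcases hk with hk | hk | hk
  · exact Or.inl ⟨_, hk, h4, degSum_le_of_low_degrees hA (by omega) h4 h5⟩
  · rw [hk] at h4 h5
    refine Or.inr (exists_isJoinOn_of_six_low_degrees hG hA hD h4 ?_)
    have h6 : #{x ∈ A | G.degIn A x + 5 + 2 ≤ 14} ≤ #{x ∈ A | G.degIn A x ≤ 7} :=
      Finset.card_le_card fun x => by
        simp only [Finset.mem_filter]
        rintro ⟨h, h'⟩
        exact ⟨h, by omega⟩
    omega
  · refine Or.inr (exists_isJoinOn_of_degree_six hG hA hD hpos hlow hGK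
      (fun x hx y hy hxy h => by have := hK x hx y hy hxy h; omega) hu hv huv hk (by omega) ?_)
    rw [hk] at h2
    have h6 : #{x ∈ A | K.degIn A x + 6 + 2 ≤ 14} ≤ #{x ∈ A | K.degIn A x ≤ 6} :=
      Finset.card_le_card fun x => by
        simp only [Finset.mem_filter]
        rintro ⟨h, h'⟩
        exact ⟨h, by omega⟩
    omega

lemma degSum_add_le {c d : ℕ} (hc : c ≤ #{x ∈ A | G.degIn A x ≤ d}) :
    G.degSum A + c * (#A - 1 - d) ≤ #A * (#A - 1) := by
  have key : ∀ x ∈ A, G.degIn A x + (if G.degIn A x ≤ d then #A - 1 - d else 0) ≤ #A - 1 := by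
    intro x hx
    have := degIn_lt_card (G := G) hx
    split_ifs <;> omega
  have h1 := Finset.sum_le_card_nsmul A _ _ key
  rw [Finset.sum_add_distrib, ← Finset.sum_filter, Finset.sum_const, smul_eq_mul, smul_eq_mul] at h1
  have h2 := Nat.mul_le_mul_right (#A - 1 - d) hc
  change G.degSum A + _ ≤ _ at h1
  omega

/-- Two vertices outside a dense set on twelve vertices cannot both be attached to it. -/
lemma degIn_eq_zero_of_dense [Finite V] (hG : ¬ G.HasTwoPaths) {Y : Finset V} (hY : #Y = 12)
    (hD : 120 ≤ G.degSum Y) {w w' : V} (hw : w ∉ Y) (hw' : w' ∉ Y) (hne : w ≠ w')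
    (h2 : 2 ≤ G.degIn (insert w (insert w' Y)) w) : G.degIn (insert w (insert w' Y)) w' = 0 := by
  by_contra h1
  obtain ⟨T, hTdef⟩ : ∃ T, T = insert w (insert w' Y) := ⟨_, rfl⟩
  have hwY : w ∉ insert w' Y := by simp [hw, hne]
  have hYT : Y ⊆ T := hTdef ▸ (Finset.subset_insert _ _).trans (Finset.subset_insert _ _)
  have hT : #T = 14 := by
    rw [hTdef, Finset.card_insert_of_notMem hwY, Finset.card_insert_of_notMem hw', hY]
  have hDT : 124 ≤ G.degSum T := by
    rw [hTdef, degSum_insert hwY, degSum_insert hw']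
    rw [degIn_insert_self] at h2
    omega
  rw [← hTdef] at h1 h2
  have hYlow : ∀ y ∈ Y, 2 ≤ G.degIn T y := by
    intro y hy
    have h3 := degIn_mono (G := G) hYT y
    have h4 := degSum_le G (Y.erase y)
    rw [Finset.card_erase_of_mem hy, hY] at h4
    have h5 := degSum_erase (G := G) hy
    omega
  have hlow1 : ∀ x ∈ T, G.degIn T x ≤ 1 → x = w' ∧ 1 ≤ G.degIn T x := by
    intro x hx hx1
    rw [hTdef, Finset.mem_insert, Finset.mem_insert] at hx
    rcases hx with rfl | rfl | hx
    · omega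
    · exact ⟨rfl, Nat.pos_of_ne_zero h1⟩
    · have := hYlow x hx
      omega
  obtain ⟨k, hk6, hk1, -, hk3⟩ := exists_low_degrees hG hT
  -- For k = 2, 3, 4, 5 the degree sum would be at most 122, 114, 112, 116. The cases k = 0 and k =
  -- 1 need more poor vertices than `w'` alone, and k = 6 would put five vertices of degree at most
  -- six into `Y`, leaving it at most 107.
  have hk : k = 0 ∨ k = 1 ∨ k = 6 := by
    interval_cases k <;> omega
  rcases hk with rfl | rfl | rfl
  · obtain ⟨x, hx⟩ := Finset.card_pos.1 (Nat.lt_of_succ_le hk1)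
    rw [Finset.mem_filter] at hx
    have := hlow1 x hx.1 (by omega)
    omega
  · obtain ⟨x, hx, y, hy, hxy⟩ := Finset.one_lt_card.1 hk1
    rw [Finset.mem_filter] at hx hy
    exact hxy ((hlow1 x hx.1 hx.2).1.trans (hlow1 y hy.1 hy.2).1.symm)
  · have h3 : ({x ∈ T | G.degIn T x ≤ 6} : Finset V) ⊆
        insert w (insert w' {x ∈ Y | G.degIn Y x ≤ 6}) := by
      intro x hx
      rw [Finset.mem_filter] at hx
      have hx1 := hx.1
      rw [hTdef, Finset.mem_insert, Finset.mem_insert] at hx1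
      simp only [Finset.mem_insert, Finset.mem_filter]
      have := degIn_mono (G := G) hYT x
      rcases hx1 with h | h | h
      · exact Or.inl h
      · exact Or.inr (Or.inl h)
      · exact Or.inr (Or.inr ⟨h, this.trans hx.2⟩)
    have h4 := (Finset.card_le_card h3).trans ((Finset.card_insert_le _ _).trans
      (Nat.add_le_add_right (Finset.card_insert_le _ _) 1))
    have h5 := degSum_add_le (G := G) (A := Y) (c := 5) (d := 6) (by omega)
    rw [hY] at h5
    omega

/-- Twice the number `pathBracket n 14 7`, for `n ≥ 13`. -/
def twiceBracket (n : ℕ) : ℕ := 156 + sevenPathBound (n - 13)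

lemma hasPathIn_seven_of_degSum (h : 5 * #A < G.degSum A) : G.HasPathIn A 7 := by
  by_contra hcon
  have := degSum_le_five_mul_card hcon
  omega

lemma degSum_le_of_disjoint_seven_path [Finite V] (hG : ¬ G.HasTwoPaths) (hA : G.HasPathIn A 7)
    (hAB : Disjoint A B) :
    G.degSum B ≤ 5 * #B ∧ (#B ≤ 10 → G.degSum B ≤ sevenPathBound #B) := by
  have h7 : ¬ G.HasPathIn B 7 := fun h => hG (HasTwoPaths.of_disjoint hA h hAB)
  exact ⟨degSum_le_five_mul_card h7, degSum_le_sevenPathBound h7⟩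

/-- If an outside vertex has two neighbours in `Y`, adding it makes the set closed. Otherwise
outside vertices with one neighbour in `Y` have no further edges, and those with none span a graph
without a seven-vertex path, because `Y` contains one. -/
lemma degSum_lt_or_exists_closed_of_dense [Finite V] (hG : ¬ G.HasTwoPaths) (hA : 14 ≤ #A)
    {Y : Finset V} (hYA : Y ⊆ A) (hY : #Y = 12) (hD : 120 ≤ G.degSum Y) :
    G.degSum A < max (twiceBracket #A) (10 * #A - 28) ∨
      ∃ Z ⊆ A, #Z = 13 ∧ 120 ≤ G.degSum Z ∧ ∀ x ∈ A \ Z, G.degIn Z x = 0 := by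
  by_cases h2 : ∃ w ∈ A \ Y, 2 ≤ G.degIn Y w
  · right
    obtain ⟨w, hw, hw2⟩ := h2
    rw [Finset.mem_sdiff] at hw
    refine ⟨insert w Y, ?_, ?_, ?_, ?_⟩
    · exact Finset.insert_subset hw.1 hYA
    · rw [Finset.card_insert_of_notMem hw.2, hY]
    · exact hD.trans (degSum_mono (Finset.subset_insert _ _))
    · intro x hx
      rw [Finset.mem_sdiff, Finset.mem_insert, not_or] at hx
      have h1 := degIn_eq_zero_of_dense hG hY hD hw.2 hx.2.2 (Ne.symm hx.2.1)
        (hw2.trans (degIn_mono ((Finset.subset_insert _ _).trans (Finset.subset_insert _ _)) w))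
      refine Nat.le_zero.1 ((degIn_mono ?_ x).trans h1.le)
      exact Finset.insert_subset_insert _ (Finset.subset_insert _ _)
  · left
    push Not at h2
    obtain ⟨R₁, hR₁⟩ : ∃ R, R = {x ∈ A \ Y | G.degIn Y x = 0} := ⟨_, rfl⟩
    obtain ⟨R₂, hR₂⟩ : ∃ R, R = {x ∈ A \ Y | ¬ G.degIn Y x = 0} := ⟨_, rfl⟩
    have hR : A \ Y = R₁ ∪ R₂ := by rw [hR₁, hR₂, Finset.filter_union_filter_not_eq]
    have hdisj : Disjoint R₁ R₂ := by rw [hR₁, hR₂]; exact Finset.disjoint_filter_filter_not _ _ _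
    have hcard : #R₁ + #R₂ = #A - 12 := by
      rw [← Finset.card_union_of_disjoint hdisj, ← hR, Finset.card_sdiff_of_subset hYA, hY]
    have hm₁ : ∀ x ∈ R₁, x ∈ A ∧ x ∉ Y ∧ G.degIn Y x = 0 := fun x hx => by
      rw [hR₁, Finset.mem_filter, Finset.mem_sdiff] at hx
      tauto
    have hm₂ : ∀ x ∈ R₂, x ∈ A ∧ x ∉ Y ∧ G.degIn Y x = 1 := fun x hx => by
      rw [hR₂, Finset.mem_filter] at hx
      have := h2 x hx.1
      rw [Finset.mem_sdiff] at hx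
      exact ⟨hx.1.1, hx.1.2, by omega⟩
    have hiso : ∀ x ∈ R₂, ∀ y ∈ A, y ∉ Y → ¬ G.Adj x y := by
      intro x hx y hy hyY hxy
      obtain ⟨-, hxY, hx1⟩ := hm₂ x hx
      have hyx : y ∉ insert x Y := by simp [hyY, hxy.ne']
      have h3 : 2 ≤ G.degIn (insert x (insert y Y)) x := by
        rw [degIn_insert_self, degIn_insert hyY, hx1, if_pos hxy]
      have h4 := degIn_eq_zero_of_dense hG hY hD hxY hyY hxy.ne h3
      exact degIn_eq_zero_iff.1 h4 x (Finset.mem_insert_self _ _) hxy.symm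
    have e1 : G.degSum A = G.degSum Y + G.degSum (A \ Y) + 2 * ∑ x ∈ A \ Y, G.degIn Y x :=
      degSum_sdiff hYA
    have e2 : G.degSum (R₁ ∪ R₂) = G.degSum R₁ + G.degSum R₂ + 2 * ∑ x ∈ R₂, G.degIn R₁ x :=
      degSum_union hdisj
    have e3 : G.degSum R₂ = 0 := Finset.sum_eq_zero fun x hx => degIn_eq_zero_iff.2 fun y hy =>
      hiso x hx y (hm₂ y hy).1 (hm₂ y hy).2.1
    have e4 : ∑ x ∈ R₂, G.degIn R₁ x = 0 := Finset.sum_eq_zero fun x hx =>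
      degIn_eq_zero_iff.2 fun y hy => hiso x hx y (hm₁ y hy).1 (hm₁ y hy).2.1
    have e5 : ∑ x ∈ R₁ ∪ R₂, G.degIn Y x = #R₂ := by
      rw [Finset.sum_union hdisj, Finset.sum_eq_zero fun x hx => (hm₁ x hx).2.2,
        Finset.sum_congr rfl fun x hx => (hm₂ x hx).2.2]
      simp
    have hYle := degSum_le G Y
    rw [hY] at hYle
    have hYR : Disjoint Y R₁ := Finset.disjoint_right.2 fun x hx => (hm₁ x hx).2.1
    obtain ⟨b1, b2⟩ := degSum_le_of_disjoint_seven_path hG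
      (hasPathIn_seven_of_degSum (by omega : 5 * #Y < G.degSum Y)) hYR
    rw [hR, e2, e3, e4, e5] at e1
    rw [lt_max_iff]
    -- From 23 vertices on, the bound of five per vertex on `R₁` suffices. Below that, `R₁` has at
    -- most ten vertices and the exact bound is needed.
    by_cases hn : 23 ≤ #A
    · right; omega
    · left
      have hA' : #R₂ = #A - 12 - #R₁ := by omega
      have hb := b2 (by omega)
      have hR₁le : #R₁ ≤ #A - 12 := by omega
      unfold twiceBracket
      rw [hA'] at e1
      generalize #A = n at *
      have : G.degSum R₁ + 2 * (n - 12 - #R₁) < 24 + sevenPathBound (n - 13) := by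
        refine lt_of_le_of_lt (Nat.add_le_add_right hb _) ?_
        generalize #R₁ = r at *
        have h22 : n ≤ 22 := by omega
        clear * - hA hR₁le h22
        have : ∀ n ≤ 22, 14 ≤ n → ∀ r ≤ n - 12, sevenPathBound r + 2 * (n - 12 - r) <
          24 + sevenPathBound (n - 13) := by unfold sevenPathBound; decide
        exact this n h22 hA r hR₁le
      omega

end

/-! ### Extending the join, and chains of minimum degree deletions. -/

section

variable {V : Type*}
variable {G K : SimpleGraph V} {A B H S L : Finset V} {u v w : V}

section IsJoinOn

variable {a b : V}

lemma IsJoinOn.adj_of_mem (h : G.IsJoinOn A S a b) {s x : V} (hs : s ∈ S) (hx : x ∈ A)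
    (hsx : s ≠ x) : G.Adj s x :=
  (h.adj_iff s (h.subset hs) x hx).2 (Or.inl ⟨hsx, Or.inl hs⟩)

lemma IsJoinOn.adj (h : G.IsJoinOn A S a b) : G.Adj a b :=
  (h.adj_iff a h.left_mem b h.right_mem).2 (Or.inr (Or.inl ⟨rfl, rfl⟩))

lemma IsJoinOn.symm (h : G.IsJoinOn A S a b) : G.IsJoinOn A S b a :=
  ⟨h.subset, h.card, h.right_mem, h.left_mem, h.right_notMem, h.left_notMem, fun x hx y hy =>
    (h.adj_iff x hx y hy).trans (by tauto)⟩

lemma IsJoinOn.five_le_degIn (h : G.IsJoinOn A S a b) (hA : 6 ≤ #A) {x : V} (hx : x ∈ A) :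
    5 ≤ G.degIn A x := by
  by_cases hxS : x ∈ S
  · have h1 : G.degIn (A.erase x) x = #(A.erase x) := degIn_eq_card_iff.2 fun y hy =>
      h.adj_of_mem hxS (Finset.mem_of_mem_erase hy) (Finset.ne_of_mem_erase hy).symm
    rw [degIn_erase_self, Finset.card_erase_of_mem hx] at h1
    omega
  · have h1 : G.degIn S x = #S := degIn_eq_card_iff.2 fun y hy =>
      (h.adj_of_mem hy hx (fun h => hxS (h ▸ hy))).symm
    have := degIn_mono (G := G) h.subset x
    have := h.card
    omega

lemma IsJoinOn.degSum_eq (h : G.IsJoinOn A S a b) : G.degSum A + 28 = 10 * #A := by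
  have h5 := h.card
  have hab := h.adj
  have e1 : G.degSum A = G.degSum S + G.degSum (A \ S) + 2 * ∑ x ∈ A \ S, G.degIn S x :=
    degSum_sdiff h.subset
  have e2 : G.degSum S = #S * (#S - 1) := degSum_eq_iff.2 fun x hx y hy hxy =>
    h.adj_of_mem hx (h.subset hy) hxy
  have e3 : ∑ x ∈ A \ S, G.degIn S x = (#A - 5) * 5 := by
    rw [Finset.sum_congr rfl fun x hx => degIn_eq_card_iff.2 fun s hs => ?_, Finset.sum_const,
      Finset.card_sdiff_of_subset h.subset, h5, smul_eq_mul]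
    rw [Finset.mem_sdiff] at hx
    exact (h.adj_of_mem hs hx.1 fun e => hx.2 (e ▸ hs)).symm
  have e4 : G.degSum (A \ S) = ∑ x ∈ ({a, b} : Finset V), 1 := by
    rw [degSum]
    symm
    have haL : a ∈ A \ S := Finset.mem_sdiff.2 ⟨h.left_mem, h.left_notMem⟩
    have hbL : b ∈ A \ S := Finset.mem_sdiff.2 ⟨h.right_mem, h.right_notMem⟩
    have hL : ∀ x ∈ A \ S, ∀ y ∈ A \ S, G.Adj x y ↔ x = a ∧ y = b ∨ x = b ∧ y = a := by
      intro x hx y hy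
      rw [Finset.mem_sdiff] at hx hy
      rw [h.adj_iff x hx.1 y hy.1]
      tauto
    have hone : ∀ x y, x ∈ A \ S → y ∈ A \ S → (x = a ∧ y = b ∨ x = b ∧ y = a) →
        G.degIn (A \ S) x = 1 := by
      intro x y hx hy hxy
      rw [degIn, Finset.card_eq_one]
      refine ⟨y, Finset.ext fun z => ?_⟩
      rw [Finset.mem_filter, Finset.mem_singleton]
      constructor
      · rintro ⟨hz, hxz⟩
        rcases hxy with ⟨rfl, rfl⟩ | ⟨rfl, rfl⟩
        · rcases (hL _ hx z hz).1 hxz with h | h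
          · exact h.2
          · exact absurd h.1 hab.ne
        · rcases (hL _ hx z hz).1 hxz with h | h
          · exact absurd h.1 hab.ne'
          · exact h.2
      · rintro rfl
        exact ⟨hy, (hL x hx z hy).2 hxy⟩
    rw [Finset.sum_congr rfl (g := G.degIn (A \ S))]
    · refine Finset.sum_subset ?_ fun x hx hx' => ?_
      · intro x hx
        rcases Finset.mem_insert.1 hx with rfl | hx
        · exact haL
        · rwa [Finset.mem_singleton.1 hx]
      · rw [degIn_eq_zero_iff]
        intro y hy hxy
        simp only [Finset.mem_insert, Finset.mem_singleton, not_or] at hx'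
        rcases (hL x hx y hy).1 hxy with h | h
        · exact hx'.1 h.1
        · exact hx'.2 h.1
    · intro x hx
      rcases Finset.mem_insert.1 hx with rfl | hx
      · exact (hone x b haL hbL (Or.inl ⟨rfl, rfl⟩)).symm
      · rw [Finset.mem_singleton] at hx
        subst hx
        exact (hone x a hbL haL (Or.inr ⟨rfl, rfl⟩)).symm
  rw [Finset.sum_pair hab.ne] at e4
  have h6 : 5 ≤ #A := h5 ▸ Finset.card_le_card h.subset
  rw [h5] at e2
  omega

lemma IsJoinOn.exists_lists (h : G.IsJoinOn A S a b) (hA : 14 ≤ #A) (w : V) :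
    ∃ s : Fin 5 → V, ∃ i : Fin 6 → V, Function.Injective s ∧ Function.Injective i ∧
      (∀ j, s j ∈ S) ∧ ∀ j, i j ∈ A ∧ i j ∉ S ∧ i j ≠ a ∧ i j ≠ b ∧ i j ≠ w := by
  obtain ⟨I, hI, hI6⟩ := Finset.exists_subset_card_eq
    (show 6 ≤ #((((A \ S).erase a).erase b).erase w) by
      have h1 := Finset.pred_card_le_card_erase (s := A \ S) (a := a)
      have h2 := Finset.pred_card_le_card_erase (s := (A \ S).erase a) (a := b)
      have h3 := Finset.pred_card_le_card_erase (s := ((A \ S).erase a).erase b) (a := w)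
      rw [Finset.card_sdiff_of_subset h.subset, h.card] at h1
      omega)
  let e : S ≃ Fin 5 := S.equivFinOfCardEq h.card
  let f : I ≃ Fin 6 := I.equivFinOfCardEq hI6
  refine ⟨fun j => e.symm j, fun j => f.symm j, fun i j h => e.symm.injective (Subtype.ext h),
    fun i j h => f.symm.injective (Subtype.ext h), fun j => (e.symm j).2, fun j => ?_⟩
  have := hI (f.symm j).2
  simp only [Finset.mem_erase, Finset.mem_sdiff] at this
  tauto

/-- The path `x a b` uses three vertices before its first centre, so two centres complete it and
three remain for the other path. -/
lemma IsJoinOn.hasTwoPaths_of_adj_left (h : G.IsJoinOn A S a b) (hA : 14 ≤ #A) {x : V}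
    (hx : x ∉ A) (hxa : G.Adj x a) : G.HasTwoPaths := by
  obtain ⟨s, i, hs, hi, hsS, hiA⟩ := h.exists_lists hA a
  have hsA : ∀ j, s j ∈ A := fun j => h.subset (hsS j)
  have hxs : ∀ j, x ≠ s j := fun j e => hx (e ▸ hsA j)
  have hxi : ∀ j, x ≠ i j := fun j e => hx (e ▸ (hiA j).1)
  have has : ∀ j, a ≠ s j := fun j e => h.left_notMem (e ▸ hsS j)
  have hbs : ∀ j, b ≠ s j := fun j e => h.right_notMem (e ▸ hsS j)
  have hai : ∀ j, a ≠ i j := fun j => (hiA j).2.2.1.symm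
  have hbi : ∀ j, b ≠ i j := fun j => (hiA j).2.2.2.1.symm
  have hsi : ∀ j k, s j ≠ i k := fun j k e => (hiA k).2.1 (e ▸ hsS j)
  have asi : ∀ j k, G.Adj (s j) (i k) := fun j k => h.adj_of_mem (hsS j) (hiA k).1 (hsi j k)
  have abs : ∀ j, G.Adj b (s j) := fun j => (h.adj_of_mem (hsS j) h.right_mem (hbs j).symm).symm
  have hxb : x ≠ b := fun e => hx (e ▸ h.right_mem)
  refine ⟨[x, a, b, s 0, i 0, s 1, i 1], [i 2, s 2, i 3, s 3, i 4, s 4, i 5], rfl, rfl, ?_, ?_, ?_⟩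
  · simp [hxa, h.adj, abs, asi, (asi _ _).symm]
  · simp [asi, (asi _ _).symm]
  · simp [hs.eq_iff, hi.eq_iff, hxs, hxi, has, hbs, hai, hbi, hsi, (hsi _ _).symm, hxa.ne, hxb,
      h.adj.ne]

lemma IsJoinOn.hasTwoPaths_of_adj (h : G.IsJoinOn A S a b) (hA : 14 ≤ #A) {x w : V}
    (hx : x ∉ A) (hw : w ∈ A) (hwS : w ∉ S) (hxw : G.Adj x w) : G.HasTwoPaths := by
  by_cases hwa : w = a
  · exact h.hasTwoPaths_of_adj_left hA hx (hwa ▸ hxw)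
  by_cases hwb : w = b
  · exact h.symm.hasTwoPaths_of_adj_left hA hx (hwb ▸ hxw)
  obtain ⟨s, i, hs, hi, hsS, hiA⟩ := h.exists_lists hA w
  have hsA : ∀ j, s j ∈ A := fun j => h.subset (hsS j)
  have hxs : ∀ j, s j ≠ x := fun j e => hx (e ▸ hsA j)
  have hxi : ∀ j, i j ≠ x := fun j e => hx (e ▸ (hiA j).1)
  have has : ∀ j, a ≠ s j := fun j e => h.left_notMem (e ▸ hsS j)
  have hbs : ∀ j, b ≠ s j := fun j e => h.right_notMem (e ▸ hsS j)
  have hws : ∀ j, w ≠ s j := fun j e => hwS (e ▸ hsS j)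
  have hia : ∀ j, i j ≠ a := fun j => (hiA j).2.2.1
  have hib : ∀ j, i j ≠ b := fun j => (hiA j).2.2.2.1
  have hiw : ∀ j, i j ≠ w := fun j => (hiA j).2.2.2.2
  have hsi : ∀ j k, s j ≠ i k := fun j k e => (hiA k).2.1 (e ▸ hsS j)
  have asi : ∀ j k, G.Adj (s j) (i k) := fun j k => h.adj_of_mem (hsS j) (hiA k).1 (hsi j k)
  have asa : ∀ j, G.Adj (s j) a := fun j => h.adj_of_mem (hsS j) h.left_mem (has j).symm
  have abs : ∀ j, G.Adj b (s j) := fun j => (h.adj_of_mem (hsS j) h.right_mem (hbs j).symm).symm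
  have asw : ∀ j, G.Adj (s j) w := fun j => h.adj_of_mem (hsS j) hw (hws j).symm
  have hxa : a ≠ x := fun e => hx (e ▸ h.left_mem)
  have hxb : b ≠ x := fun e => hx (e ▸ h.right_mem)
  refine ⟨[i 0, s 0, a, b, s 1, w, x], [i 1, s 2, i 2, s 3, i 3, s 4, i 4], rfl, rfl, ?_, ?_, ?_⟩
  · simp [hxw.symm, h.adj, abs, asa, asw, (asi _ _).symm]
  · simp [asi, (asi _ _).symm]
  · simp [hs.eq_iff, hi.eq_iff, hxs, hxi, has, hbs, hws, hia, hib, hiw, hsi, (hsi _ _).symm,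
      (hxs _).symm, (hxi _).symm, (has _).symm, (hbs _).symm, (hws _).symm, (hia _).symm,
      (hib _).symm, (hiw _).symm, hxa, hxb, h.adj.ne, Ne.symm hwa, Ne.symm hwb, hxw.ne']

/-- All neighbours of a new vertex lie in `S`, since any other one creates two disjoint paths.
Degree five then means exactly `S`. -/
lemma IsJoinOn.insert (h : G.IsJoinOn A S a b) (hG : ¬ G.HasTwoPaths) (hA : 14 ≤ #A) {x : V}
    (hx : x ∉ A) (hx5 : G.degIn A x = 5) : G.IsJoinOn (insert x A) S a b := by
  have hN : ∀ y ∈ A, G.Adj x y → y ∈ S := fun y hy hxy => by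
    by_contra hyS
    exact hG (h.hasTwoPaths_of_adj hA hx hy hyS hxy)
  have hS : A.filter (fun y => G.Adj x y) = S := by
    refine Finset.eq_of_subset_of_card_le (fun y hy => ?_) ?_
    · rw [Finset.mem_filter] at hy
      exact hN y hy.1 hy.2
    · rw [h.card, ← hx5]; rfl
  have hxS : ∀ y ∈ S, G.Adj x y := fun y hy => by
    rw [← hS, Finset.mem_filter] at hy
    exact hy.2
  have hxnS : x ∉ S := fun e => hx (h.subset e)
  have hxa : x ≠ a := fun e => hx (e ▸ h.left_mem)
  have hxb : x ≠ b := fun e => hx (e ▸ h.right_mem)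
  refine ⟨h.subset.trans (Finset.subset_insert _ _), h.card, Finset.mem_insert_of_mem h.left_mem,
    Finset.mem_insert_of_mem h.right_mem, h.left_notMem, h.right_notMem, fun y hy z hz => ?_⟩
  have key : ∀ z ∈ A, G.Adj x z ↔ z ∈ S := fun z hz => ⟨hN z hz, hxS z⟩
  rcases Finset.mem_insert.1 hy with e | hy' <;> rcases Finset.mem_insert.1 hz with e' | hz'
  · subst e e'
    simp [hxa, hxb]
  · subst e
    rw [key z hz']
    have : y ≠ z := fun e => hx (e ▸ hz')
    tauto
  · subst e'
    rw [G.adj_comm, key y hy']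
    have : y ≠ z := fun e => hx (e ▸ hy')
    tauto
  · exact h.adj_iff y hy' z hz'

end IsJoinOn

/-- `B` arises from `A` by deleting a vertex of minimum degree, and this degree is at most five. -/
def MinDeletion (G : SimpleGraph V) (B A : Finset V) : Prop :=
  ∃ x ∈ A, B = A.erase x ∧ G.degIn A x ≤ 5 ∧ ∀ y ∈ A, G.degIn A x ≤ G.degIn A y

/-- Minimum degree six on m ≥ 14 vertices gives 7(m - 1) ≤ 10m - 30, and each reinsertion raises the
degree sum by at most ten, so the deficit survives. -/
lemma exists_minDeletion_chain (hG : ¬ G.HasTwoPaths) (m : ℕ) (A : Finset V) (hA : #A = 14 + m) :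
    G.degSum A + 30 ≤ 10 * #A ∨ ∃ B, #B = 14 ∧ (∃ x ∈ B, G.degIn B x ≤ 5) ∧
      Relation.ReflTransGen G.MinDeletion B A := by
  by_cases h6 : ∀ x ∈ A, 6 ≤ G.degIn A x
  · left
    have := degSum_le_of_six_le_degIn hG (by omega) h6
    omega
  push Not at h6
  obtain ⟨x₀, hx₀, hx₀6⟩ := h6
  induction m generalizing A x₀ with
  | zero => exact Or.inr ⟨A, hA, ⟨x₀, hx₀, by omega⟩, Relation.ReflTransGen.refl⟩
  | succ m ih =>
    obtain ⟨x, hx, hmin⟩ := A.exists_min_image (G.degIn A) ⟨x₀, hx₀⟩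
    have hx5 : G.degIn A x ≤ 5 := by
      have := hmin x₀ hx₀
      omega
    have hcard : #(A.erase x) = 14 + m := by rw [Finset.card_erase_of_mem hx]; omega
    have hstep : G.degSum (A.erase x) + 30 ≤ 10 * #(A.erase x) ∨ ∃ B, #B = 14 ∧
        (∃ x ∈ B, G.degIn B x ≤ 5) ∧ Relation.ReflTransGen G.MinDeletion B (A.erase x) := by
      by_cases h6 : ∀ y ∈ A.erase x, 6 ≤ G.degIn (A.erase x) y
      · left
        have := degSum_le_of_six_le_degIn hG (by omega) h6
        omega
      push Not at h6
      obtain ⟨y, hy, hy6⟩ := h6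
      exact ih _ hcard y hy hy6
    rcases hstep with h | ⟨B, hB, hB5, hBA⟩
    · left
      rw [degSum_erase hx]
      omega
    · exact Or.inr ⟨B, hB, hB5, hBA.tail ⟨x, hx, rfl, hx5, hmin⟩⟩

lemma MinDeletion.card_eq (h : G.MinDeletion B A) : #A = #B + 1 := by
  obtain ⟨x, hx, rfl, -, -⟩ := h
  exact (Finset.card_erase_add_one hx).symm

lemma MinDeletion.subset (h : G.MinDeletion B A) : B ⊆ A := by
  obtain ⟨x, hx, rfl, -, -⟩ := h
  exact Finset.erase_subset _ _

/-- The maximum growth of the number of edges in `m` steps, when a minimum degree at most `d` grows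
by at most one in each step and a step adds at most five edges. -/
def climb (d m : ℕ) : ℕ := ∑ j ∈ range m, min 5 (d + j + 1)

/-- Inserting a vertex raises any given degree by at most one, and the inserted vertex has minimum
degree. Hence after `j` steps the next one adds at most `d + j + 1` edges, and never more than five.
-/
lemma degSum_le_climb {d : ℕ} (h : Relation.ReflTransGen G.MinDeletion B A)
    (hd : ∃ x ∈ B, G.degIn B x ≤ d) : B ⊆ A ∧ ∃ m, #A = #B + m ∧
      G.degSum A ≤ G.degSum B + 2 * climb d m ∧ ∃ x ∈ A, G.degIn A x ≤ d + m := by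
  induction h with
  | refl => exact ⟨Finset.Subset.refl _, 0, rfl, le_self_add, hd⟩
  | @tail C A _ hCA ih =>
    obtain ⟨hBC, m, hm, hle, y, hy, hyd⟩ := ih
    refine ⟨hBC.trans hCA.subset, m + 1, by rw [hCA.card_eq, hm]; rfl, ?_⟩
    obtain ⟨x, hx, rfl, hx5, hmin⟩ := hCA
    have h1 := degIn_le_erase_add_one (G := G) hx y
    have h2 := hmin y (Finset.mem_of_mem_erase hy)
    rw [degSum_erase hx, climb, Finset.sum_range_succ, ← climb]
    refine ⟨?_, x, hx, by omega⟩
    have : G.degIn A x ≤ min 5 (d + m + 1) := le_min hx5 (by omega)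
    omega

/-- An insertion with five edges preserves the join. One with fewer drops below `10 * n - 28`, and
later steps of at most five edges cannot recover. -/
lemma IsJoinOn.of_chain {a b : V} (hG : ¬ G.HasTwoPaths)
    (h : Relation.ReflTransGen G.MinDeletion B A) (hB : 14 ≤ #B) (hF : G.IsJoinOn B S a b) :
    14 ≤ #A ∧ (G.degSum A + 28 < 10 * #A ∨ G.IsJoinOn A S a b) := by
  induction h with
  | refl => exact ⟨hB, Or.inr hF⟩
  | @tail C A _ hCA ih =>
    have hc := hCA.card_eq
    refine ⟨by omega, ?_⟩
    obtain ⟨hC, ih⟩ := ih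
    obtain ⟨x, hx, rfl, hx5, hmin⟩ := hCA
    rcases ih with h | h
    · left
      rw [degSum_erase hx]
      omega
    · have hs := h.degSum_eq
      by_cases h5 : G.degIn A x = 5
      · right
        have := h.insert hG hC (Finset.notMem_erase x A) (by rw [degIn_erase_self, h5])
        rwa [Finset.insert_erase hx] at this
      · left
        rw [degSum_erase hx]
        omega

end

/-! ### The structure theorem. -/

section

variable {V : Type*}
variable {G K : SimpleGraph V} {A B H S L : Finset V} {u v w : V}

/-- A graph on fourteen vertices of minimum degree `d` from which minimum degree insertions can lead
to an extremal graph has at least this degree sum. -/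
def denseThreshold : ℕ → ℕ
  | 0 => 132
  | 1 => 124
  | 2 => 118
  | 3 => 114
  | _ => 112

lemma climb_succ (d m : ℕ) : climb d (m + 1) = climb d m + min 5 (d + m + 1) :=
  Finset.sum_range_succ _ _

/-- The thresholds are chosen so that for every `d` the climb reaches `10 * n - 28` exactly after
four steps. From then on each step adds five edges. -/
lemma climb_add_denseThreshold_of_four_le {d m : ℕ} (hd : d ≤ 5) (hm : 4 ≤ m) :
    2 * climb d m + denseThreshold d = 112 + 10 * m := by
  induction m, hm using Nat.le_induction with
  | base => interval_cases d <;> rfl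
  | succ m hm ih =>
    rw [climb_succ, min_eq_left (by omega)]
    omega

lemma climb_add_denseThreshold_le {d m : ℕ} (hd : d ≤ 5) :
    2 * climb d m + denseThreshold d ≤ max (twiceBracket (14 + m)) (10 * (14 + m) - 28) := by
  by_cases hm : 4 ≤ m
  · have := climb_add_denseThreshold_of_four_le hd hm
    exact le_max_of_le_right (by omega)
  · have : ∀ m < 4, ∀ d ≤ 5, 2 * climb d m + denseThreshold d ≤
        max (twiceBracket (14 + m)) (10 * (14 + m) - 28) := by decide
    exact this m (by omega) d hd

/-- The values 122, 114, 112 are Chvátal's bounds for k = 2, 3, 4. If the first step adds only `d`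
edges, then `D + 2 * d` is still less than ten above `denseThreshold d`, while the target has moved
by ten. -/
lemma climb_stationary_lt {d D m : ℕ} (hd : d = 2 ∧ D ≤ 122 ∨ d = 3 ∧ D ≤ 114 ∨ d = 4 ∧ D ≤ 112) :
    D + 2 * d + 2 * climb d m < max (twiceBracket (15 + m)) (10 * (15 + m) - 28) := by
  by_cases hm : 4 ≤ m
  · have := climb_add_denseThreshold_of_four_le (d := d) (by omega) hm
    refine lt_max_of_lt_right ?_
    rcases hd with ⟨rfl, hD⟩ | ⟨rfl, hD⟩ | ⟨rfl, hD⟩ <;> simp only [denseThreshold] at this <;> omega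
  · have h1 : ∀ m < 4, 122 + 2 * 2 + 2 * climb 2 m < twiceBracket (15 + m) ∧
        114 + 2 * 3 + 2 * climb 3 m < twiceBracket (15 + m) ∧
        112 + 2 * 4 + 2 * climb 4 m < twiceBracket (15 + m) := by decide
    obtain ⟨h2, h3, h4⟩ := h1 m (by omega)
    refine lt_max_of_lt_left ?_
    rcases hd with ⟨rfl, hD⟩ | ⟨rfl, hD⟩ | ⟨rfl, hD⟩ <;> omega

/-- If the neighbours of each vertex of degree `i` with a neighbour of degree `i` all have
degree `i`, these vertices form an `i`-regular closed set. -/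
lemma exists_regular_closed {i : ℕ}
    (hN : ∀ z ∈ A, G.degIn A z = i → (∃ y ∈ A, G.Adj z y ∧ G.degIn A y = i) →
      ∀ y ∈ A, G.Adj z y → G.degIn A y = i)
    (hex : ∃ z ∈ A, G.degIn A z = i ∧ ∃ y ∈ A, G.Adj z y ∧ G.degIn A y = i) :
    ∃ P ⊆ A, i + 1 ≤ #P ∧ (∀ x ∈ P, G.degIn A x = i) ∧ ∀ x ∈ A \ P, G.degIn P x = 0 := by
  obtain ⟨P, hP⟩ : ∃ P, P = {z ∈ A | G.degIn A z = i ∧ ∃ y ∈ A, G.Adj z y ∧ G.degIn A y = i} :=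
    ⟨_, rfl⟩
  have hPm : ∀ z, z ∈ P ↔ z ∈ A ∧ G.degIn A z = i ∧ ∃ y ∈ A, G.Adj z y ∧ G.degIn A y = i :=
    fun z => by rw [hP, Finset.mem_filter]
  have hcl : ∀ z ∈ P, ∀ y ∈ A, G.Adj z y → y ∈ P := by
    intro z hz y hy hzy
    obtain ⟨h1, h2, h3⟩ := (hPm z).1 hz
    exact (hPm y).2 ⟨hy, hN z h1 h2 h3 y hy hzy, z, h1, hzy.symm, h2⟩
  refine ⟨P, fun z hz => ((hPm z).1 hz).1, ?_, fun x hx => ((hPm x).1 hx).2.1, fun x hx => ?_⟩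
  · obtain ⟨z, hz⟩ := hex
    have hzP := (hPm z).2 hz
    have h1 : insert z (A.filter fun y => G.Adj z y) ⊆ P := by
      intro y hy
      rw [Finset.mem_insert, Finset.mem_filter] at hy
      rcases hy with rfl | hy
      · exact hzP
      · exact hcl z hzP y hy.1 hy.2
    have h2 := Finset.card_le_card h1
    rw [Finset.card_insert_of_notMem (by simp)] at h2
    have h3 := hz.2.1
    unfold degIn at h3
    omega
  · rw [Finset.mem_sdiff] at hx
    exact degIn_eq_zero_iff.2 fun y hy hxy => hx.2 (hcl y hy x hx.1 hxy.symm)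

lemma degSum_regular_closed_le {i N : ℕ} {P : Finset V} (hA : #A = N) (hPA : P ⊆ A)
    (hreg : ∀ x ∈ P, G.degIn A x = i) (hcl : ∀ x ∈ A \ P, G.degIn P x = 0) :
    G.degSum A ≤ #P * i + (N - #P) * (N - #P - 1) := by
  have h1 : G.degSum P ≤ #P * i := Finset.sum_le_card_nsmul _ _ _ fun x hx =>
    (degIn_mono hPA x).trans (hreg x hx).le
  have h2 := degSum_le G (A \ P)
  rw [Finset.card_sdiff_of_subset hPA, hA] at h2
  rw [degSum_of_closed hPA hcl]
  omega

/-- Deleting any other `z` of minimum degree `d + 1` with a neighbour of that degree gives a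
fourteen-vertex graph of the same degree sum and minimum degree `d`. Chvátal's condition then holds
with k = d, so `d + 1` vertices dropped to degree `d`, and they are all the neighbours of `z`. So
these vertices form a regular closed set, which leaves room for too few edges. -/
lemma no_minDegree_jump [Finite V] (hG : ¬ G.HasTwoPaths) {X : Finset V} (hX : #X = 15) {d : ℕ}
    (hd : d = 2 ∨ d = 3 ∨ d = 4) {x : V} (hx : x ∈ X) (hxd : G.degIn X x = d + 1)
    (hmin : ∀ y ∈ X, d + 1 ≤ G.degIn X y) (hD : denseThreshold d ≤ G.degSum (X.erase x))
    (hlow : ∃ y ∈ X.erase x, G.degIn (X.erase x) y = d) : False := by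
  have hDX := degSum_erase (G := G) hx
  have hN : ∀ z ∈ X, G.degIn X z = d + 1 → (∃ y ∈ X, G.Adj z y ∧ G.degIn X y = d + 1) →
      ∀ y ∈ X, G.Adj z y → G.degIn X y = d + 1 := by
    intro z hz hzd ⟨y, hy, hzy, hyd⟩
    have hcard : #(X.erase z) = 14 := by rw [Finset.card_erase_of_mem hz, hX]
    have hyz : y ∈ X.erase z := Finset.mem_erase.2 ⟨hzy.ne', hy⟩
    have hyd' : G.degIn (X.erase z) y = d := by
      have := degIn_erase (G := G) hz y
      rw [if_pos hzy.symm, hyd] at this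
      omega
    have hDz := degSum_erase (G := G) hz
    have hD' : G.degSum (X.erase z) = G.degSum (X.erase x) := by omega
    have hD112 : 112 ≤ denseThreshold d := by
      rcases hd with rfl | rfl | rfl <;> simp [denseThreshold]
    rcases low_degrees_or_exists_isJoinOn hG hcard (by omega) ⟨y, hyz, by omega⟩ with
      ⟨k, hk, hk1, hk2⟩ | ⟨S, a, b, hF⟩
    · have hdeg : ∀ w ∈ X.erase z, G.degIn X w = G.degIn (X.erase z) w +
          if G.Adj w z then 1 else 0 := fun w _ => degIn_erase hz w
      have hdk : d ≤ k := by
        obtain ⟨w, hw⟩ := Finset.card_pos.1 (Nat.lt_of_lt_of_le (Nat.succ_pos k) hk1)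
        rw [Finset.mem_filter] at hw
        have h1 := hdeg w hw.1
        have h2 := hmin w (Finset.mem_of_mem_erase hw.1)
        split_ifs at h1 <;> omega
      have hkd : k = d := by
        rcases hd with rfl | rfl | rfl <;> simp only [denseThreshold] at hD <;>
        interval_cases k <;> omega
      subst hkd
      have hsub : ({w ∈ X.erase z | G.degIn (X.erase z) w ≤ k} : Finset V) ⊆
          X.filter fun w => G.Adj z w := by
        intro w hw
        rw [Finset.mem_filter] at hw ⊢
        have h1 := hdeg w hw.1
        have h2 := hmin w (Finset.mem_of_mem_erase hw.1)
        refine ⟨Finset.mem_of_mem_erase hw.1, ?_⟩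
        by_contra h
        rw [if_neg fun h' => h h'.symm] at h1
        omega
      have heq := Finset.eq_of_subset_of_card_le hsub (by unfold degIn at hzd hk1 ⊢; omega)
      intro w hw hzw
      have hw' : w ∈ X.filter fun w => G.Adj z w := Finset.mem_filter.2 ⟨hw, hzw⟩
      rw [← heq, Finset.mem_filter] at hw'
      have h1 := hdeg w hw'.1
      have h2 := hmin w hw
      rw [if_pos hzw.symm] at h1
      omega
    · have := hF.five_le_degIn (by omega) hyz
      omega
  have hex : ∃ z ∈ X, G.degIn X z = d + 1 ∧ ∃ y ∈ X, G.Adj z y ∧ G.degIn X y = d + 1 := by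
    obtain ⟨y, hy, hyd⟩ := hlow
    have h1 := degIn_erase (G := G) hx y
    have h2 := hmin y (Finset.mem_of_mem_erase hy)
    have hyx : G.Adj y x := by
      by_contra h
      rw [if_neg h] at h1
      omega
    rw [if_pos hyx] at h1
    exact ⟨x, hx, hxd, y, Finset.mem_of_mem_erase hy, hyx.symm, by omega⟩
  obtain ⟨P, hPX, hP, hreg, hcl⟩ := exists_regular_closed hN hex
  have h1 := degSum_regular_closed_le hX hPX hreg hcl
  have h2 := Finset.card_le_card hPX
  rw [hX] at h2
  rcases hd with rfl | rfl | rfl <;> simp only [denseThreshold] at hD <;>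
  · generalize #P = p at *
    interval_cases p <;> omega

/-- If some `w` is attached to `B`, the density leaves only k ≤ 1 on the fourteen vertices, so a
vertex of `B` itself has degree at most one. Removing it leaves twelve dense vertices. -/
lemma degSum_lt_or_exists_closed_of_isolated [Finite V] (hG : ¬ G.HasTwoPaths) (hA : 14 ≤ #A)
    (hBA : B ⊆ A) (hB : #B = 13) (hD : 132 ≤ G.degSum B) :
    G.degSum A < max (twiceBracket #A) (10 * #A - 28) ∨
      ∃ Z ⊆ A, #Z = 13 ∧ 120 ≤ G.degSum Z ∧ ∀ x ∈ A \ Z, G.degIn Z x = 0 := by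
  by_cases hcl : ∀ x ∈ A \ B, G.degIn B x = 0
  · exact Or.inr ⟨B, hBA, hB, by omega, hcl⟩
  push Not at hcl
  obtain ⟨w, hw, hw0⟩ := hcl
  rw [Finset.mem_sdiff] at hw
  have hT : #(insert w B) = 14 := by rw [Finset.card_insert_of_notMem hw.2, hB]
  have hDT := degSum_insert (G := G) hw.2
  obtain ⟨k, hk6, hk1, -, hk3⟩ := exists_low_degrees hG hT
  have hk : k ≤ 1 := by
    interval_cases k <;> omega
  obtain ⟨y, hyB, hy1⟩ : ∃ y ∈ B, G.degIn (insert w B) y ≤ 1 := by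
    have hww := degIn_insert_self G B w
    rcases (by omega : k = 0 ∨ k = 1) with rfl | rfl
    · obtain ⟨y, hy⟩ := Finset.card_pos.1 (Nat.lt_of_succ_le hk1)
      rw [Finset.mem_filter, Finset.mem_insert] at hy
      obtain ⟨rfl | hy, hy0⟩ := hy
      · omega
      · exact ⟨y, hy, by omega⟩
    · obtain ⟨y, hy, hyw⟩ := Finset.exists_mem_ne (Nat.lt_of_succ_le hk1) w
      rw [Finset.mem_filter, Finset.mem_insert] at hy
      exact ⟨y, hy.1.resolve_left hyw, hy.2⟩
  have h1 := degIn_mono (G := G) (Finset.subset_insert w B) y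
  have h2 := degSum_erase (G := G) hyB
  exact degSum_lt_or_exists_closed_of_dense hG hA ((Finset.erase_subset y B).trans hBA)
    (by rw [Finset.card_erase_of_mem hyB, hB]) (by omega)

/-- The structure of graphs without two disjoint paths on seven vertices. -/
theorem degSum_lt_or_exists_closed_or_isJoinOn [Finite V] (hG : ¬ G.HasTwoPaths) (hA : 14 ≤ #A) :
    G.degSum A < max (twiceBracket #A) (10 * #A - 28) ∨
      (∃ Z ⊆ A, #Z = 13 ∧ 120 ≤ G.degSum Z ∧ ∀ x ∈ A \ Z, G.degIn Z x = 0) ∨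
      ∃ S a b, G.IsJoinOn A S a b := by
  by_cases hsmall : G.degSum A < max (twiceBracket #A) (10 * #A - 28)
  · exact Or.inl hsmall
  right
  rcases exists_minDeletion_chain hG (#A - 14) A (by omega) with h | ⟨B, hB, hB5, hBA⟩
  · exact absurd (lt_max_of_lt_right (by omega)) hsmall
  obtain ⟨x₀, hx₀, hmin⟩ := B.exists_min_image (G.degIn B) (Finset.card_pos.1 (by omega))
  obtain ⟨d, hd⟩ : ∃ d, d = G.degIn B x₀ := ⟨_, rfl⟩
  rw [← hd] at hmin
  have hd5 : d ≤ 5 := by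
    obtain ⟨x, hx, hx5⟩ := hB5
    have := hmin x hx
    omega
  obtain ⟨hBsub, m, hm, hle, -⟩ := degSum_le_climb hBA ⟨x₀, hx₀, hd.ge⟩
  -- A smaller start could not climb to the bound within the remaining steps.
  have hD : denseThreshold d ≤ G.degSum B := by
    by_contra hcon
    apply hsmall
    have := climb_add_denseThreshold_le (d := d) (m := m) hd5
    rw [hm, hB]
    exact lt_of_lt_of_le (by omega) this
  have h112 : 112 ≤ denseThreshold d := by
    interval_cases d <;> simp [denseThreshold]
  rcases low_degrees_or_exists_isJoinOn hG hB (by omega) hB5 with ⟨k, hk, hk1, hk2⟩ | ⟨S, a, b, hF⟩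
  swap
  · rcases (hF.of_chain hG hBA hB.ge).2 with h | h
    · exact absurd (lt_max_of_lt_right (by omega)) hsmall
    · exact Or.inr ⟨S, a, b, h⟩
  left
  have hdk : d ≤ k := by
    obtain ⟨x, hx⟩ := Finset.card_pos.1 (Nat.lt_of_lt_of_le (Nat.succ_pos k) hk1)
    rw [Finset.mem_filter] at hx
    exact (hmin x hx.1).trans hx.2
  have hcases : k = 0 ∨ k = 1 ∨ 2 ≤ k := by omega
  rcases hcases with rfl | rfl | hk'
  · obtain rfl : d = 0 := by omega
    simp only [denseThreshold] at hD
    have h1 := degSum_erase (G := G) hx₀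
    refine (degSum_lt_or_exists_closed_of_isolated hG hA ((Finset.erase_subset x₀ B).trans hBsub)
      (by rw [Finset.card_erase_of_mem hx₀, hB]) (by omega)).resolve_left hsmall
  · have hD' : 124 ≤ G.degSum B := by
      interval_cases d <;> simp only [denseThreshold] at hD <;> omega
    obtain ⟨x, hx, y, hy, hxy⟩ := Finset.one_lt_card.1 (Nat.lt_of_succ_le hk1)
    rw [Finset.mem_filter] at hx hy
    have hy' : y ∈ B.erase x := Finset.mem_erase.2 ⟨Ne.symm hxy, hy.1⟩
    have h1 := degSum_erase (G := G) hx.1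
    have h2 := degSum_erase (G := G) hy'
    have h3 := degIn_mono (G := G) (Finset.erase_subset x B) y
    refine (degSum_lt_or_exists_closed_of_dense hG hA (Y := (B.erase x).erase y)
      (((Finset.erase_subset _ _).trans (Finset.erase_subset x B)).trans hBsub) ?_
      (by omega)).resolve_left hsmall
    rw [Finset.card_erase_of_mem hy', Finset.card_erase_of_mem hx.1, hB]
  · exfalso
    -- For k > d Chvátal's bound lies below `denseThreshold d`.
    have hkd : k = d := by
      interval_cases k <;> interval_cases d <;> simp only [denseThreshold] at hD <;> omega
    subst hkd
    have hk3 : k = 2 ∧ G.degSum B ≤ 122 ∨ k = 3 ∧ G.degSum B ≤ 114 ∨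
        k = 4 ∧ G.degSum B ≤ 112 := by
      interval_cases k <;> omega
    -- The first reinsertion decides: the minimum degree either stays at most k or rises to k + 1.
    rcases hBA.cases_head with rfl | ⟨X, hBX, hXA⟩
    · apply hsmall
      rw [hB]
      refine lt_max_of_lt_left ?_
      have : twiceBracket 14 = 156 := rfl
      omega
    · have hX := hBX.card_eq
      obtain ⟨x, hx, rfl, hx5, hxmin⟩ := hBX
      by_cases hxk : G.degIn X x ≤ k
      · apply hsmall
        obtain ⟨-, m', hm', hle', -⟩ := degSum_le_climb hXA ⟨x, hx, hxk⟩
        have h1 := climb_stationary_lt (m := m') hk3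
        rw [hm', hX, hB]
        refine lt_of_le_of_lt ?_ h1
        rw [degSum_erase hx] at hle'
        omega
      · have h1 := degIn_le_erase_add_one (G := G) hx x₀
        have h2 := hxmin x₀ (Finset.mem_of_mem_erase hx₀)
        have hxk' : G.degIn X x = k + 1 := by omega
        exact no_minDegree_jump hG (by omega : #X = 15) (by omega) hx hxk'
          (fun y hy => hxk' ▸ hxmin y hy) hD ⟨x₀, hx₀, hd.symm⟩

end

/-! ### Translation to subgraph containment, and the extremal constructions. -/

section

variable {V W : Type*}
variable {G : SimpleGraph V} {A S : Finset V}

lemma adj_get_of_isChain {k : ℕ} {l : List V} (hl : l.length = k) (hc : l.IsChain G.Adj)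
    {i j : Fin k} (h : (pathGraph k).Adj i j) :
    G.Adj (l.get (i.cast hl.symm)) (l.get (j.cast hl.symm)) := by
  subst hl
  rw [List.isChain_iff_getElem] at hc
  rw [pathGraph_adj] at h
  obtain ⟨i, hi⟩ := i
  obtain ⟨j, hj⟩ := j
  rcases h with h | h
  · obtain rfl : i + 1 = j := h
    exact hc i hj
  · obtain rfl : j + 1 = i := h
    exact (hc j hi).symm

lemma isChain_ofFn_of_hom {k : ℕ} {f : Fin k → V}
    (hf : ∀ {i j}, (pathGraph k).Adj i j → G.Adj (f i) (f j)) : (List.ofFn f).IsChain G.Adj :=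
  List.isChain_ofFn.2 fun _ _ => hf (pathGraph_adj.2 (Or.inl rfl))

lemma pathGraph_free_iff [Fintype V] {k : ℕ} : (pathGraph k).Free G ↔ ¬ G.HasPathIn univ k := by
  refine not_congr ⟨fun ⟨f⟩ => ⟨List.ofFn f, ⟨isChain_ofFn_of_hom fun h => f.toHom.map_adj h,
    List.nodup_ofFn.2 f.injective, fun _ _ => Finset.mem_univ _⟩, List.length_ofFn⟩, ?_⟩
  rintro ⟨l, hl, hk⟩
  exact ⟨⟨⟨fun i => l.get (i.cast hk.symm), fun h => adj_get_of_isChain hk hl.chain h⟩,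
    fun i j h => Fin.cast_injective _ (hl.nodup.injective_get h)⟩⟩

lemma twoPaths_free_iff : (twoPaths 7).Free G ↔ ¬ G.HasTwoPaths := by
  refine not_congr ⟨fun ⟨f⟩ => ?_, ?_⟩
  · refine ⟨List.ofFn fun i => f (Sum.inl i), List.ofFn fun i => f (Sum.inr i), List.length_ofFn,
      List.length_ofFn, isChain_ofFn_of_hom fun h => f.toHom.map_adj (sum_adj_inl.2 h),
      isChain_ofFn_of_hom fun h => f.toHom.map_adj (sum_adj_inr.2 h), ?_⟩
    refine List.Nodup.append (List.nodup_ofFn.2 fun i j h => Sum.inl_injective (f.injective h))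
      (List.nodup_ofFn.2 fun i j h => Sum.inr_injective (f.injective h)) fun x hx hx' => ?_
    obtain ⟨i, hi⟩ := List.mem_ofFn.1 hx
    obtain ⟨j, hj⟩ := List.mem_ofFn.1 hx'
    exact Sum.inl_ne_inr (f.injective (hi.trans hj.symm))
  · rintro ⟨l, m, hl, hm, hlc, hmc, hnd⟩
    rw [List.nodup_append'] at hnd
    obtain ⟨hln, hmn, hd⟩ := hnd
    refine ⟨⟨⟨Sum.elim (fun i => l.get (i.cast hl.symm)) fun i => m.get (i.cast hm.symm), ?_⟩, ?_⟩⟩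
    · rintro (i | i) (j | j) h
      · exact adj_get_of_isChain hl hlc (sum_adj_inl.1 h)
      · simp at h
      · simp at h
      · exact adj_get_of_isChain hm hmc (sum_adj_inr.1 h)
    · rintro (i | i) (j | j) h
      · exact congrArg _ (Fin.cast_injective _ (hln.injective_get h))
      · have h' : l.get (i.cast hl.symm) = m.get (j.cast hm.symm) := h
        exact absurd (h' ▸ List.get_mem m _) (hd (List.get_mem l _))
      · have h' : m.get (i.cast hm.symm) = l.get (j.cast hl.symm) := h
        exact absurd (h' ▸ List.get_mem m _) (hd (List.get_mem l _))
      · exact congrArg _ (Fin.cast_injective _ (hmn.injective_get h))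

lemma ncard_edgeSet_le_extremalNumber [Fintype V] {F : SimpleGraph W} (h : F.Free G) :
    G.edgeSet.ncard ≤ extremalNumber (Fintype.card V) F := by
  rw [Set.ncard_eq_toFinset_card']
  exact card_edgeFinset_le_extremalNumber h

lemma extremalNumber_le_of_forall {n m : ℕ} {F : SimpleGraph W}
    (h : ∀ G : SimpleGraph (Fin n), F.Free G → G.edgeSet.ncard ≤ m) : extremalNumber n F ≤ m := by
  have := (extremalNumber_le_iff (V := Fin n) F m).2 fun G _ hG => by
    have := h G hG
    rwa [Set.ncard_eq_toFinset_card'] at this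
  rwa [Fintype.card_fin] at this

lemma ncard_edgeSet_congr {G : SimpleGraph V} {H : SimpleGraph W} (e : G ≃g H) :
    G.edgeSet.ncard = H.edgeSet.ncard :=
  Nat.card_congr e.mapEdgeSet

lemma ncard_edgeSet_sum [Finite V] [Finite W] (G : SimpleGraph V) (H : SimpleGraph W) :
    (G ⊕g H).edgeSet.ncard = G.edgeSet.ncard + H.edgeSet.ncard := by
  refine (Nat.card_congr edgeSetSumEquiv).trans ?_
  rw [Nat.card_sum]
  rfl

lemma two_mul_ncard_edgeSet_top [Fintype V] :
    2 * (⊤ : SimpleGraph V).edgeSet.ncard = Fintype.card V * (Fintype.card V - 1) := by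
  rw [← degSum_univ, ← Finset.card_univ, degSum_eq_iff]
  exact fun u _ v _ huv => huv

lemma exists_map_eq_of_isChain_sum {G : SimpleGraph V} {H : SimpleGraph W} (l : List (V ⊕ W))
    (hl : l.IsChain (G ⊕g H).Adj) :
    (∃ l' : List V, l = l'.map Sum.inl ∧ l'.IsChain G.Adj) ∨
      ∃ l' : List W, l = l'.map Sum.inr ∧ l'.IsChain H.Adj := by
  have key : (∃ l' : List V, l = l'.map Sum.inl) ∨ ∃ l' : List W, l = l'.map Sum.inr := by
    induction l with
    | nil => exact Or.inl ⟨[], rfl⟩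
    | cons x t ih =>
      rcases ih hl.of_cons with ⟨l', rfl⟩ | ⟨l', rfl⟩ <;> rcases x with x | x
      · exact Or.inl ⟨x :: l', rfl⟩
      · cases l' with
        | nil => exact Or.inr ⟨[x], rfl⟩
        | cons y l' => simp at hl
      · cases l' with
        | nil => exact Or.inl ⟨[x], rfl⟩
        | cons y l' => simp at hl
      · exact Or.inr ⟨x :: l', rfl⟩
  rcases key with ⟨l', rfl⟩ | ⟨l', rfl⟩
  · exact Or.inl ⟨l', rfl, (List.isChain_map _).1 hl |>.imp fun _ _ h => sum_adj_inl.1 h⟩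
  · exact Or.inr ⟨l', rfl, (List.isChain_map _).1 hl |>.imp fun _ _ h => sum_adj_inr.1 h⟩

/-- A path stays in one summand. Both paths would have to lie in the left one, which has fewer than
fourteen vertices. -/
lemma not_hasTwoPaths_sum [Fintype V] [Fintype W] {G : SimpleGraph V} {H : SimpleGraph W}
    (hV : Fintype.card V ≤ 13) (hH : ¬ H.HasPathIn univ 7) : ¬ (G ⊕g H).HasTwoPaths := by
  rintro ⟨l, m, hl, hm, hlc, hmc, hnd⟩
  have hright : ∀ l : List (V ⊕ W), l.length = 7 → l.IsChain (G ⊕g H).Adj → l.Nodup →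
      ∃ l' : List V, l = l'.map Sum.inl := by
    intro l hl hlc hln
    rcases exists_map_eq_of_isChain_sum l hlc with ⟨l', h, -⟩ | ⟨l', rfl, h⟩
    · exact ⟨l', h⟩
    · exact absurd ⟨l', ⟨h, hln.of_map, fun _ _ => Finset.mem_univ _⟩, by simpa using hl⟩ hH
  obtain ⟨l', rfl⟩ := hright l hl hlc hnd.of_append_left
  obtain ⟨m', rfl⟩ := hright m hm hmc hnd.of_append_right
  rw [← List.map_append] at hnd
  have := hnd.of_map.length_le_card
  simp only [List.length_append, List.length_map] at this hl hm
  omega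

/-- The disjoint union of copies of `K₆` and one smaller complete graph, on `m` vertices. -/
def sixCliques (m : ℕ) : SimpleGraph (Fin m) where
  Adj i j := i ≠ j ∧ (i : ℕ) / 6 = (j : ℕ) / 6
  symm := ⟨fun _ _ h => ⟨h.1.symm, h.2.symm⟩⟩
  loopless := ⟨fun _ h => h.1 rfl⟩

lemma not_hasPathIn_sixCliques (m : ℕ) : ¬ (sixCliques m).HasPathIn univ 7 := by
  rintro ⟨l, hl, h7⟩
  obtain ⟨x, t, rfl⟩ : ∃ x t, l = x :: t := by
    cases l with
    | nil => simp at h7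
    | cons x t => exact ⟨x, t, rfl⟩
  have hc : ∀ y ∈ x :: t, (y : ℕ) / 6 = (x : ℕ) / 6 := by
    have h1 : (x :: t).IsChain fun a b : Fin m => (b : ℕ) / 6 = (a : ℕ) / 6 :=
      hl.chain.imp fun _ _ h => h.2.symm
    have : IsTrans (Fin m) fun a b : Fin m => (b : ℕ) / 6 = (a : ℕ) / 6 :=
      ⟨fun _ _ _ h h' => h'.trans h⟩
    rw [List.isChain_iff_pairwise, List.pairwise_cons] at h1
    intro y hy
    rcases List.mem_cons.1 hy with rfl | hy
    · rfl
    · exact h1.1 y hy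
  have h1 : #((x :: t).toFinset) ≤ #(Finset.range 6) := by
    refine Finset.card_le_card_of_injOn (fun y : Fin m => (y : ℕ) % 6)
      (fun y _ => Finset.mem_coe.2 (Finset.mem_range.2 (Nat.mod_lt _ (by norm_num))))
      fun y hy z hz hyz => ?_
    have h2 := hc y (List.mem_toFinset.1 hy)
    have h3 := hc z (List.mem_toFinset.1 hz)
    simp only at hyz
    apply Fin.ext
    omega
  rw [List.toFinset_card_of_nodup hl.nodup, h7, Finset.card_range] at h1
  omega

lemma two_mul_ncard_edgeSet_sixCliques {m : ℕ} (hm : m ≤ 9) :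
    2 * (sixCliques m).edgeSet.ncard = sevenPathBound m := by
  rw [← degSum_univ]
  have h1 : ∀ m ≤ 9, ∑ i : Fin m, ∑ j : Fin m, (if i ≠ j ∧ (i : ℕ) / 6 = (j : ℕ) / 6 then 1 else 0)
      = sevenPathBound m := by decide
  rw [← h1 m hm]
  refine Finset.sum_congr rfl fun i _ => ?_
  rw [degIn_eq_sum]
  refine Finset.sum_congr rfl fun j _ => ?_
  congr

lemma two_mul_extremalNumber_pathGraph {m : ℕ} (hm : m ≤ 9) :
    2 * extremalNumber m (pathGraph 7) = sevenPathBound m := by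
  refine le_antisymm ?_ ?_
  · have h1 : extremalNumber m (pathGraph 7) ≤ sevenPathBound m / 2 :=
      extremalNumber_le_of_forall fun H hH => by
        have h2 := degSum_le_sevenPathBound (A := univ) (pathGraph_free_iff.1 hH) (by simp; omega)
        rw [degSum_univ, Finset.card_univ, Fintype.card_fin] at h2
        omega
    omega
  · have h1 := ncard_edgeSet_le_extremalNumber
      (pathGraph_free_iff.2 (not_hasPathIn_sixCliques m))
    rw [Fintype.card_fin] at h1
    have := two_mul_ncard_edgeSet_sixCliques hm
    omega

lemma isJoinOn_graphJoin (k : ℕ) :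
    (graphJoin (⊤ : SimpleGraph (Fin 5)) ((⊤ : SimpleGraph (Fin 2)) ⊕g
      (⊥ : SimpleGraph (Fin k)))).IsJoinOn univ (univ.map Function.Embedding.inl)
      (Sum.inr (Sum.inl 0)) (Sum.inr (Sum.inl 1)) := by
  refine ⟨Finset.subset_univ _, by simp, Finset.mem_univ _, Finset.mem_univ _, by simp, by simp, ?_⟩
  rintro (x | x | x) - (y | y | y) - <;> simp [graphJoin]
  · revert x y
    decide

/-- Outside `S` the only edge is `ab`, so vertices outside `S` are separated by vertices of `S`,
with one exception when both `a` and `b` occur. -/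
lemma IsJoinOn.length_le {a b : V} [Fintype V] (h : G.IsJoinOn univ S a b) : ∀ l : List V,
    l.IsChain G.Adj → l.Nodup →
    l.length ≤ 2 * l.countP (· ∈ S) + 1 + if a ∈ l ∧ b ∈ l then 1 else 0
  | [], _, _ => by simp
  | [x], _, _ => by rw [List.length_singleton]; omega
  | x :: y :: t, hc, hn => by
    have h1 := IsJoinOn.length_le h (y :: t) hc.of_cons hn.of_cons
    have hmono : ∀ t' : List V, (∀ z ∈ t', z ∈ x :: y :: t) →
        (if a ∈ t' ∧ b ∈ t' then 1 else 0) ≤ if a ∈ x :: y :: t ∧ b ∈ x :: y :: t then 1 else 0 := by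
      intro t' ht'
      split_ifs with h1 h2
      · exact le_rfl
      · exact absurd ⟨ht' a h1.1, ht' b h1.2⟩ h2
      · exact Nat.zero_le _
      · exact le_rfl
    by_cases hx : x ∈ S
    · have h2 := hmono (y :: t) fun z hz => List.mem_cons_of_mem _ hz
      rw [List.countP_cons_of_pos (by simpa using hx), List.length_cons]
      omega
    by_cases hy : y ∈ S
    · have h3 := IsJoinOn.length_le h t hc.of_cons.of_cons hn.of_cons.of_cons
      have h2 := hmono t fun z hz => List.mem_cons_of_mem _ (List.mem_cons_of_mem _ hz)
      rw [List.countP_cons_of_neg (by simpa using hx), List.countP_cons_of_pos (by simpa using hy),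
        List.length_cons, List.length_cons]
      omega
    · have hxy : G.Adj x y := (List.isChain_cons_cons.1 hc).1
      have hab := ((h.adj_iff x (Finset.mem_univ _) y (Finset.mem_univ _)).1 hxy).resolve_left
        (by tauto)
      have hnx : x ∉ y :: t := (List.nodup_cons.1 hn).1
      have h2 : ¬ (a ∈ y :: t ∧ b ∈ y :: t) := by
        rcases hab with ⟨rfl, rfl⟩ | ⟨rfl, rfl⟩ <;> tauto
      have h3 : a ∈ x :: y :: t ∧ b ∈ x :: y :: t := by
        rcases hab with ⟨rfl, rfl⟩ | ⟨rfl, rfl⟩ <;> simp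
      rw [if_neg h2] at h1
      rw [if_pos h3, List.countP_cons_of_neg (by simpa using hx), List.length_cons]
      omega

/-- Only one of two disjoint paths can use the edge `ab`, so together they have at most 2 · 5 + 2 +
1 = 13 vertices. -/
lemma IsJoinOn.not_hasTwoPaths {a b : V} [Fintype V] (h : G.IsJoinOn univ S a b) :
    ¬ G.HasTwoPaths := by
  rintro ⟨l, m, hl, hm, hlc, hmc, hnd⟩
  have h1 := h.length_le l hlc hnd.of_append_left
  have h2 := h.length_le m hmc hnd.of_append_right
  have h3 : (l ++ m).countP (· ∈ S) ≤ 5 := by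
    rw [List.countP_eq_length_filter, ← List.toFinset_card_of_nodup (hnd.filter _), ← h.card]
    exact Finset.card_le_card fun x hx => by simpa using (List.mem_filter.1 (List.mem_toFinset.1 hx)).2
  rw [List.countP_append] at h3
  have h4 : ¬ (a ∈ l ∧ a ∈ m) := fun h => List.disjoint_of_nodup_append hnd h.1 h.2
  split_ifs at h1 h2 with h5 h6
  · exact h4 ⟨h5.1, h6.1⟩
  all_goals omega

/-- The class of a vertex in a graph as in `IsJoinOn`. -/
noncomputable def joinClass (S : Finset V) (a b x : V) : Fin 4 :=
  if x ∈ S then 0 else if x = a then 1 else if x = b then 2 else 3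

lemma IsJoinOn.joinClass_iff [Fintype V] {a b : V} (h : G.IsJoinOn univ S a b) (x : V) :
    (joinClass S a b x = 0 ↔ x ∈ S) ∧ (joinClass S a b x = 1 ↔ x = a) ∧
      (joinClass S a b x = 2 ↔ x = b) := by
  have ha := h.left_notMem
  have hb := h.right_notMem
  have hab := h.adj.ne
  unfold joinClass
  split_ifs with h1 h2 h3
  · refine ⟨by simp [h1], ?_, ?_⟩
    · simpa using fun e : x = a => ha (e ▸ h1)
    · simpa using fun e : x = b => hb (e ▸ h1)
  · subst h2
    simp [h1, hab]
  · subst h3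
    simp [h1, h2]
  · simp [h1, h2, h3]

lemma IsJoinOn.card_joinClass [Fintype V] {a b : V} (h : G.IsJoinOn univ S a b) (c : Fin 4) :
    Fintype.card {x // joinClass S a b x = c} = ![5, 1, 1, Fintype.card V - 7] c := by
  rw [Fintype.card_subtype]
  have hcl := h.joinClass_iff
  have h0 : ({x | joinClass S a b x = 0} : Finset V) = S := by
    ext x; simp [(hcl x).1]
  have h1 : ({x | joinClass S a b x = 1} : Finset V) = {a} := by
    ext x; simp [(hcl x).2.1]
  have h2 : ({x | joinClass S a b x = 2} : Finset V) = {b} := by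
    ext x; simp [(hcl x).2.2]
  have hsum := Finset.card_eq_sum_card_fiberwise (s := (univ : Finset V)) (t := univ)
    (f := joinClass S a b) fun _ _ => Finset.mem_coe.2 (Finset.mem_univ _)
  rw [Fin.sum_univ_four, h0, h1, h2, h.card, Finset.card_singleton, Finset.card_singleton,
    Finset.card_univ] at hsum
  fin_cases c
  · simpa [h.card] using congrArg Finset.card h0
  · simpa using congrArg Finset.card h1
  · simpa using congrArg Finset.card h2
  · change #{x | joinClass S a b x = 3} = Fintype.card V - 7
    omega

/-- Adjacency depends only on equality and on the classes of the two vertices, so any bijection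
preserving classes is an isomorphism. The class sizes are determined by the order. -/
lemma IsJoinOn.nonempty_iso [Fintype V] [Fintype W] {a b : V} {H : SimpleGraph W} {T : Finset W}
    {c d : W} (h : G.IsJoinOn univ S a b) (h' : H.IsJoinOn univ T c d)
    (hcard : Fintype.card V = Fintype.card W) : Nonempty (G ≃g H) := by
  let e : V ≃ W := Equiv.ofFiberEquiv (f := joinClass S a b) (g := joinClass T c d) fun i =>
    Fintype.equivOfCardEq (by rw [h.card_joinClass, h'.card_joinClass, hcard])
  have he : ∀ x, joinClass T c d (e x) = joinClass S a b x := Equiv.ofFiberEquiv_map _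
  refine ⟨⟨e, fun {x y} => ?_⟩⟩
  have hx := h.joinClass_iff x
  have hy := h.joinClass_iff y
  have hx' := h'.joinClass_iff (e x)
  have hy' := h'.joinClass_iff (e y)
  rw [he] at hx' hy'
  rw [h'.adj_iff _ (Finset.mem_univ _) _ (Finset.mem_univ _),
    h.adj_iff _ (Finset.mem_univ _) _ (Finset.mem_univ _), ← hx.1, ← hy.1, ← hx.2.1, ← hx.2.2,
    ← hy.2.1, ← hy.2.2, ← hx'.1, ← hy'.1, ← hx'.2.1, ← hx'.2.2, ← hy'.2.1, ← hy'.2.2, ne_eq, ne_eq,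
    e.injective.eq_iff]

end

/-! ### Comparison of the bounds, and the extremal graphs. -/

section

variable {V W : Type*}
variable {G : SimpleGraph V} {A S : Finset V}

lemma two_mul_pathBracket {n : ℕ} (hn : 14 ≤ n) : 2 * pathBracket n 14 7 = twiceBracket n := by
  have h1 : pathBracket n 14 7 = 78 + (n - 13) / 6 * 15 + ((n - 13) % 6).choose 2 := by
    rw [pathBracket, if_neg (by omega)]
    rfl
  have h2 : ∀ r < 6, 2 * r.choose 2 = r * (r - 1) := by decide
  have h3 := h2 _ (Nat.mod_lt (n - 13) (by norm_num))
  rw [h1, twiceBracket, sevenPathBound]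
  omega

lemma pathBracket_eq {n r : ℕ} (hn : 14 ≤ n) (hr : r < 6) (h : n - 13 ≡ r [MOD 6]) :
    (pathBracket n 14 7 : ℚ) = (5 * n + 91 + r * (r - 6)) / 2 := by
  have hmod : (n - 13) % 6 = r := by
    have := h
    rwa [Nat.ModEq, Nat.mod_eq_of_lt hr] at this
  have h1 := two_mul_pathBracket hn
  rw [twiceBracket, sevenPathBound, hmod] at h1
  obtain ⟨t, ht⟩ : ∃ t, t = (n - 13) / 6 := ⟨_, rfl⟩
  have hnt : n = 13 + 6 * t + r := by omega
  rw [← ht] at h1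
  have h2 : (2 : ℚ) * pathBracket n 14 7 = 156 + (t * 30 + r * (r - 1)) := by
    rcases Nat.eq_zero_or_pos r with rfl | hr0
    · simp only [zero_mul] at h1
      have : 2 * pathBracket n 14 7 = 156 + t * 30 := by omega
      rw [show (2 : ℚ) * pathBracket n 14 7 = ((2 * pathBracket n 14 7 : ℕ) : ℚ) by push_cast; ring,
        this]
      push_cast; ring
    · rw [show (2 : ℚ) * pathBracket n 14 7 = ((2 * pathBracket n 14 7 : ℕ) : ℚ) by push_cast; ring,
        h1]
      push_cast [Nat.cast_sub hr0]
      ring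
  have h3 : (n : ℚ) = 13 + 6 * t + r := by
    rw [hnt]; push_cast; ring
  rw [h3]
  linarith [h2, show (r : ℚ) * (r - 1) = r * (r - 6) + 5 * r by ring]

/-- Up to twenty-two vertices the bracket is the larger bound, and from then on the other one. -/
lemma twiceBracket_cmp {n : ℕ} (hn : 14 ≤ n) :
    (n ≤ 21 → 10 * n - 28 < twiceBracket n) ∧ (n = 22 → twiceBracket n = 10 * n - 28) ∧
      (23 ≤ n → twiceBracket n < 10 * n - 28) := by
  refine ⟨fun h => ?_, fun h => by subst h; rfl, fun h => ?_⟩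
  · have : ∀ n ≤ 21, 14 ≤ n → 10 * n - 28 < twiceBracket n := by decide
    exact this n h hn
  · have h2 : ∀ r < 6, r * (r - 1) ≤ 5 * r := by decide
    have h3 := h2 _ (Nat.mod_lt (n - 13) (by norm_num))
    -- The estimate of five per vertex gives 206 against 202 here, so this order is evaluated
    -- exactly.
    by_cases h23 : n = 23
    · subst h23; decide
    · rw [twiceBracket, sevenPathBound]
      omega

theorem degSum_univ_le_and_eq [Fintype V] {n : ℕ} (hV : Fintype.card V = n) (hn : 14 ≤ n)
    (hG : ¬ G.HasTwoPaths) :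
    G.degSum univ ≤ max (twiceBracket n) (10 * n - 28) ∧
      (G.degSum univ = max (twiceBracket n) (10 * n - 28) →
        (n ≤ 22 ∧ ∃ Z : Finset V, #Z = 13 ∧ G.degSum Z = 156 ∧
          ∀ x ∈ univ \ Z, G.degIn Z x = 0) ∨
        (22 ≤ n ∧ ∃ S a b, G.IsJoinOn univ S a b)) := by
  obtain ⟨c1, c2, c3⟩ := twiceBracket_cmp hn
  have hcard : #(univ : Finset V) = n := by rw [Finset.card_univ, hV]
  rcases degSum_lt_or_exists_closed_or_isJoinOn (A := univ) hG (by omega) with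
    h | ⟨Z, hZ, hZ13, hZD, hcl⟩ | ⟨S, a, b, h⟩
  · rw [hcard] at h
    exact ⟨h.le, fun h' => absurd h' h.ne⟩
  · have e1 := degSum_of_closed hZ hcl
    have b1 := degSum_le G Z
    rw [hZ13] at b1
    obtain ⟨b2, b3⟩ := degSum_le_of_disjoint_seven_path hG
      (hasPathIn_seven_of_degSum (A := Z) (by omega)) (Finset.disjoint_sdiff (t := univ))
    rw [Finset.card_sdiff_of_subset hZ, hcard, hZ13] at b2 b3
    rcases (by omega : n ≤ 22 ∨ n = 23 ∨ 24 ≤ n) with h | h | h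
    · have b4 := b3 (by omega)
      have hle : G.degSum univ ≤ twiceBracket n := by
        rw [twiceBracket]; omega
      refine ⟨hle.trans (le_max_left _ _), fun heq => Or.inl ⟨h, Z, hZ13, ?_⟩⟩
      have h1 := le_max_left (twiceBracket n) (10 * n - 28)
      rw [← heq, twiceBracket] at h1
      exact ⟨by omega, hcl⟩
    -- On 23 vertices the bound of five per vertex is too weak. The exact value 42 for ten vertices
    -- gives 198 < 202.
    · subst h
      have b4 := b3 (by norm_num)
      have e10 : sevenPathBound (23 - 13) = 42 := rfl
      have hlt : G.degSum univ < max (twiceBracket 23) (10 * 23 - 28) :=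
        lt_max_of_lt_right (by omega)
      exact ⟨hlt.le, fun h' => absurd h' hlt.ne⟩
    · have hlt : G.degSum univ < max (twiceBracket n) (10 * n - 28) :=
        lt_max_of_lt_right (by omega)
      exact ⟨hlt.le, fun h' => absurd h' hlt.ne⟩
  · have e1 := h.degSum_eq
    rw [hcard] at e1
    refine ⟨le_max_of_le_right (by omega), fun heq => Or.inr ⟨?_, S, a, b, h⟩⟩
    by_contra hcon
    have h1 := le_max_left (twiceBracket n) (10 * n - 28)
    have := c1 (by omega)
    omega

lemma two_mul_ncard_cliques_sum {m : ℕ} (H : SimpleGraph (Fin m)) :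
    2 * ((⊤ : SimpleGraph (Fin 13)) ⊕g H).edgeSet.ncard = 156 + 2 * H.edgeSet.ncard := by
  rw [ncard_edgeSet_sum, mul_add, two_mul_ncard_edgeSet_top, Fintype.card_fin]

lemma two_mul_ncard_graphJoin {n : ℕ} (hn : 14 ≤ n) :
    2 * (graphJoin (⊤ : SimpleGraph (Fin 5)) ((⊤ : SimpleGraph (Fin 2)) ⊕g
      (⊥ : SimpleGraph (Fin (n - 7))))).edgeSet.ncard = 10 * n - 28 := by
  have h1 := (isJoinOn_graphJoin (n - 7)).degSum_eq
  rw [degSum_univ, Finset.card_univ, Fintype.card_sum, Fintype.card_sum, Fintype.card_fin,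
    Fintype.card_fin, Fintype.card_fin] at h1
  omega

lemma two_mul_extremalNumber_twoPaths {n : ℕ} (hn : 14 ≤ n) :
    2 * extremalNumber n (twoPaths 7) = max (twiceBracket n) (10 * n - 28) := by
  obtain ⟨c1, c2, c3⟩ := twiceBracket_cmp hn
  refine le_antisymm ?_ (max_le ?_ ?_)
  · have h1 : extremalNumber n (twoPaths 7) ≤ max (twiceBracket n) (10 * n - 28) / 2 :=
      extremalNumber_le_of_forall fun G hG => by
        have h2 := (degSum_univ_le_and_eq (Fintype.card_fin n) hn (twoPaths_free_iff.1 hG)).1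
        rw [degSum_univ] at h2
        omega
    omega
  · have hjoin := ncard_edgeSet_le_extremalNumber
      (twoPaths_free_iff.2 (isJoinOn_graphJoin (n - 7)).not_hasTwoPaths)
    have hj := two_mul_ncard_graphJoin hn
    rw [Fintype.card_sum, Fintype.card_sum, Fintype.card_fin, Fintype.card_fin, Fintype.card_fin,
      (by omega : 5 + (2 + (n - 7)) = n)] at hjoin
    by_cases h : n ≤ 22
    · have h1 := ncard_edgeSet_le_extremalNumber (twoPaths_free_iff.2
        (not_hasTwoPaths_sum (G := (⊤ : SimpleGraph (Fin 13))) (by simp)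
          (not_hasPathIn_sixCliques (n - 13))))
      rw [Fintype.card_sum, Fintype.card_fin, Fintype.card_fin, (by omega : 13 + (n - 13) = n)] at h1
      have h2 := two_mul_ncard_cliques_sum (sixCliques (n - 13))
      rw [two_mul_ncard_edgeSet_sixCliques (by omega)] at h2
      rw [twiceBracket]
      omega
    · have := c3 (by omega)
      omega
  · have hjoin := ncard_edgeSet_le_extremalNumber
      (twoPaths_free_iff.2 (isJoinOn_graphJoin (n - 7)).not_hasTwoPaths)
    have hj := two_mul_ncard_graphJoin hn
    rw [Fintype.card_sum, Fintype.card_sum, Fintype.card_fin, Fintype.card_fin, Fintype.card_fin,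
      (by omega : 5 + (2 + (n - 7)) = n)] at hjoin
    omega

/-- A complete set of vertices without edges to its complement splits off as a summand. -/
lemma exists_iso_top_sum [Fintype V] {Z : Finset V} {p m : ℕ} (hZ : #Z = p)
    (hV : Fintype.card V = p + m) (hZc : ∀ x ∈ Z, ∀ y ∈ Z, x ≠ y → G.Adj x y)
    (hcl : ∀ x ∈ univ \ Z, G.degIn Z x = 0) :
    ∃ H : SimpleGraph (Fin m), Nonempty (G ≃g (⊤ : SimpleGraph (Fin p)) ⊕g H) := by
  let e₁ : {x // x ∈ Z} ≃ Fin p := Z.equivFinOfCardEq hZ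
  let e₂ : {x // ¬ x ∈ Z} ≃ Fin m := Fintype.equivFinOfCardEq (by
    rw [Fintype.card_subtype_compl, Fintype.card_coe, hZ, hV]; omega)
  let e : V ≃ Fin p ⊕ Fin m := (Equiv.sumCompl (· ∈ Z)).symm.trans (Equiv.sumCongr e₁ e₂)
  have hcl' : ∀ x ∉ Z, ∀ y ∈ Z, ¬ G.Adj x y := fun x hx =>
    degIn_eq_zero_iff.1 (hcl x (Finset.mem_sdiff.2 ⟨Finset.mem_univ _, hx⟩))
  have hinl : ∀ i, e.symm (Sum.inl i) ∈ Z := fun i => (e₁.symm i).2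
  have hinr : ∀ i, e.symm (Sum.inr i) ∉ Z := fun i => (e₂.symm i).2
  refine ⟨G.comap fun i => e.symm (Sum.inr i), ⟨Iso.symm ⟨e.symm, ?_⟩⟩⟩
  rintro (i | i) (j | j)
  · rw [sum_adj_inl, top_adj]
    refine ⟨fun h hij => h.ne (by rw [hij]), fun h => hZc _ (hinl i) _ (hinl j) fun h' => h ?_⟩
    exact Sum.inl_injective (e.symm.injective h')
  · simpa using fun h => hcl' _ (hinr j) _ (hinl i) h.symm
  · simpa using fun h => hcl' _ (hinr i) _ (hinl j) h
  · rw [sum_adj_inr]; rfl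

lemma isExtremalGraph_congr [Fintype V] [Fintype W] {U : Type*} {F : SimpleGraph U}
    {H : SimpleGraph W} (e : G ≃g H) : IsExtremalGraph F G ↔ IsExtremalGraph F H := by
  rw [IsExtremalGraph, IsExtremalGraph, free_congr_right e, ncard_edgeSet_congr e,
    Fintype.card_congr e.toEquiv]

lemma isExtremalGraph_twoPaths_iff [Fintype V] {n : ℕ} (hn : 14 ≤ n) (hV : Fintype.card V = n) :
    IsExtremalGraph (twoPaths 7) G ↔
      ¬ G.HasTwoPaths ∧ G.degSum univ = max (twiceBracket n) (10 * n - 28) := by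
  rw [IsExtremalGraph, twoPaths_free_iff, hV, ← two_mul_extremalNumber_twoPaths hn, degSum_univ]
  refine and_congr_right fun _ => ?_
  omega

/-- A seven-vertex path in `H` is disjoint from one in K₁₃, so the two freeness conditions agree.
The edge counts agree because up to n = 22 the bracket attains the maximum. -/
lemma isExtremalGraph_top_sum_iff {n : ℕ} (hn : 14 ≤ n) (hn' : n ≤ 22)
    (H : SimpleGraph (Fin (n - 13))) :
    IsExtremalGraph (twoPaths 7) ((⊤ : SimpleGraph (Fin 13)) ⊕g H) ↔
      IsExtremalGraph (pathGraph 7) H := by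
  obtain ⟨c1, c2, -⟩ := twiceBracket_cmp hn
  have hmax : max (twiceBracket n) (10 * n - 28) = twiceBracket n := max_eq_left (by omega)
  have hex := two_mul_extremalNumber_pathGraph (m := n - 13) (by omega)
  have hnc := two_mul_ncard_cliques_sum H
  rw [isExtremalGraph_twoPaths_iff hn (by simp; omega), hmax, degSum_univ, IsExtremalGraph,
    pathGraph_free_iff, Fintype.card_fin, hnc, twiceBracket]
  constructor
  · rintro ⟨h1, h2⟩
    refine ⟨fun hP => h1 ?_, by omega⟩
    obtain ⟨l, hl, hl7⟩ := hP
    have hl' : ((⊤ : SimpleGraph (Fin 13)) ⊕g H).HasPathIn (univ.map Function.Embedding.inr) 7 :=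
      ⟨l.map Sum.inr, ⟨(List.isChain_map _).2 (hl.chain.imp fun _ _ h => sum_adj_inr.2 h),
        hl.nodup.map Sum.inr_injective, fun x hx => by
          obtain ⟨y, -, rfl⟩ := List.mem_map.1 hx
          exact Finset.mem_map.2 ⟨y, Finset.mem_univ _, rfl⟩⟩, by simpa using hl7⟩
    have hK : ((⊤ : SimpleGraph (Fin 13)) ⊕g H).HasPathIn (univ.map Function.Embedding.inl) 7 := by
      refine (hasPathIn_card_of_forall_adj fun x hx y hy hxy => ?_).of_le (by simp)
      obtain ⟨i, -, rfl⟩ := Finset.mem_map.1 hx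
      obtain ⟨j, -, rfl⟩ := Finset.mem_map.1 hy
      exact sum_adj_inl.2 fun h => hxy (congrArg _ h)
    refine HasTwoPaths.of_disjoint hK hl' (Finset.disjoint_left.2 fun x hx hx' => ?_)
    obtain ⟨i, -, rfl⟩ := Finset.mem_map.1 hx
    obtain ⟨j, -, h⟩ := Finset.mem_map.1 hx'
    exact Sum.inr_ne_inl h
  · rintro ⟨h1, h2⟩
    exact ⟨not_hasTwoPaths_sum (by simp) h1, by omega⟩

end

end SimpleGraph

theorem theorem1p9 (n : ℕ) (hn : 14 ≤ n) :
    extremalNumber n (twoPaths 7) = max (pathBracket n 14 7) (5 * n - 14) ∧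
    (∀ r : ℕ, r < 6 → n - 13 ≡ r [MOD 6] →
      (pathBracket n 14 7 : ℚ) = (5 * n + 91 + r * (r - 6)) / 2) ∧
    (∀ (V : Type*) [Fintype V] (G : SimpleGraph V), Fintype.card V = n →
      (IsExtremalGraph (twoPaths 7) G ↔
        (n ≤ 22 ∧ ∃ H : SimpleGraph (Fin (n - 13)), IsExtremalGraph (pathGraph 7) H ∧
          Nonempty (G ≃g ((⊤ : SimpleGraph (Fin 13)) ⊕g H))) ∨
        (22 ≤ n ∧ Nonempty (G ≃g graphJoin (⊤ : SimpleGraph (Fin 5))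
          ((⊤ : SimpleGraph (Fin 2)) ⊕g (⊥ : SimpleGraph (Fin (n - 7)))))))) := by
  refine ⟨?_, fun r hr h => pathBracket_eq hn hr h, fun V _ G hV => ⟨fun h => ?_, ?_⟩⟩
  · have h1 := two_mul_extremalNumber_twoPaths hn
    have h2 := two_mul_pathBracket hn
    omega
  · obtain ⟨hG, hD⟩ := (isExtremalGraph_twoPaths_iff hn hV).1 h
    rcases (degSum_univ_le_and_eq hV hn hG).2 hD with
      ⟨hn', Z, hZ, hZD, hcl⟩ | ⟨hn', S, a, b, hF⟩
    · obtain ⟨H, ⟨e⟩⟩ := exists_iso_top_sum (m := n - 13) hZ (by omega)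
        (degSum_eq_iff.1 (by rw [hZD, hZ])) hcl
      exact Or.inl ⟨hn', H, (isExtremalGraph_top_sum_iff hn hn' H).1
        ((isExtremalGraph_congr e).1 h), ⟨e⟩⟩
    · refine Or.inr ⟨hn', hF.nonempty_iso (isJoinOn_graphJoin (n - 7)) ?_⟩
      simp only [Fintype.card_sum, Fintype.card_fin]
      omega
  · rintro (⟨hn', H, hH, ⟨e⟩⟩ | ⟨hn', ⟨e⟩⟩)
    · exact (isExtremalGraph_congr e).2 ((isExtremalGraph_top_sum_iff hn hn' H).2 hH)
    · rw [isExtremalGraph_congr e]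
      refine (isExtremalGraph_twoPaths_iff hn ?_).2
        ⟨(isJoinOn_graphJoin (n - 7)).not_hasTwoPaths, ?_⟩
      · simp only [Fintype.card_sum, Fintype.card_fin]
        omega
      · obtain ⟨-, c2, c3⟩ := twiceBracket_cmp hn
        rw [degSum_univ, two_mul_ncard_graphJoin hn, max_eq_right]
        omega
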